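/- Let $P,Q\in L^2([0,\pi])$ be complex-valued and consider the Dirac operator $$Ly=i\begin{pmatrix}1&0\\0&-1\end{pmatrix}\frac{dy}{dx}+v(x)y,\qquad v=\begin{pmatrix}0&P\\Q&0\end{pmatrix},\quad y=\begin{pmatrix}y_1\\y_2\end{pmatrix},$$ on $[0,\pi]$ under boundary conditions ($bc$) $$a_1y_1(0)+b_1y_1(\pi)+a_2y_2(0)+b_2y_2(\pi)=0,\qquad c_1y_1(0)+d_1y_1(\pi)+c_2y_2(0)+d_2y_2(\pi)=0$$ with complex coefficients. The domain of $L_{bc}(v)$ consists of all absolutely continuous $y:[0,\pi]\to\mathbb C^2$ with $y'\in L^2([0,\pi],\mathbb C^2)$ that satisfy $bc$; $L_{bc}(v)$ is regarded as an unbounded operator in $L^2([0,\pi],\mathbb C^2)$, and $L^0_{bc}=L_{bc}(0)$. Let $|A_{ij}|$ be the determinant formed by the $i$-th and $j$-th columns of $$\begin{pmatrix}a_1&b_1&a_2&b_2\\c_1&d_1&c_2&d_2\end{pmatrix},$$ and suppose that $bc$ is regular, i.e. $|A_{14}|\ne0$ and $|A_{23}|\neq0$. Let $z_1,z_2$ be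 the roots, with multiplicity, of $|A_{14}|z^2+(|A_{13}|+|A_{24}|)z+|A_{23}|=0$, and choose $\tau_1,\tau_2\in\mathbb C$ with $z_\nu=e^{i\pi\tau_\nu}$ and $|\mathrm{Re}\,\tau_1-\mathrm{Re}\,\tau_2|\le1$. For $T>0$ and even $N$ put $$R_{NT}=\Big\{x+it:\ \Big|x-\mathrm{Re}\,\frac{\tau_1+\tau_2}{2}\Big|<N+1,\ |t|<T\Big\}.$$ Then there are $N_0$ and $T_0>0$, depending only on $v$, $bc$, $\tau_1,\tau_2$, such that every $\lambda$ with $|\mathrm{Im}\,\lambda|\ge T_0$, and every $\lambda$ with $|\mathrm{Re}\,\lambda-\mathrm{Re}\,\frac{\tau_1+\tau_2}2|=N+1$ for some even $N\ge N_0$, lies in the resolvent sets of both $L_{bc}(v)$ and $L^0_{bc}$. Hence for even $N\ge N_0$ and $T\ge T_0$ the Riesz projections $$S_N=\frac1{2\pi i}\int_{\partial R_{NT}}(\lambda-L_{bc}(v))^{-1}d\lambda,\qquad S_N^0=\frac1{2\pi i}\int_{\partial R_{NT}}(\lambda-L^0_{bc})^{-1}d\lambda$$ are well defined. Moreover, for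 every $F=\begin{pmatrix}F_1\\F_2\end{pmatrix}\in L^2([0,\pi],\mathbb C^2)$ and every $T\ge T_0$, $$\|(S_N-S_N^0)F\|_{L^\infty([0,\pi])}\to0\quad\text{as } N\to\infty,\ N\text{ even},$$ whenever one of the following conditions holds: (a) there is $\beta>1$ with $\sum_{k\in2\mathbb Z}(|F_{1,k}|^2+|F_{2,k}|^2)(\log(e+|k|))^\beta<\infty$, where $F_{j,k}=\frac1\pi\int_0^\pi F_j(x)e^{-ikx}dx$; (b) there is $\beta>1$ with $\sum_{k\in2\mathbb Z}(|p(k)|^2+|q(k)|^2)(\log(e+|k|))^\beta<\infty$, where $p(k)$, $q(k)$ are the Fourier coefficients $\frac1\pi\int_0^\pi P(x)e^{-ikx}dx$, $\frac1\pi\int_0^\pi Q(x)e^{-ikx}dx$. In particular, the convergence holds if $F_1,F_2$ are functions of bounded variation, or if $P,Q$ are functions of bounded variation. -/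

import Mathlib

open MeasureTheory Set Filter Topology
open scoped Real ENNReal

noncomputable section

namespace DiracBVP

/-- The values of the functions considered: column vectors in `ℂ²`. -/
abbrev C2 : Type := EuclideanSpace ℂ (Fin 2)

/-- Lebesgue measure on the interval `[0, π]`. -/
abbrev mu : Measure ℝ := (volume : Measure ℝ).restrict (Icc 0 π)

/-- The Hilbert space `L²([0, π], ℂ²)`. -/
abbrev H : Type := Lp C2 2 mu

/-! ### Boundary conditions -/

/-- The `2 × 2` minor of a `2 × 4` matrix formed by the columns `i` and `j`. -/
def minor (B : Matrix (Fin 2) (Fin 4) ℂ) (i j : Fin 4) : ℂ :=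
  (B.submatrix id ![i, j]).det

/-- The boundary condition with coefficient matrix `B` with rows `(a₁, b₁, a₂, b₂)` and
`(c₁, d₁, c₂, d₂)`:
`a₁ y₁(0) + b₁ y₁(π) + a₂ y₂(0) + b₂ y₂(π) = 0`,
`c₁ y₁(0) + d₁ y₁(π) + c₂ y₂(0) + d₂ y₂(π) = 0`. -/
def SatisfiesBC (B : Matrix (Fin 2) (Fin 4) ℂ) (y : ℝ → C2) : Prop :=
  B.mulVec ![y 0 0, y π 0, y 0 1, y π 1] = 0

/-- Regular boundary conditions: `|A₁₄| ≠ 0` and `|A₂₃| ≠ 0` (columns numbered from `1`). -/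
def IsRegularBC (B : Matrix (Fin 2) (Fin 4) ℂ) : Prop :=
  minor B 0 3 ≠ 0 ∧ minor B 1 2 ≠ 0

/-- `exp (iπτ₁)`, `exp (iπτ₂)` are the two roots, listed with multiplicity, of the characteristic
equation `|A₁₄| z² + (|A₁₃| + |A₂₄|) z + |A₂₃| = 0`, and `|Re τ₁ - Re τ₂| ≤ 1`.
(If the root is double, then `τ₁ = τ₂` follows.) -/
def IsExponentPair (B : Matrix (Fin 2) (Fin 4) ℂ) (τ₁ τ₂ : ℂ) : Prop :=
  (∀ z : ℂ, minor B 0 3 * z ^ 2 + (minor B 0 2 + minor B 1 3) * z + minor B 1 2 =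
    minor B 0 3 * (z - Complex.exp (Complex.I * π * τ₁)) *
      (z - Complex.exp (Complex.I * π * τ₂))) ∧
  |τ₁.re - τ₂.re| ≤ 1

/-! ### The Dirac operator -/

/-- The differential expression `i diag(1, -1) y' + v y` with `v = [[0, P], [Q, 0]]`. -/
def diracExpr (P Q : ℝ → ℂ) (y : ℝ → C2) (x : ℝ) : C2 :=
  !₂[Complex.I * deriv y x 0 + P x * y x 1, -Complex.I * deriv y x 1 + Q x * y x 0]

/-- `y` is absolutely continuous on `[0, π]` with derivative in `L²`, and satisfies the boundary
condition. -/
structure InDomain (B : Matrix (Fin 2) (Fin 4) ℂ) (y : ℝ → C2) : Prop where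
  ac : AbsolutelyContinuousOnInterval y 0 π
  deriv_memLp : MemLp (deriv y) 2 mu
  bc : SatisfiesBC B y

theorem InDomain.ae_differentiableAt {B : Matrix (Fin 2) (Fin 4) ℂ} {y : ℝ → C2}
    (h : InDomain B y) : ∀ᵐ x ∂mu, DifferentiableAt ℝ y x := by
  have h1 := h.ac.boundedVariationOn.ae_differentiableAt_of_mem_uIcc
  rw [uIcc_of_le Real.pi_pos.le] at h1
  exact (ae_restrict_iff' measurableSet_Icc).2 h1

theorem InDomain.zero (B : Matrix (Fin 2) (Fin 4) ℂ) : InDomain B 0 where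
  ac := (LipschitzWith.const (0 : C2)).lipschitzOnWith.absolutelyContinuousOnInterval
  deriv_memLp := by
    have : deriv (0 : ℝ → C2) = 0 := by ext1 x; simp
    rw [this]; exact MemLp.zero
  bc := by
    have : (![(0 : ℂ), 0, 0, 0] : Fin 4 → ℂ) = 0 := by ext i; fin_cases i <;> rfl
    simp [SatisfiesBC, this]

theorem InDomain.add {B : Matrix (Fin 2) (Fin 4) ℂ} {y w : ℝ → C2}
    (hy : InDomain B y) (hw : InDomain B w) : InDomain B (y + w) where
  ac := hy.ac.add hw.ac
  deriv_memLp := by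
    refine (memLp_congr_ae ?_).1 (hy.deriv_memLp.add hw.deriv_memLp)
    filter_upwards [hy.ae_differentiableAt, hw.ae_differentiableAt] with x h1 h2
    simp [deriv_add h1 h2]
  bc := by
    have h1 := hy.bc
    have h2 := hw.bc
    unfold SatisfiesBC at *
    have : (![(y + w) 0 0, (y + w) π 0, (y + w) 0 1, (y + w) π 1] : Fin 4 → ℂ) =
        ![y 0 0, y π 0, y 0 1, y π 1] + ![w 0 0, w π 0, w 0 1, w π 1] := by
      simp
    rw [this, Matrix.mulVec_add, h1, h2, add_zero]

theorem InDomain.smul {B : Matrix (Fin 2) (Fin 4) ℂ} {y : ℝ → C2} (c : ℂ)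
    (hy : InDomain B y) : InDomain B (c • y) where
  ac := hy.ac.const_smul c
  deriv_memLp := by
    refine (memLp_congr_ae ?_).1 (hy.deriv_memLp.const_smul c)
    filter_upwards [hy.ae_differentiableAt] with x h1
    simp [deriv_const_smul c h1]
  bc := by
    have h1 := hy.bc
    unfold SatisfiesBC at *
    have : (![(c • y) 0 0, (c • y) π 0, (c • y) 0 1, (c • y) π 1] : Fin 4 → ℂ) =
        c • ![y 0 0, y π 0, y 0 1, y π 1] := by
      simp
    rw [this, Matrix.mulVec_smul, h1, smul_zero]

/-- The graph of the Dirac operator `L_bc(v)` in `L²([0, π], ℂ²)`. -/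
def diracGraph (B : Matrix (Fin 2) (Fin 4) ℂ) (P Q : ℝ → ℂ) : Submodule ℂ (H × H) where
  carrier := {p | ∃ y : ℝ → C2, InDomain B y ∧ p.1 =ᵐ[mu] y ∧ p.2 =ᵐ[mu] diracExpr P Q y}
  zero_mem' := by
    refine ⟨0, InDomain.zero B, Lp.coeFn_zero C2 2 mu, ?_⟩
    filter_upwards [Lp.coeFn_zero C2 2 mu] with x hx
    have hd : deriv (0 : ℝ → C2) x = 0 := by simp
    change (0 : H) x = _
    rw [hx]
    ext i
    fin_cases i <;> simp [diracExpr, hd]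
  add_mem' := by
    rintro ⟨p₁, p₂⟩ ⟨q₁, q₂⟩ ⟨y, hy, hy1, hy2⟩ ⟨w, hw, hw1, hw2⟩
    refine ⟨y + w, hy.add hw, ?_, ?_⟩
    · exact (Lp.coeFn_add p₁ q₁).trans (hy1.add hw1)
    · filter_upwards [Lp.coeFn_add p₂ q₂, hy2, hw2, hy.ae_differentiableAt,
        hw.ae_differentiableAt] with x h0 h1 h2 h3 h4
      change (p₂ + q₂ : H) x = _
      have hd : deriv (y + w) x = deriv y x + deriv w x := deriv_add h3 h4
      rw [h0, Pi.add_apply, h1, h2]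
      ext i
      fin_cases i <;> simp [diracExpr, hd] <;> ring
  smul_mem' := by
    rintro c ⟨p₁, p₂⟩ ⟨y, hy, hy1, hy2⟩
    refine ⟨c • y, hy.smul c, ?_, ?_⟩
    · exact (Lp.coeFn_smul c p₁).trans (hy1.const_smul c)
    · filter_upwards [Lp.coeFn_smul c p₂, hy2, hy.ae_differentiableAt] with x h0 h1 h3
      change (c • p₂ : H) x = _
      have hd : deriv (c • y) x = c • deriv y x := deriv_const_smul c h3
      rw [h0, Pi.smul_apply, h1]
      ext i
      fin_cases i <;> simp [diracExpr, hd] <;> ring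

/-- The graph is single-valued. -/
theorem diracGraph_singleValued (B : Matrix (Fin 2) (Fin 4) ℂ) (P Q : ℝ → ℂ) (p : H × H)
    (hp : p ∈ diracGraph B P Q) (h0 : p.1 = 0) : p.2 = 0 := by
  obtain ⟨y, hy, h1, h2⟩ := hp
  have hy0 : y =ᵐ[mu] fun _ => (0 : C2) := by
    rw [h0] at h1
    filter_upwards [h1, Lp.coeFn_zero C2 2 mu] with x hx hx0
    rw [← hx, hx0]; rfl
  have hc : ContinuousOn y (Icc 0 π) := by
    simpa [uIcc_of_le Real.pi_pos.le] using hy.ac.continuousOn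
  have hE : EqOn y (fun _ => (0 : C2)) (Icc 0 π) :=
    Measure.eqOn_Icc_of_ae_eq volume Real.pi_pos.ne hy0 hc continuousOn_const
  have hI : ∀ᵐ x ∂mu, x ∈ Ioo 0 π := by
    have : mu = (volume : Measure ℝ).restrict (Ioo 0 π) := restrict_Ioo_eq_restrict_Icc.symm
    rw [this]
    exact ae_restrict_mem measurableSet_Ioo
  apply Lp.ext
  filter_upwards [h2, hI, Lp.coeFn_zero C2 2 mu] with x hx hxI hx0
  have hd : deriv y x = 0 := by
    have : y =ᶠ[𝓝 x] fun _ => (0 : C2) := by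
      filter_upwards [isOpen_Ioo.mem_nhds hxI] with t ht
      exact hE (Ioo_subset_Icc_self ht)
    rw [this.deriv_eq]; simp
  rw [hx, hx0]
  have hyx : y x = 0 := hE (Ioo_subset_Icc_self hxI)
  ext i
  fin_cases i <;> simp [diracExpr, hd, hyx]

/-- The (unbounded) Dirac operator `L_bc(v)`, `v = [[0, P], [Q, 0]]`, in `L²([0, π], ℂ²)`. -/
def diracOp (B : Matrix (Fin 2) (Fin 4) ℂ) (P Q : ℝ → ℂ) : H →ₗ.[ℂ] H :=
  (diracGraph B P Q).toLinearPMap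

theorem diracOp_graph (B : Matrix (Fin 2) (Fin 4) ℂ) (P Q : ℝ → ℂ) :
    (diracOp B P Q).graph = diracGraph B P Q :=
  Submodule.toLinearPMap_graph_eq _ (diracGraph_singleValued B P Q)

/-! ### Resolvents and Riesz projections of unbounded operators -/

section Resolvent

variable {E : Type*} [NormedAddCommGroup E] [NormedSpace ℂ E]

/-- The bounded operator `R` is the inverse of `z - A : dom A → E`. -/
def IsResolventAt (A : E →ₗ.[ℂ] E) (z : ℂ) (R : E →L[ℂ] E) : Prop :=
  (∀ f : E, ∃ h : R f ∈ A.domain, z • R f - A ⟨R f, h⟩ = f) ∧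
  ∀ y : A.domain, R (z • (y : E) - A y) = y

theorem IsResolventAt.unique {A : E →ₗ.[ℂ] E} {z : ℂ} {R S : E →L[ℂ] E}
    (hR : IsResolventAt A z R) (hS : IsResolventAt A z S) : R = S := by
  ext f
  obtain ⟨h, hf⟩ := hR.1 f
  have := hS.2 ⟨R f, h⟩
  rw [hf] at this
  exact this.symm

/-- The resolvent set of `A`. -/
def resolventSetOf (A : E →ₗ.[ℂ] E) : Set ℂ := {z | ∃ R, IsResolventAt A z R}

open Classical in
/-- The resolvent `(z - A)⁻¹`; it is only meaningful for `z` in the resolvent set. -/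
def resolventOf (A : E →ₗ.[ℂ] E) (z : ℂ) : E →L[ℂ] E :=
  if h : ∃ R, IsResolventAt A z R then h.choose else 0

/-- The integral of `f` along the positively oriented boundary of the rectangle
`{x + it : a < x < b, c < t < d}`. -/
def rectIntegral {G : Type*} [NormedAddCommGroup G] [NormedSpace ℂ G]
    (f : ℂ → G) (a b c d : ℝ) : G :=
  (∫ x in a..b, f (x + c * Complex.I)) - (∫ x in a..b, f (x + d * Complex.I)) +
    Complex.I • (∫ t in c..d, f (b + t * Complex.I)) -
    Complex.I • (∫ t in c..d, f (a + t * Complex.I))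

/-- The Riesz projection `(2πi)⁻¹ ∫_{∂R} (λ - A)⁻¹ dλ` for the rectangle
`R = {x + it : |x - m| < N + 1, |t| < T}`. -/
def rieszProj (A : E →ₗ.[ℂ] E) (m N T : ℝ) : E →L[ℂ] E :=
  (2 * π * Complex.I : ℂ)⁻¹ •
    rectIntegral (resolventOf A) (m - (N + 1)) (m + (N + 1)) (-T) T

end Resolvent

/-! ### Conditions on functions -/

/-- `∃ β > 1, ∑_{k ∈ 2ℤ} (|f_k|² + |g_k|²) (log (e + |k|)) ^ β < ∞`, where
`f_k = π⁻¹ ∫₀^π f(x) exp(-ikx) dx`; the index `k ∈ 2ℤ` is written as `k = 2n`, and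
`fourierCoeffOn` uses the characters `exp(2πi n x / π) = exp(i(2n)x)` of the interval `[0, π]`. -/
def LogFourierCondition (f g : ℝ → ℂ) : Prop :=
  ∃ β : ℝ, 1 < β ∧ Summable fun n : ℤ =>
    (‖fourierCoeffOn Real.pi_pos f n‖ ^ 2 + ‖fourierCoeffOn Real.pi_pos g n‖ ^ 2) *
      Real.log (Real.exp 1 + |2 * (n : ℝ)|) ^ β

end DiracBVP

end

open DiracBVP

noncomputable section

namespace DiracBVP

/-! ### Absolutely continuous functions -/

/-! Regard the resolvents R of L_bc(v) and R⁰ of L⁰_bc as operators from L² into continuous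
functions with the sup norm. The proof is a Banach–Steinhaus argument for the maps sending F to the
contour integral of (R - R⁰)F. They are bounded uniformly in N
(`ResolventBounds.norm_rectIntegral_resDiff_le`), and they tend to zero on C¹ functions with support
inside (0, π), which are dense in L² (`ResolventBounds.norm_rectIntegral_resDiff_test_le`). Both
resolvents are holomorphic where |Im λ| is large, so the height of the rectangle can be changed by
Cauchy's theorem and adapted to N: N + 1 for the uniform bound, (N + 1)^(3/4) on test functions.

The uniform bound rests on a pointwise one. With ρ(x) the distance from x to the end points, R⁰ is
dominated by the kernel C exp(-|Im λ| |ρ(x) - ρ(s)|) (`Solves.bound`). Folding by ρ identifies 0 and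
π, which is what makes the kernel insensitive to how the boundary condition couples them. For large
|Im λ| a weighted maximum argument carries this over to R at half the rate, and bounds (R - R⁰)F at
x by a product of folded Laplace transforms of |F| and |P| + |Q| (`fullRes_bound`). The Laplace
transform is bounded on L² as a function of the rate (`lintegral_foldLapE_sq_le`), so this product
is integrable along vertical lines, uniformly in x and N.

Where |Im λ| stays bounded, the vertical sides need two further facts. Since N + 1 is odd, the
characteristic determinant stays away from zero there (`exists_charDetGE`). And although R⁰v is
merely bounded, (R⁰v)² is small for large |λ| (`exists_norm_bsOp_sq_le`): the off-diagonal v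
interchanges the two exponentials exp(±iλx), so R⁰vR⁰ gains a factor 1/|λ| when v is smooth, and a
general v is approximated. Hence 1 - R⁰v is invertible and R is bounded. -/

theorem acoi_clm_comp {E G : Type*} [NormedAddCommGroup E] [NormedSpace ℝ E]
    [NormedAddCommGroup G] [NormedSpace ℝ G] (L : E →L[ℝ] G) {f : ℝ → E} {a b : ℝ}
    (hf : AbsolutelyContinuousOnInterval f a b) :
    AbsolutelyContinuousOnInterval (fun x => L (f x)) a b := by
  unfold AbsolutelyContinuousOnInterval at *
  have h := hf.const_mul ‖L‖
  rw [mul_zero] at h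
  refine squeeze_zero (fun E => Finset.sum_nonneg fun _ _ => dist_nonneg) (fun E => ?_) h
  rw [Finset.mul_sum]
  refine Finset.sum_le_sum fun i _ => ?_
  rw [dist_eq_norm, dist_eq_norm, ← map_sub]
  exact L.le_opNorm _

theorem acoi_const {E : Type*} [NormedAddCommGroup E] (c : E) (a b : ℝ) :
    AbsolutelyContinuousOnInterval (fun _ : ℝ => c) a b :=
  (LipschitzWith.const c).lipschitzOnWith.absolutelyContinuousOnInterval

theorem acoi_integral {f : ℝ → ℂ} {a b c : ℝ} (hf : IntervalIntegrable f volume a b)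
    (hc : c ∈ uIcc a b) : AbsolutelyContinuousOnInterval (fun x => ∫ s in c..x, f s) a b := by
  have hre : IntervalIntegrable (fun s => (f s).re) volume a b :=
    ⟨hf.1.re, hf.2.re⟩
  have him : IntervalIntegrable (fun s => (f s).im) volume a b :=
    ⟨hf.1.im, hf.2.im⟩
  have h1 := acoi_clm_comp Complex.ofRealCLM
    (hre.absolutelyContinuousOnInterval_intervalIntegral hc)
  have h2 := acoi_clm_comp Complex.ofRealCLM
    (him.absolutelyContinuousOnInterval_intervalIntegral hc)
  have h3 := h1.add (h2.const_smul Complex.I)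
  have key : ∀ x ∈ uIcc a b, ∫ s in c..x, f s = Complex.ofRealCLM (∫ s in c..x, (f s).re) +
      Complex.I • Complex.ofRealCLM (∫ s in c..x, (f s).im) := by
    intro x hx
    have hsub : uIcc c x ⊆ uIcc a b := uIcc_subset_uIcc hc hx
    rw [← Complex.ofRealCLM.intervalIntegral_comp_comm (hre.mono_set hsub),
      ← Complex.ofRealCLM.intervalIntegral_comp_comm (him.mono_set hsub),
      ← intervalIntegral.integral_smul, ← intervalIntegral.integral_add]
    · refine intervalIntegral.integral_congr fun s _ => ?_
      simp [mul_comm Complex.I, Complex.re_add_im]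
    · exact ⟨Integrable.ofReal (hre.mono_set hsub).1, Integrable.ofReal (hre.mono_set hsub).2⟩
    · have h : IntervalIntegrable (fun s => Complex.ofRealCLM (f s).im) volume c x :=
        ⟨Integrable.ofReal (him.mono_set hsub).1, Integrable.ofReal (him.mono_set hsub).2⟩
      exact h.smul (r := Complex.I)
  unfold AbsolutelyContinuousOnInterval at *
  refine h3.congr' ?_
  filter_upwards [mem_inf_of_right (mem_principal_self _)] with E hE
  refine Finset.sum_congr rfl fun i hi => ?_
  rw [key _ (hE.1 i hi).1, key _ (hE.1 i hi).2]
  rfl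

theorem acoi_exp (κ : ℂ) (a b : ℝ) :
    AbsolutelyContinuousOnInterval (fun x : ℝ => Complex.exp (κ * x)) a b := by
  refine ContDiffOn.absolutelyContinuousOnInterval (ContDiff.contDiffOn ?_)
  exact Complex.contDiff_exp.comp (contDiff_const.mul Complex.ofRealCLM.contDiff)

theorem hasDerivAt_exp_ofReal (κ : ℂ) (x : ℝ) :
    HasDerivAt (fun x : ℝ => Complex.exp (κ * x)) (κ * Complex.exp (κ * x)) x := by
  have h : HasDerivAt (fun z : ℂ => Complex.exp (κ * z)) (κ * Complex.exp (κ * x)) (x : ℂ) := by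
    have := ((hasDerivAt_id (x : ℂ)).const_mul κ).cexp
    simpa [mul_comm] using this
  exact h.comp_ofReal

theorem ae_mu_iff {p : ℝ → Prop} : (∀ᵐ x ∂mu, p x) ↔ ∀ᵐ x, x ∈ Icc 0 π → p x :=
  ae_restrict_iff' measurableSet_Icc

theorem uIcc_zero_pi : uIcc 0 π = Icc 0 π := uIcc_of_le Real.pi_pos.le

theorem Integrable.intervalIntegrable_mu {E : Type*} [NormedAddCommGroup E] {f : ℝ → E}
    (hf : Integrable f mu) : IntervalIntegrable f volume 0 π :=
  (intervalIntegrable_iff_integrableOn_Icc_of_le Real.pi_pos.le).2 hf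

/-! ### The scalar equation `y' = κ y + h` -/

theorem integrable_exp_mul {h : ℝ → ℂ} (hh : Integrable h mu) (κ : ℂ) (c : ℝ) :
    Integrable (fun s : ℝ => Complex.exp (κ * (c - s)) * h s) mu := by
  have hc : ContinuousOn (fun s : ℝ => Complex.exp (κ * (c - s))) (Icc 0 π) := by fun_prop
  exact IntegrableOn.continuousOn_mul hc hh isCompact_Icc

/-- The function exp(-κx) y(x) minus its expected primitive is absolutely continuous with derivative
zero almost everywhere, hence constant. The base point is free, so that each component can later be
integrated from the end point at which its exponential decays. -/
theorem ode_representation {κ : ℂ} {y h : ℝ → ℂ} (hy : AbsolutelyContinuousOnInterval y 0 π)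
    (hh : Integrable h mu) (hd : ∀ᵐ x ∂mu, HasDerivAt y (κ * y x + h x) x) {a x : ℝ}
    (ha : a ∈ Icc 0 π) (hx : x ∈ Icc 0 π) :
    y x = Complex.exp (κ * (x - a)) * y a + ∫ s in a..x, Complex.exp (κ * (x - s)) * h s := by
  have hI := Integrable.intervalIntegrable_mu (integrable_exp_mul hh κ 0)
  rw [← uIcc_zero_pi] at ha hx
  set g : ℝ → ℂ := fun x => Complex.exp (-κ * x) * y x -
    ∫ s in a..x, Complex.exp (κ * ((0 : ℝ) - s)) * h s with hg
  have hgac : AbsolutelyContinuousOnInterval g 0 π :=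
    ((acoi_exp (-κ) 0 π).smul hy).sub (acoi_integral hI ha)
  obtain ⟨C, hC⟩ := hgac.const_of_ae_hasDerivAt_zero (by
    rw [ae_mu_iff] at hd
    filter_upwards [hd, hI.ae_hasDerivAt_integral] with s h1 h2 hs
    have h3 := ((hasDerivAt_exp_ofReal (-κ) s).mul (h1 (by rwa [← uIcc_zero_pi]))).sub
      (h2 hs a ha)
    refine h3.congr_deriv ?_
    rw [show κ * (((0 : ℝ) : ℂ) - s) = -κ * s by push_cast; ring]
    ring)
  have h1 : Complex.exp (-κ * x) * y x - ∫ s in a..x, Complex.exp (κ * ((0 : ℝ) - s)) * h s =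
      Complex.exp (-κ * a) * y a := by
    have e1 := hC x hx
    have e2 := hC a ha
    simp only [hg, intervalIntegral.integral_same, sub_zero] at e1 e2
    rw [e1, e2]
  have h2 : y x = Complex.exp (κ * x) * (Complex.exp (-κ * x) * y x) := by
    rw [← mul_assoc, ← Complex.exp_add]
    simp
  rw [h2, sub_eq_iff_eq_add.1 h1, mul_add, ← mul_assoc, ← Complex.exp_add,
    ← intervalIntegral.integral_const_mul]
  congr 2
  · congr 1; ring
  · ext s
    rw [← mul_assoc, ← Complex.exp_add]
    congr 2
    push_cast
    ring

theorem ode_exists (κ : ℂ) {h : ℝ → ℂ} (hh : Integrable h mu) {a : ℝ} (ha : a ∈ Icc 0 π) (c : ℂ) :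
    ∃ y : ℝ → ℂ, AbsolutelyContinuousOnInterval y 0 π ∧
      (∀ᵐ x ∂mu, HasDerivAt y (κ * y x + h x) x) ∧ y a = c := by
  have hI := Integrable.intervalIntegrable_mu (integrable_exp_mul hh κ 0)
  rw [← uIcc_zero_pi] at ha
  refine ⟨fun x => Complex.exp (κ * x) * (Complex.exp (-κ * a) * c +
    ∫ s in a..x, Complex.exp (κ * ((0 : ℝ) - s)) * h s),
    (acoi_exp κ 0 π).smul ((acoi_const _ 0 π).add (acoi_integral hI ha)), ?_, ?_⟩
  · rw [ae_mu_iff]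
    filter_upwards [hI.ae_hasDerivAt_integral] with s h2 hs
    rw [← uIcc_zero_pi] at hs
    refine ((hasDerivAt_exp_ofReal κ s).mul ((h2 hs a ha).const_add _)).congr_deriv ?_
    rw [mul_assoc κ, ← mul_assoc _ _ (h s), ← Complex.exp_add]
    simp
  · simp only [intervalIntegral.integral_same, add_zero]
    rw [← mul_assoc, ← Complex.exp_add]
    simp

/-! ### The folded distance -/

/-- The distance from `x ∈ [0, π]` to the end points. -/
def rho (x : ℝ) : ℝ := min x (π - x)

theorem abs_rho_sub_le (x s : ℝ) : |rho x - rho s| ≤ |x - s| := by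
  unfold rho
  refine (abs_min_sub_min_le_max _ _ _ _).trans ?_
  rw [show π - x - (π - s) = -(x - s) by ring, abs_neg, max_self]

@[fun_prop]
theorem continuous_rho : Continuous rho := by unfold rho; fun_prop

/-- The integral of `n` over `[0, π]` against `exp (-τ |ρ(x) - ρ(s)|)`. -/
def foldLap (τ x : ℝ) (n : ℝ → ℝ) : ℝ := ∫ s, Real.exp (-(τ * |rho x - rho s|)) * n s ∂mu

theorem integrable_foldLap {n : ℝ → ℝ} (hn : Integrable n mu) (τ x : ℝ) :
    Integrable (fun s => Real.exp (-(τ * |rho x - rho s|)) * n s) mu := by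
  have hc : ContinuousOn (fun s : ℝ => Real.exp (-(τ * |rho x - rho s|))) (Icc 0 π) := by fun_prop
  exact IntegrableOn.continuousOn_mul hc hn isCompact_Icc

theorem foldLap_mono {n n' : ℝ → ℝ} (hn : Integrable n mu) (hn' : Integrable n' mu)
    (h : ∀ᵐ s ∂mu, n s ≤ n' s) (τ x : ℝ) : foldLap τ x n ≤ foldLap τ x n' := by
  refine integral_mono_ae (integrable_foldLap hn τ x) (integrable_foldLap hn' τ x) ?_
  filter_upwards [h] with s hs
  exact mul_le_mul_of_nonneg_left hs (Real.exp_pos _).le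

theorem foldLap_nonneg {n : ℝ → ℝ} (hn : ∀ s, 0 ≤ n s) (τ x : ℝ) : 0 ≤ foldLap τ x n :=
  integral_nonneg fun s => mul_nonneg (Real.exp_pos _).le (hn s)

/-- The sign condition says that exp(κ(x - s)) decays away from s as s runs from a to x; its modulus
is exp(-|Re κ| |x - s|), and folding does not increase distances. -/
theorem integral_exp_le_foldLap {κ : ℂ} {h : ℝ → ℂ} (hh : Integrable h mu) {a x : ℝ}
    (ha : a ∈ Icc 0 π) (hx : x ∈ Icc 0 π) (hκ : κ.re * (x - a) ≤ 0) :
    ‖∫ s in a..x, Complex.exp (κ * (x - s)) * h s‖ ≤ foldLap |κ.re| x (fun s => ‖h s‖) := by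
  have hI := integrable_foldLap hh.norm |κ.re| x
  have hsub : uIoc a x ⊆ Icc 0 π :=
    uIoc_subset_uIcc.trans ((uIcc_subset_uIcc (by rwa [uIcc_zero_pi]) (by rwa [uIcc_zero_pi])).trans
      uIcc_zero_pi.subset)
  calc ‖∫ s in a..x, Complex.exp (κ * (x - s)) * h s‖
      ≤ ∫ s in uIoc a x, ‖Complex.exp (κ * (x - s)) * h s‖ :=
        intervalIntegral.norm_integral_le_integral_norm_uIoc
    _ ≤ ∫ s in uIoc a x, Real.exp (-(|κ.re| * |rho x - rho s|)) * ‖h s‖ := by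
        refine setIntegral_mono_on ((integrable_exp_mul hh κ x).norm.mono_measure
          (Measure.restrict_mono hsub le_rfl)) (hI.mono_measure
          (Measure.restrict_mono hsub le_rfl)) measurableSet_uIoc fun s hs => ?_
        rw [norm_mul, Complex.norm_exp]
        refine mul_le_mul_of_nonneg_right (Real.exp_le_exp.2 ?_) (norm_nonneg _)
        have h1 : (κ * (x - s)).re = κ.re * (x - s) := by
          simp [Complex.mul_re]
        rw [h1]
        have h2 : |κ.re| * |rho x - rho s| ≤ |κ.re| * |x - s| :=
          mul_le_mul_of_nonneg_left (abs_rho_sub_le _ _) (abs_nonneg _)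
        have h3 : κ.re * (x - s) = -(|κ.re| * |x - s|) := by
          rw [← abs_mul, ← abs_neg, abs_of_nonneg, neg_neg]
          rcases mem_uIoc.1 hs with hs | hs
          · have : κ.re ≤ 0 := by
              by_contra hk
              push Not at hk
              nlinarith [mul_pos hk (sub_pos.2 (hs.1.trans_le hs.2))]
            nlinarith [hs.2]
          · have : 0 ≤ κ.re := by
              by_contra hk
              push Not at hk
              nlinarith [mul_pos_of_neg_of_neg hk (sub_neg.2 (hs.1.trans_le hs.2))]
            nlinarith [hs.1]
        linarith
    _ ≤ foldLap |κ.re| x (fun s => ‖h s‖) :=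
        setIntegral_mono_set hI (Eventually.of_forall fun s => by positivity)
          (LE.le.eventuallyLE hsub)

/-! ### The free problem -/

theorem cramer_bound {a b c d r s α β : ℂ} {M δ G : ℝ} (hδ : 0 < δ) (hD : δ ≤ ‖a * d - b * c‖)
    (ha : ‖a‖ ≤ M) (hb : ‖b‖ ≤ M) (hc : ‖c‖ ≤ M) (hd : ‖d‖ ≤ M) (hr : ‖r‖ ≤ G) (hs : ‖s‖ ≤ G)
    (h₁ : a * α + b * β = r) (h₂ : c * α + d * β = s) :
    ‖α‖ ≤ 2 * M * G / δ ∧ ‖β‖ ≤ 2 * M * G / δ := by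
  have hM : 0 ≤ M := (norm_nonneg _).trans ha
  have e1 : (a * d - b * c) * α = d * r - b * s := by rw [← h₁, ← h₂]; ring
  have e2 : (a * d - b * c) * β = a * s - c * r := by rw [← h₁, ← h₂]; ring
  have key : ∀ u v w : ℂ, ‖u‖ ≤ M → ‖v‖ ≤ M → ∀ γ, (a * d - b * c) * γ = w →
      ‖w‖ ≤ 2 * M * G → ‖γ‖ ≤ 2 * M * G / δ := by
    intro u v w _ _ γ hγ hw
    rw [le_div_iff₀ hδ]
    calc ‖γ‖ * δ ≤ ‖γ‖ * ‖a * d - b * c‖ := by gcongr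
      _ = ‖w‖ := by rw [← hγ, norm_mul, mul_comm]
      _ ≤ _ := hw
  have bd : ∀ u v p q : ℂ, ‖u‖ ≤ M → ‖v‖ ≤ M → ‖p‖ ≤ G → ‖q‖ ≤ G →
      ‖u * p - v * q‖ ≤ 2 * M * G := by
    intro u v p q hu hv hp hq
    calc ‖u * p - v * q‖ ≤ ‖u * p‖ + ‖v * q‖ := norm_sub_le _ _
      _ ≤ M * G + M * G := by
        rw [norm_mul, norm_mul]
        gcongr
      _ = _ := by ring
  exact ⟨key a a _ ha ha _ e1 (bd _ _ _ _ hd hb hr hs), key a a _ ha ha _ e2 (bd _ _ _ _ ha hc hs hr)⟩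

/-- Triangle inequality for the folded distance. It carries contributions of the boundary values
into the interior. -/
theorem exp_mul_foldLap_le {n : ℝ → ℝ} (hn : Integrable n mu) (h0 : ∀ s, 0 ≤ n s) {τ : ℝ}
    (hτ : 0 ≤ τ) (x x' : ℝ) :
    Real.exp (-(τ * |rho x - rho x'|)) * foldLap τ x' n ≤ foldLap τ x n := by
  unfold foldLap
  rw [← integral_const_mul]
  refine integral_mono ((integrable_foldLap hn τ x').const_mul _) (integrable_foldLap hn τ x)
    fun s => ?_
  rw [← mul_assoc, ← Real.exp_add]
  refine mul_le_mul_of_nonneg_right (Real.exp_le_exp.2 ?_) (h0 s)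
  have := mul_le_mul_of_nonneg_left (abs_sub_le (rho x) (rho x') (rho s)) hτ
  linarith

theorem foldLap_add {n n' : ℝ → ℝ} (hn : Integrable n mu) (hn' : Integrable n' mu) (τ x : ℝ) :
    foldLap τ x (fun s => n s + n' s) = foldLap τ x n + foldLap τ x n' := by
  unfold foldLap
  rw [← integral_add (integrable_foldLap hn τ x) (integrable_foldLap hn' τ x)]
  simp_rw [mul_add]

/-- Each component is integrated in its decaying direction: `y₁` from a, `y₂` from the opposite end
π - a. The values there solve a 2 × 2 system whose entries are perturbed only by w with |w| ≤ 1, so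
a lower bound on the determinant controls them by Cramer's rule. Their influence at x decays like
exp(-|Re κ| ρ(x)), which the folded kernel absorbs. -/
theorem system_bound {p₁ q₁ p₂ q₂ : Fin 2 → ℂ} {M δ : ℝ} (hp₁ : ∀ i, ‖p₁ i‖ ≤ M)
    (hq₁ : ∀ i, ‖q₁ i‖ ≤ M) (hp₂ : ∀ i, ‖p₂ i‖ ≤ M) (hq₂ : ∀ i, ‖q₂ i‖ ≤ M) {κ w : ℂ} {a : ℝ}
    (ha : a = 0 ∨ a = π) (hκ : ∀ x ∈ Icc 0 π, κ.re * (x - a) ≤ 0) (hδ : 0 < δ)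
    (hw : w = Complex.exp (κ * (π - 2 * a)))
    (hD : δ ≤ ‖(p₁ 0 + w * q₁ 0) * (p₂ 1 + w * q₂ 1) - (p₂ 0 + w * q₂ 0) * (p₁ 1 + w * q₁ 1)‖)
    {y₁ y₂ h₁ h₂ : ℝ → ℂ} (hy₁ : AbsolutelyContinuousOnInterval y₁ 0 π)
    (hy₂ : AbsolutelyContinuousOnInterval y₂ 0 π) (hh₁ : Integrable h₁ mu)
    (hh₂ : Integrable h₂ mu) (hd₁ : ∀ᵐ x ∂mu, HasDerivAt y₁ (κ * y₁ x + h₁ x) x)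
    (hd₂ : ∀ᵐ x ∂mu, HasDerivAt y₂ (-κ * y₂ x + h₂ x) x)
    (hbc : ∀ i, p₁ i * y₁ a + q₁ i * y₁ (π - a) + p₂ i * y₂ (π - a) + q₂ i * y₂ a = 0)
    {x : ℝ} (hx : x ∈ Icc 0 π) :
    ‖y₁ x‖ + ‖y₂ x‖ ≤ (1 + 8 * M ^ 2 / δ) * foldLap |κ.re| x (fun s => ‖h₁ s‖ + ‖h₂ s‖) := by
  have hM : 0 ≤ M := (norm_nonneg _).trans (hp₁ 0)
  have haI : a ∈ Icc 0 π := by rcases ha with rfl | rfl <;> simp [Real.pi_pos.le]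
  have hbI : π - a ∈ Icc 0 π := by rcases ha with rfl | rfl <;> simp [Real.pi_pos.le]
  have hκ2 : ∀ x ∈ Icc 0 π, (-κ).re * (x - (π - a)) ≤ 0 := by
    intro x hx
    have := hκ (π - x) ⟨by linarith [hx.2], by linarith [hx.1]⟩
    simp only [Complex.neg_re]
    linarith
  have hrho : rho a = 0 ∧ rho (π - a) = 0 := by
    rcases ha with rfl | rfl <;> simp [rho, Real.pi_pos.le]
  have hw1 : ‖w‖ ≤ 1 := by
    rw [hw, Complex.norm_exp, Real.exp_le_one_iff]
    have := hκ (π - a) hbI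
    have e : (κ * (π - 2 * a)).re = κ.re * (π - a - a) := by
      rw [show (π : ℂ) - 2 * a = ((π - a - a : ℝ) : ℂ) by push_cast; ring, Complex.re_mul_ofReal]
    rwa [e]
  set n : ℝ → ℝ := fun s => ‖h₁ s‖ + ‖h₂ s‖ with hn
  have hnI : Integrable n mu := hh₁.norm.add hh₂.norm
  have hn0 : ∀ s, 0 ≤ n s := fun s => by positivity
  set τ := |κ.re|
  have hτ : 0 ≤ τ := abs_nonneg _
  have hadd : ∀ z, foldLap τ z n = foldLap τ z (fun s => ‖h₁ s‖) + foldLap τ z (fun s => ‖h₂ s‖) :=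
    foldLap_add hh₁.norm hh₂.norm τ
  -- values at the opposite end points
  set g₁ := ∫ s in a..(π - a), Complex.exp (κ * ((π - a : ℝ) - s)) * h₁ s with hg₁
  set g₂ := ∫ s in (π - a)..a, Complex.exp (-κ * (a - s)) * h₂ s with hg₂
  have b₁ : ‖g₁‖ ≤ foldLap τ (π - a) (fun s => ‖h₁ s‖) :=
    integral_exp_le_foldLap hh₁ haI hbI (hκ _ hbI)
  have b₂ : ‖g₂‖ ≤ foldLap τ a (fun s => ‖h₂ s‖) := by
    have := integral_exp_le_foldLap hh₂ hbI haI (hκ2 _ haI)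
    rwa [Complex.neg_re, abs_neg] at this
  -- The folded distance vanishes at both ends, so the kernel does not distinguish them; this is
  -- what lets a boundary condition couple 0 with π.
  have hlap : ∀ f : ℝ → ℝ, foldLap τ (π - a) f = foldLap τ a f := by
    intro f; simp only [foldLap, hrho.1, hrho.2]
  have e₁ : y₁ (π - a) = w * y₁ a + g₁ := by
    rw [ode_representation hy₁ hh₁ hd₁ haI hbI, hw]
    congr 4; push_cast; ring
  have e₂ : y₂ a = w * y₂ (π - a) + g₂ := by
    rw [ode_representation hy₂ hh₂ hd₂ hbI haI, hw]
    congr 3; push_cast; ring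
  set G := foldLap τ a n with hG
  have hgG : ‖g₁‖ + ‖g₂‖ ≤ G := by
    rw [hG, hadd, ← hlap (fun s => ‖h₁ s‖)]
    exact add_le_add b₁ b₂
  have hlin : ∀ i, (p₁ i + w * q₁ i) * y₁ a + (p₂ i + w * q₂ i) * y₂ (π - a) =
      -(q₁ i * g₁ + q₂ i * g₂) := by
    intro i
    have := hbc i
    rw [e₁, e₂] at this
    linear_combination this
  have hent : ∀ u v : ℂ, ‖u‖ ≤ M → ‖v‖ ≤ M → ‖u + w * v‖ ≤ 2 * M := by
    intro u v hu hv
    calc ‖u + w * v‖ ≤ ‖u‖ + ‖w * v‖ := norm_add_le _ _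
      _ ≤ M + 1 * M := by rw [norm_mul]; gcongr
      _ = _ := by ring
  have hrhs : ∀ i, ‖-(q₁ i * g₁ + q₂ i * g₂)‖ ≤ M * G := by
    intro i
    rw [norm_neg]
    calc ‖q₁ i * g₁ + q₂ i * g₂‖ ≤ ‖q₁ i * g₁‖ + ‖q₂ i * g₂‖ := norm_add_le _ _
      _ ≤ M * ‖g₁‖ + M * ‖g₂‖ := by
        rw [norm_mul, norm_mul]
        gcongr
        exacts [hq₁ i, hq₂ i]
      _ ≤ M * G := by rw [← mul_add]; gcongr
  -- Entries are at most 2M and right-hand sides at most MG, so Cramer's rule gives 4M²G/δ for each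
  -- unknown.
  obtain ⟨hα, hβ⟩ := cramer_bound hδ hD (hent _ _ (hp₁ 0) (hq₁ 0)) (hent _ _ (hp₂ 0) (hq₂ 0))
    (hent _ _ (hp₁ 1) (hq₁ 1)) (hent _ _ (hp₂ 1) (hq₂ 1)) (hrhs 0) (hrhs 1) (hlin 0) (hlin 1)
  have hexp : ∀ (κ' : ℂ) (c : ℝ), |κ'.re| = τ → κ'.re * (x - c) ≤ 0 → rho c = 0 →
      ‖Complex.exp (κ' * (x - c))‖ ≤ Real.exp (-(τ * |rho x - rho a|)) := by
    intro κ' c h1 h2 h3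
    rw [Complex.norm_exp, Real.exp_le_exp]
    have e : (κ' * (x - c)).re = κ'.re * (x - c) := by simp [Complex.mul_re]
    rw [e, hrho.1, ← h3, ← h1]
    have h4 := mul_le_mul_of_nonneg_left (abs_rho_sub_le x c) (abs_nonneg κ'.re)
    rw [← abs_mul _ (x - c), abs_of_nonpos h2] at h4
    linarith
  have hGx : Real.exp (-(τ * |rho x - rho a|)) * G ≤ foldLap τ x n :=
    exp_mul_foldLap_le hnI hn0 hτ x a
  set E := Real.exp (-(τ * |rho x - rho a|)) with hE
  have f₁ : ‖y₁ x‖ ≤ E * (4 * M ^ 2 * G / δ) + foldLap τ x (fun s => ‖h₁ s‖) := by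
    rw [ode_representation hy₁ hh₁ hd₁ haI hx]
    refine (norm_add_le _ _).trans (add_le_add ?_ (integral_exp_le_foldLap hh₁ haI hx (hκ _ hx)))
    rw [norm_mul]
    refine mul_le_mul (hexp κ a rfl (hκ _ hx) hrho.1) (hα.trans_eq ?_) (norm_nonneg _)
      (Real.exp_pos _).le
    ring
  have f₂ : ‖y₂ x‖ ≤ E * (4 * M ^ 2 * G / δ) + foldLap τ x (fun s => ‖h₂ s‖) := by
    rw [ode_representation hy₂ hh₂ hd₂ hbI hx]
    have hre : |(-κ).re| = τ := by rw [Complex.neg_re, abs_neg]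
    refine (norm_add_le _ _).trans (add_le_add ?_ ?_)
    · rw [norm_mul]
      refine mul_le_mul (hexp (-κ) (π - a) hre (hκ2 _ hx) hrho.2) (hβ.trans_eq ?_)
        (norm_nonneg _) (Real.exp_pos _).le
      ring
    · have := integral_exp_le_foldLap hh₂ hbI hx (hκ2 _ hx)
      rwa [hre] at this
  calc ‖y₁ x‖ + ‖y₂ x‖ ≤ 8 * M ^ 2 / δ * (E * G) + foldLap τ x n := by
        rw [hadd]
        have : 8 * M ^ 2 / δ * (E * G) = E * (4 * M ^ 2 * G / δ) + E * (4 * M ^ 2 * G / δ) := by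
          ring
        linarith
    _ ≤ 8 * M ^ 2 / δ * foldLap τ x n + foldLap τ x n := by gcongr
    _ = _ := by ring

theorem system_exists {p₁ q₁ p₂ q₂ : Fin 2 → ℂ} {κ w : ℂ} {a : ℝ}
    (ha : a = 0 ∨ a = π) (hw : w = Complex.exp (κ * (π - 2 * a)))
    (hD : (p₁ 0 + w * q₁ 0) * (p₂ 1 + w * q₂ 1) - (p₂ 0 + w * q₂ 0) * (p₁ 1 + w * q₁ 1) ≠ 0)
    {h₁ h₂ : ℝ → ℂ} (hh₁ : Integrable h₁ mu) (hh₂ : Integrable h₂ mu) :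
    ∃ y₁ y₂ : ℝ → ℂ, AbsolutelyContinuousOnInterval y₁ 0 π ∧
      AbsolutelyContinuousOnInterval y₂ 0 π ∧
      (∀ᵐ x ∂mu, HasDerivAt y₁ (κ * y₁ x + h₁ x) x) ∧
      (∀ᵐ x ∂mu, HasDerivAt y₂ (-κ * y₂ x + h₂ x) x) ∧
      ∀ i, p₁ i * y₁ a + q₁ i * y₁ (π - a) + p₂ i * y₂ (π - a) + q₂ i * y₂ a = 0 := by
  have haI : a ∈ Icc 0 π := by rcases ha with rfl | rfl <;> simp [Real.pi_pos.le]
  have hbI : π - a ∈ Icc 0 π := by rcases ha with rfl | rfl <;> simp [Real.pi_pos.le]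
  set g₁ := ∫ s in a..(π - a), Complex.exp (κ * ((π - a : ℝ) - s)) * h₁ s with hg₁
  set g₂ := ∫ s in (π - a)..a, Complex.exp (-κ * (a - s)) * h₂ s with hg₂
  set r : Fin 2 → ℂ := fun i => -(q₁ i * g₁ + q₂ i * g₂) with hr
  set D := (p₁ 0 + w * q₁ 0) * (p₂ 1 + w * q₂ 1) - (p₂ 0 + w * q₂ 0) * (p₁ 1 + w * q₁ 1) with hDdef
  -- Cramer's formulas prescribe the starting values at the two opposite ends.
  obtain ⟨y₁, hy₁, hd₁, hv₁⟩ := ode_exists κ hh₁ haI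
    (((p₂ 1 + w * q₂ 1) * r 0 - (p₂ 0 + w * q₂ 0) * r 1) / D)
  obtain ⟨y₂, hy₂, hd₂, hv₂⟩ := ode_exists (-κ) hh₂ hbI
    (((p₁ 0 + w * q₁ 0) * r 1 - (p₁ 1 + w * q₁ 1) * r 0) / D)
  refine ⟨y₁, y₂, hy₁, hy₂, hd₁, hd₂, fun i => ?_⟩
  have e₁ : y₁ (π - a) = w * y₁ a + g₁ := by
    rw [ode_representation hy₁ hh₁ hd₁ haI hbI, hw]
    congr 4; push_cast; ring
  have e₂ : y₂ a = w * y₂ (π - a) + g₂ := by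
    rw [ode_representation hy₂ hh₂ hd₂ hbI haI, hw]
    congr 3; push_cast; ring
  have hlin : (p₁ i + w * q₁ i) * y₁ a + (p₂ i + w * q₂ i) * y₂ (π - a) = r i := by
    rw [hv₁, hv₂, ← mul_div_assoc, ← mul_div_assoc, ← add_div, div_eq_iff hD, hDdef]
    fin_cases i <;> simp only [Fin.zero_eta, Fin.mk_one, Fin.isValue] <;> ring
  rw [e₁, e₂]
  simp only [hr] at hlin
  linear_combination hlin

/-- `y` lies in the domain of the free operator `L⁰` and `(z - L⁰) y = f`. -/
structure Solves (B : Matrix (Fin 2) (Fin 4) ℂ) (z : ℂ) (f y : ℝ → C2) : Prop where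
  inDomain : InDomain B y
  ode : ∀ᵐ x ∂mu, z • y x - diracExpr 0 0 y x = f x

/-- The characteristic determinant as a polynomial in `exp (iπz)`. -/
def charDet (B : Matrix (Fin 2) (Fin 4) ℂ) (w : ℂ) : ℂ :=
  minor B 1 2 + (minor B 0 2 + minor B 1 3) * w + minor B 0 3 * w ^ 2

/-- The reciprocal polynomial of `charDet`, in `exp (-iπz)`. -/
def charDetInv (B : Matrix (Fin 2) (Fin 4) ℂ) (w : ℂ) : ℂ :=
  minor B 0 3 + (minor B 0 2 + minor B 1 3) * w + minor B 1 2 * w ^ 2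

/-- The suitably normalized characteristic determinant at `z` is at least `δ`. -/
def CharDetGE (B : Matrix (Fin 2) (Fin 4) ℂ) (δ : ℝ) (z : ℂ) : Prop :=
  (0 ≤ z.im → δ ≤ ‖charDet B (Complex.exp (Complex.I * z * π))‖) ∧
  (z.im ≤ 0 → δ ≤ ‖charDetInv B (Complex.exp (-(Complex.I * z) * π))‖)

theorem norm_C2_le (u : C2) : ‖u‖ ≤ ‖u 0‖ + ‖u 1‖ := by
  rw [EuclideanSpace.norm_eq, Fin.sum_univ_two]
  refine Real.sqrt_le_iff.2 ⟨by positivity, ?_⟩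
  nlinarith [norm_nonneg (u 0), norm_nonneg (u 1)]

theorem hasDerivAt_coord {y : ℝ → C2} {y' : C2} {x : ℝ} (h : HasDerivAt y y' x) (i : Fin 2) :
    HasDerivAt (fun t => y t i) (y' i) x := by
  have := ((EuclideanSpace.proj (𝕜 := ℂ) i : C2 →L[ℂ] ℂ).restrictScalars ℝ).hasFDerivAt.comp_hasDerivAt x h
  exact this

theorem acoi_coord {y : ℝ → C2} (h : AbsolutelyContinuousOnInterval y 0 π) (i : Fin 2) :
    AbsolutelyContinuousOnInterval (fun t => y t i) 0 π :=
  acoi_clm_comp ((EuclideanSpace.proj (𝕜 := ℂ) i : C2 →L[ℂ] ℂ).restrictScalars ℝ) h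

theorem mk_eq_smul (a b : ℂ) : (!₂[a, b] : C2) = a • !₂[(1 : ℂ), 0] + b • !₂[(0 : ℂ), 1] := by
  ext i; fin_cases i <;> simp

theorem acoi_mk {y₁ y₂ : ℝ → ℂ} (h₁ : AbsolutelyContinuousOnInterval y₁ 0 π)
    (h₂ : AbsolutelyContinuousOnInterval y₂ 0 π) :
    AbsolutelyContinuousOnInterval (fun x => (!₂[y₁ x, y₂ x] : C2)) 0 π := by
  simp_rw [mk_eq_smul (y₁ _)]
  exact (h₁.smul (acoi_const _ 0 π)).add (h₂.smul (acoi_const _ 0 π))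

theorem hasDerivAt_mk {y₁ y₂ : ℝ → ℂ} {d₁ d₂ : ℂ} {x : ℝ} (h₁ : HasDerivAt y₁ d₁ x)
    (h₂ : HasDerivAt y₂ d₂ x) : HasDerivAt (fun x => (!₂[y₁ x, y₂ x] : C2)) !₂[d₁, d₂] x := by
  simp_rw [mk_eq_smul (y₁ _), mk_eq_smul d₁]
  exact (h₁.smul_const _).add (h₂.smul_const _)

theorem diracExpr_zero_apply (y : ℝ → C2) (x : ℝ) :
    diracExpr 0 0 y x = !₂[Complex.I * deriv y x 0, -Complex.I * deriv y x 1] := by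
  simp [diracExpr]

theorem Solves.hasDerivAt {B : Matrix (Fin 2) (Fin 4) ℂ} {z : ℂ} {f y : ℝ → C2}
    (h : Solves B z f y) :
    (∀ᵐ x ∂mu, HasDerivAt (fun t => y t 0) (-(Complex.I * z) * y x 0 + Complex.I * f x 0) x) ∧
    (∀ᵐ x ∂mu, HasDerivAt (fun t => y t 1) (Complex.I * z * y x 1 + -Complex.I * f x 1) x) := by
  constructor
  · filter_upwards [h.ode, h.inDomain.ae_differentiableAt] with x h1 h2
    refine (hasDerivAt_coord h2.hasDerivAt 0).congr_deriv ?_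
    rw [← h1, diracExpr_zero_apply]
    simp only [PiLp.sub_apply, PiLp.smul_apply, smul_eq_mul, Matrix.cons_val_zero]
    linear_combination (deriv y x 0) * Complex.I_mul_I
  · filter_upwards [h.ode, h.inDomain.ae_differentiableAt] with x h1 h2
    refine (hasDerivAt_coord h2.hasDerivAt 1).congr_deriv ?_
    rw [← h1, diracExpr_zero_apply]
    simp only [PiLp.sub_apply, PiLp.smul_apply, smul_eq_mul, Matrix.cons_val_one]
    simp
    linear_combination (deriv y x 1) * Complex.I_mul_I

theorem satisfiesBC_iff (B : Matrix (Fin 2) (Fin 4) ℂ) (y : ℝ → C2) : SatisfiesBC B y ↔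
    ∀ i, B i 0 * y 0 0 + B i 1 * y π 0 + B i 2 * y 0 1 + B i 3 * y π 1 = 0 := by
  unfold SatisfiesBC
  rw [funext_iff]
  refine forall_congr' fun i => ?_
  simp [Matrix.mulVec, dotProduct, Fin.sum_univ_four]

theorem minor_eq (B : Matrix (Fin 2) (Fin 4) ℂ) (i j : Fin 4) :
    minor B i j = B 0 i * B 1 j - B 0 j * B 1 i := by
  simp [minor, Matrix.det_fin_two]

/-- With κ = -iz one has Re κ = Im z. In the upper half plane the first component decays when
followed from π, in the lower one when followed from 0; the two determinants that appear are
`charDet` and `charDetInv`. The constant depends on z only through δ. -/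
theorem Solves.bound (B : Matrix (Fin 2) (Fin 4) ℂ) {δ : ℝ} (hδ : 0 < δ) :
    ∃ C : ℝ, 1 ≤ C ∧ ∀ z, CharDetGE B δ z → ∀ f y : ℝ → C2, Integrable f mu → Solves B z f y →
      ∀ x ∈ Icc 0 π, ‖y x‖ ≤ C * foldLap |z.im| x (fun s => ‖f s‖) := by
  set M : ℝ := ∑ i, ∑ j, ‖B i j‖ with hM
  have hBM : ∀ j i, ‖B i j‖ ≤ M := fun j i =>
    (Finset.single_le_sum (f := fun j => ‖B i j‖) (fun _ _ => norm_nonneg _)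
      (Finset.mem_univ j)).trans (Finset.single_le_sum (f := fun i => ∑ j, ‖B i j‖)
        (fun _ _ => Finset.sum_nonneg fun _ _ => norm_nonneg _) (Finset.mem_univ i))
  refine ⟨2 * (1 + 8 * M ^ 2 / δ), by have : 0 ≤ 8 * M ^ 2 / δ := by positivity
                                      linarith, fun z hz f y hf hy x hx => ?_⟩
  have hf0 : Integrable (fun s => Complex.I * f s 0) mu :=
    ((EuclideanSpace.proj (𝕜 := ℂ) 0 : C2 →L[ℂ] ℂ).integrable_comp hf).const_mul _
  have hf1 : Integrable (fun s => -Complex.I * f s 1) mu :=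
    ((EuclideanSpace.proj (𝕜 := ℂ) 1 : C2 →L[ℂ] ℂ).integrable_comp hf).const_mul _
  have hbc := (satisfiesBC_iff B y).1 hy.inDomain.bc
  obtain ⟨hd1, hd2⟩ := hy.hasDerivAt
  have hre : (-(Complex.I * z)).re = z.im := by simp
  have hac := hy.inDomain.ac
  have key : ‖y x 0‖ + ‖y x 1‖ ≤ (1 + 8 * M ^ 2 / δ) *
      foldLap |z.im| x (fun s => ‖Complex.I * f s 0‖ + ‖-Complex.I * f s 1‖) := by
    rw [← hre]
    rcases le_total 0 z.im with him | him
    · refine system_bound (hBM 1) (hBM 0) (hBM 2) (hBM 3) (a := π) (Or.inr rfl)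
        (fun t ht => ?_) hδ (w := Complex.exp (Complex.I * z * π)) (by congr 1; ring)
        ((hz.1 him).trans_eq ?_) (acoi_coord hac 0) (acoi_coord hac 1) hf0 hf1 hd1
        (by simpa using hd2) (fun i => ?_) hx
      · rw [hre]; exact mul_nonpos_of_nonneg_of_nonpos him (sub_nonpos.2 ht.2)
      · simp only [charDet, minor_eq]; congr 1; ring
      · simp only [sub_self]; linear_combination hbc i
    · refine system_bound (hBM 0) (hBM 1) (hBM 3) (hBM 2) (a := 0) (Or.inl rfl)
        (fun t ht => ?_) hδ (w := Complex.exp (-(Complex.I * z) * π)) (by simp)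
        ((hz.2 him).trans_eq ?_) (acoi_coord hac 0) (acoi_coord hac 1) hf0 hf1 hd1
        (by simpa using hd2) (fun i => ?_) hx
      · rw [hre]; exact mul_nonpos_of_nonpos_of_nonneg him (sub_nonneg.2 ht.1)
      · simp only [charDetInv, minor_eq]; congr 1; ring
      · simp only [sub_zero]; linear_combination hbc i
  calc ‖y x‖ ≤ ‖y x 0‖ + ‖y x 1‖ := norm_C2_le _
    _ ≤ _ := key
    _ ≤ (1 + 8 * M ^ 2 / δ) * foldLap |z.im| x (fun s => ‖f s‖ + ‖f s‖) := by
      refine mul_le_mul_of_nonneg_left (foldLap_mono (hf0.norm.add hf1.norm)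
        (hf.norm.add hf.norm) (Eventually.of_forall fun s => ?_) _ _) (by positivity)
      simp only [norm_mul, norm_neg, Complex.norm_I, one_mul]
      exact add_le_add (PiLp.norm_apply_le _ _) (PiLp.norm_apply_le _ _)
    _ = _ := by rw [foldLap_add hf.norm hf.norm]; ring

/-! ### Existence and uniqueness for the free boundary value problem -/

theorem memLp_of_acoi {E : Type*} [NormedAddCommGroup E] {y : ℝ → E}
    (h : AbsolutelyContinuousOnInterval y 0 π) : MemLp y 2 mu := by
  have hc : ContinuousOn y (Icc 0 π) := by simpa [uIcc_zero_pi] using h.continuousOn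
  obtain ⟨C, hC⟩ := isCompact_Icc.exists_bound_of_continuousOn hc
  exact MemLp.of_bound (hc.aestronglyMeasurable_of_isCompact isCompact_Icc measurableSet_Icc) C
    ((ae_restrict_iff' measurableSet_Icc).2 (Eventually.of_forall hC))

theorem memLp_coord {f : ℝ → C2} (hf : MemLp f 2 mu) (i : Fin 2) :
    MemLp (fun s => f s i) 2 mu :=
  (EuclideanSpace.proj (𝕜 := ℂ) i : C2 →L[ℂ] ℂ).comp_memLp' hf

theorem memLp_mk {f g : ℝ → ℂ} (hf : MemLp f 2 mu) (hg : MemLp g 2 mu) :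
    MemLp (fun s => (!₂[f s, g s] : C2)) 2 mu := by
  simp_rw [mk_eq_smul (f _)]
  have h (c : C2) : MemLp (fun s => f s • c) 2 mu ∧ MemLp (fun s => g s • c) 2 mu :=
    ⟨((ContinuousLinearMap.toSpanSingleton ℂ c).comp_memLp' hf),
      ((ContinuousLinearMap.toSpanSingleton ℂ c).comp_memLp' hg)⟩
  exact (h _).1.add (h _).2

theorem Solves.exists (B : Matrix (Fin 2) (Fin 4) ℂ) {δ : ℝ} (hδ : 0 < δ) {z : ℂ}
    (hz : CharDetGE B δ z) {f : ℝ → C2} (hf2 : MemLp f 2 mu) : ∃ y, Solves B z f y := by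
  have hf : Integrable f mu := hf2.integrable one_le_two
  have hf0 : MemLp (fun s => Complex.I * f s 0) 2 mu := (memLp_coord hf2 0).const_mul _
  have hf1 : MemLp (fun s => -Complex.I * f s 1) 2 mu := (memLp_coord hf2 1).const_mul _
  have key : ∃ y₁ y₂ : ℝ → ℂ, AbsolutelyContinuousOnInterval y₁ 0 π ∧
      AbsolutelyContinuousOnInterval y₂ 0 π ∧
      (∀ᵐ x ∂mu, HasDerivAt y₁ (-(Complex.I * z) * y₁ x + Complex.I * f x 0) x) ∧
      (∀ᵐ x ∂mu, HasDerivAt y₂ (-(-(Complex.I * z)) * y₂ x + -Complex.I * f x 1) x) ∧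
      ∀ i, B i 0 * y₁ 0 + B i 1 * y₁ π + B i 2 * y₂ 0 + B i 3 * y₂ π = 0 := by
    rcases le_total 0 z.im with him | him
    · obtain ⟨y₁, y₂, h1, h2, h3, h4, h5⟩ := system_exists (p₁ := fun i => B i 1)
        (q₁ := fun i => B i 0) (p₂ := fun i => B i 2) (q₂ := fun i => B i 3) (a := π)
        (κ := -(Complex.I * z)) (w := Complex.exp (Complex.I * z * π)) (Or.inr rfl)
        (by congr 1; ring) (norm_pos_iff.1 (hδ.trans_le ((hz.1 him).trans_eq (by
          simp only [charDet, minor_eq]; congr 1; ring)))) (hf0.integrable one_le_two)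
        (hf1.integrable one_le_two)
      refine ⟨y₁, y₂, h1, h2, h3, h4, fun i => ?_⟩
      have := h5 i
      rw [sub_self] at this
      linear_combination this
    · obtain ⟨y₁, y₂, h1, h2, h3, h4, h5⟩ := system_exists (p₁ := fun i => B i 0)
        (q₁ := fun i => B i 1) (p₂ := fun i => B i 3) (q₂ := fun i => B i 2) (a := 0)
        (κ := -(Complex.I * z)) (w := Complex.exp (-(Complex.I * z) * π)) (Or.inl rfl)
        (by simp) (norm_pos_iff.1 (hδ.trans_le ((hz.2 him).trans_eq (by
          simp only [charDetInv, minor_eq]; congr 1; ring)))) (hf0.integrable one_le_two)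
        (hf1.integrable one_le_two)
      refine ⟨y₁, y₂, h1, h2, h3, h4, fun i => ?_⟩
      have := h5 i
      rw [sub_zero] at this
      linear_combination this
  obtain ⟨y₁, y₂, h1, h2, h3, h4, h5⟩ := key
  have hder : ∀ᵐ x ∂mu, HasDerivAt (fun x => (!₂[y₁ x, y₂ x] : C2))
      !₂[-(Complex.I * z) * y₁ x + Complex.I * f x 0,
        -(-(Complex.I * z)) * y₂ x + -Complex.I * f x 1] x := by
    filter_upwards [h3, h4] with x e1 e2 using hasDerivAt_mk e1 e2
  refine ⟨fun x => !₂[y₁ x, y₂ x], ⟨acoi_mk h1 h2, ?_, ?_⟩, ?_⟩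
  · refine (memLp_congr_ae (?_ : _ =ᵐ[mu] fun x => (!₂[-(Complex.I * z) * y₁ x + Complex.I * f x 0,
        -(-(Complex.I * z)) * y₂ x + -Complex.I * f x 1] : C2))).2 ?_
    · filter_upwards [hder] with x hx using hx.deriv
    · exact memLp_mk (((memLp_of_acoi h1).const_mul _).add hf0)
        (((memLp_of_acoi h2).const_mul _).add hf1)
  · rw [satisfiesBC_iff]
    simpa using h5
  · filter_upwards [hder] with x hx
    rw [diracExpr_zero_apply, hx.deriv]
    ext i
    fin_cases i
    · simp
      linear_combination (z * y₁ x - f x 0) * Complex.I_mul_I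
    · simp
      linear_combination (z * y₂ x - f x 1) * Complex.I_mul_I

theorem Solves.add {B : Matrix (Fin 2) (Fin 4) ℂ} {z : ℂ} {f g y w : ℝ → C2}
    (hy : Solves B z f y) (hw : Solves B z g w) : Solves B z (f + g) (y + w) where
  inDomain := hy.inDomain.add hw.inDomain
  ode := by
    filter_upwards [hy.ode, hw.ode, hy.inDomain.ae_differentiableAt,
      hw.inDomain.ae_differentiableAt] with x h1 h2 h3 h4
    rw [Pi.add_apply, Pi.add_apply, ← h1, ← h2]
    simp only [diracExpr_zero_apply, deriv_add h3 h4]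
    ext i
    fin_cases i <;> simp <;> ring

theorem Solves.smul {B : Matrix (Fin 2) (Fin 4) ℂ} {z : ℂ} {f y : ℝ → C2} (c : ℂ)
    (hy : Solves B z f y) : Solves B z (c • f) (c • y) where
  inDomain := hy.inDomain.smul c
  ode := by
    filter_upwards [hy.ode, hy.inDomain.ae_differentiableAt] with x h1 h3
    rw [Pi.smul_apply, Pi.smul_apply, ← h1]
    simp only [diracExpr_zero_apply, deriv_const_smul c h3]
    ext i
    fin_cases i <;> simp <;> ring

theorem Solves.congr_right {B : Matrix (Fin 2) (Fin 4) ℂ} {z : ℂ} {f g y : ℝ → C2}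
    (hy : Solves B z f y) (h : f =ᵐ[mu] g) : Solves B z g y where
  inDomain := hy.inDomain
  ode := by filter_upwards [hy.ode, h] with x h1 h2 using h1.trans h2

theorem acoi_congr {E : Type*} [NormedAddCommGroup E] {y w : ℝ → E}
    (hy : AbsolutelyContinuousOnInterval y 0 π) (h : EqOn y w (Icc 0 π)) :
    AbsolutelyContinuousOnInterval w 0 π := by
  rw [← uIcc_zero_pi] at h
  unfold AbsolutelyContinuousOnInterval at *
  refine hy.congr' ?_
  filter_upwards [mem_inf_of_right (mem_principal_self _)] with E hE
  refine Finset.sum_congr rfl fun i hi => ?_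
  rw [h (hE.1 i hi).1, h (hE.1 i hi).2]

theorem ae_mem_Ioo : ∀ᵐ x ∂mu, x ∈ Ioo 0 π := by
  have : mu = (volume : Measure ℝ).restrict (Ioo 0 π) := restrict_Ioo_eq_restrict_Icc.symm
  rw [this]
  exact ae_restrict_mem measurableSet_Ioo

theorem ae_deriv_eq {y w : ℝ → C2} (h : EqOn y w (Icc 0 π)) : deriv y =ᵐ[mu] deriv w := by
  filter_upwards [ae_mem_Ioo] with x hx
  refine EventuallyEq.deriv_eq ?_
  filter_upwards [isOpen_Ioo.mem_nhds hx] with t ht using h (Ioo_subset_Icc_self ht)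

theorem InDomain.congr {B : Matrix (Fin 2) (Fin 4) ℂ} {y w : ℝ → C2} (hy : InDomain B y)
    (h : EqOn y w (Icc 0 π)) : InDomain B w where
  ac := acoi_congr hy.ac h
  deriv_memLp := (memLp_congr_ae (ae_deriv_eq h)).1 hy.deriv_memLp
  bc := by
    have := hy.bc
    unfold SatisfiesBC at *
    rwa [h ⟨le_rfl, Real.pi_pos.le⟩, h ⟨Real.pi_pos.le, le_rfl⟩] at this

theorem Solves.congr_left {B : Matrix (Fin 2) (Fin 4) ℂ} {z : ℂ} {f y w : ℝ → C2}
    (hy : Solves B z f y) (h : EqOn y w (Icc 0 π)) : Solves B z f w where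
  inDomain := hy.inDomain.congr h
  ode := by
    filter_upwards [hy.ode, ae_deriv_eq h, ae_mem_Ioo] with x h1 h2 h3
    rw [diracExpr_zero_apply, ← h2, ← h (Ioo_subset_Icc_self h3), ← h1, diracExpr_zero_apply]

/-- The difference solves the problem with zero right-hand side, and the a priori bound then forces
it to vanish. -/
theorem Solves.eqOn {B : Matrix (Fin 2) (Fin 4) ℂ} {δ : ℝ} (hδ : 0 < δ) {z : ℂ}
    (hz : CharDetGE B δ z) {f y w : ℝ → C2} (hy : Solves B z f y) (hw : Solves B z f w) :
    EqOn y w (Icc 0 π) := by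
  obtain ⟨C, hC1, hC⟩ := Solves.bound B hδ
  have h0 := (hy.add (hw.smul (-1))).congr_right (g := 0) (Eventually.of_forall fun x => by simp)
  intro x hx
  have := hC z hz _ _ (integrable_zero _ _ _) h0 x hx
  have h1 : foldLap |z.im| x (fun s => ‖(0 : ℝ → C2) s‖) = 0 := by simp [foldLap]
  rw [h1, mul_zero] at this
  have h2 := norm_le_zero_iff.1 this
  simpa [add_neg_eq_zero] using h2

/-! ### Estimates for the folded Laplace transform -/

theorem lintegral_comp_abs_eq (h : ℝ → ℝ≥0∞) :
    ∫⁻ r, h |r| = 2 * ∫⁻ r in Ioi 0, h r := by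
  have h1 : ∫⁻ r, h |r| = (∫⁻ r in Iic 0, h |r|) + ∫⁻ r in Ioi 0, h |r| := by
    rw [← compl_Iic, lintegral_add_compl _ measurableSet_Iic]
  have h2 : ∫⁻ r in Ioi 0, h |r| = ∫⁻ r in Ioi 0, h r :=
    setLIntegral_congr_fun measurableSet_Ioi fun r hr => by simp only [abs_of_pos (mem_Ioi.1 hr)]
  have h3 : ∫⁻ r in Iic 0, h |r| = ∫⁻ r in Ioi 0, h r := by
    rw [← h2, ← setLIntegral_congr Iio_ae_eq_Iic, ← lintegral_indicator measurableSet_Iio,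
      ← lintegral_indicator measurableSet_Ioi, ← lintegral_neg_eq_self]
    congr 1
    ext r
    simp [indicator_apply]
  rw [h1, h2, h3, two_mul]

/-- At each s the value ρ(s) is s or π - s, so the integrand is dominated by two translated even
functions, each of which counts the half-line twice. -/
theorem lintegral_comp_rho_le (h : ℝ → ℝ≥0∞) (hm : Measurable h) (x : ℝ) :
    ∫⁻ s, h |rho x - rho s| ∂mu ≤ 4 * ∫⁻ r in Ioi 0, h r := by
  calc ∫⁻ s, h |rho x - rho s| ∂mu ≤ ∫⁻ s, h |rho x - rho s| := setLIntegral_le_lintegral _ _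
    _ ≤ ∫⁻ s, (h |rho x - s| + h |(π - rho x) - s|) := by
      refine lintegral_mono fun s => ?_
      rcases min_choice s (π - s) with hs | hs
      · rw [show rho s = s from hs]; exact le_self_add
      · rw [show rho s = π - s from hs, ← abs_neg,
          show -(rho x - (π - s)) = π - rho x - s by ring]
        exact le_add_self
    _ = 2 * (2 * ∫⁻ r in Ioi 0, h r) := by
      rw [lintegral_add_left (by fun_prop), lintegral_sub_left_eq_self (fun r => h |r|),
        lintegral_sub_left_eq_self (fun r => h |r|), lintegral_comp_abs_eq, ← two_mul]
    _ = _ := by rw [← mul_assoc]; norm_num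

theorem lintegral_exp_Ioi {τ : ℝ} (hτ : 0 < τ) :
    ∫⁻ r in Ioi 0, ENNReal.ofReal (Real.exp (-(τ * r))) = ENNReal.ofReal (1 / τ) := by
  have h := Real.integral_rpow_mul_exp_neg_mul_Ioi one_pos hτ
  simp only [sub_self, Real.rpow_zero, one_mul, Real.rpow_one, Real.Gamma_one, mul_one] at h
  rw [← h, ofReal_integral_eq_lintegral_ofReal]
  · exact Integrable.of_integral_ne_zero (by rw [h]; positivity)
  · exact Eventually.of_forall fun r => (Real.exp_pos _).le

theorem lintegral_rpow_exp_Ioi {τ : ℝ} (hτ : 0 < τ) :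
    ∫⁻ r in Ioi 0, ENNReal.ofReal (r ^ (-(1 / 2) : ℝ) * Real.exp (-(τ * r))) =
      ENNReal.ofReal (√π * τ ^ (-(1 / 2) : ℝ)) := by
  have h := Real.integral_rpow_mul_exp_neg_mul_Ioi (one_half_pos (α := ℝ)) hτ
  rw [show (1 / 2 - 1 : ℝ) = -(1 / 2) by norm_num, Real.Gamma_one_half_eq, one_div τ,
    Real.inv_rpow hτ.le, ← Real.rpow_neg hτ.le, mul_comm] at h
  rw [← h, ofReal_integral_eq_lintegral_ofReal]
  · exact Integrable.of_integral_ne_zero (by rw [h]; positivity)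
  · filter_upwards [ae_restrict_mem measurableSet_Ioi] with r hr
    have : 0 < r := hr
    positivity

theorem sq_lintegral_mul_le {α : Type*} [MeasurableSpace α] {μ : Measure α} {f g : α → ℝ≥0∞}
    (hf : AEMeasurable f μ) (hg : AEMeasurable g μ) :
    (∫⁻ a, f a * g a ∂μ) ^ 2 ≤ (∫⁻ a, f a ^ 2 ∂μ) * ∫⁻ a, g a ^ 2 ∂μ := by
  have h := ENNReal.lintegral_mul_le_Lp_mul_Lq μ Real.HolderConjugate.two_two hf hg
  have h2 := pow_le_pow_left' h 2
  have e : ∀ t : ℝ≥0∞, (t ^ (1 / 2 : ℝ)) ^ 2 = t := fun t => by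
    rw [← ENNReal.rpow_natCast, ← ENNReal.rpow_mul]; simp
  rw [mul_pow, e, e] at h2
  simpa using h2

/-- The folded Laplace transform as a Lebesgue integral. -/
def foldLapE (τ x : ℝ) (n : ℝ → ℝ) : ℝ≥0∞ :=
  ∫⁻ s, ENNReal.ofReal (Real.exp (-(τ * |rho x - rho s|))) * ‖n s‖ₑ ∂mu

theorem ofReal_foldLap {n : ℝ → ℝ} (hn : Integrable n mu) (h0 : ∀ s, 0 ≤ n s) (τ x : ℝ) :
    ENNReal.ofReal (foldLap τ x n) = foldLapE τ x n := by
  unfold foldLap foldLapE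
  rw [ofReal_integral_eq_lintegral_ofReal (integrable_foldLap hn τ x)
    (Eventually.of_forall fun s => mul_nonneg (Real.exp_pos _).le (h0 s))]
  refine lintegral_congr fun s => ?_
  rw [ENNReal.ofReal_mul (Real.exp_pos _).le, Real.enorm_of_nonneg (h0 s)]

/-- Cauchy–Schwarz against the kernel, whose square has integral O(1/τ). The decay in τ serves the
horizontal sides and the smallness condition in `fullRes_bound`. -/
theorem foldLapE_sq_le {n : ℝ → ℝ} (hn : AEStronglyMeasurable n mu) {τ : ℝ} (hτ : 0 < τ) (x : ℝ) :
    foldLapE τ x n ^ 2 ≤ ENNReal.ofReal (2 / τ) * ∫⁻ s, ‖n s‖ₑ ^ 2 ∂mu := by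
  refine (sq_lintegral_mul_le (by fun_prop) hn.enorm).trans ?_
  gcongr
  calc ∫⁻ s, ENNReal.ofReal (Real.exp (-(τ * |rho x - rho s|))) ^ 2 ∂mu
      = ∫⁻ s, ENNReal.ofReal (Real.exp (-(2 * τ * |rho x - rho s|))) ∂mu := by
        refine lintegral_congr fun s => ?_
        rw [← ENNReal.ofReal_pow (Real.exp_pos _).le, ← Real.exp_nat_mul]
        congr 2; push_cast; ring
    _ ≤ 4 * ∫⁻ r in Ioi 0, ENNReal.ofReal (Real.exp (-(2 * τ * r))) :=
        lintegral_comp_rho_le (fun r => ENNReal.ofReal (Real.exp (-(2 * τ * r)))) (by fun_prop) x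
    _ = ENNReal.ofReal (2 / τ) := by
        rw [lintegral_exp_Ioi (by positivity), ← ENNReal.ofReal_ofNat 4,
          ← ENNReal.ofReal_mul (by norm_num)]
        congr 1; field_simp; norm_num

theorem foldLapE_sq_le' {n : ℝ → ℝ} (hn : AEStronglyMeasurable n mu) {τ : ℝ} (hτ : 0 ≤ τ) (x : ℝ) :
    foldLapE τ x n ^ 2 ≤ ENNReal.ofReal π * ∫⁻ s, ‖n s‖ₑ ^ 2 ∂mu := by
  refine (sq_lintegral_mul_le (by fun_prop) hn.enorm).trans ?_
  gcongr
  calc ∫⁻ s, ENNReal.ofReal (Real.exp (-(τ * |rho x - rho s|))) ^ 2 ∂mu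
      ≤ ∫⁻ s, 1 ∂mu := by
        refine lintegral_mono fun s => ?_
        rw [← ENNReal.ofReal_pow (Real.exp_pos _).le, ENNReal.ofReal_le_one]
        refine pow_le_one₀ (Real.exp_pos _).le (Real.exp_le_one_iff.2 ?_)
        have := mul_nonneg hτ (abs_nonneg (rho x - rho s))
        linarith
    _ = ENNReal.ofReal π := by simp

/-- The weights in the Schur test below cancel only where the folded distance is nonzero, which
excludes at most two points. -/
theorem ae_rho_ne (x : ℝ) : ∀ᵐ s ∂mu, |rho x - rho s| ≠ 0 := by
  refine ae_restrict_of_ae (measure_mono_null (t := {rho x, π - rho x}) (fun s hs => ?_)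
    (Set.Finite.measure_zero (by simp) _))
  have hs' : rho x = rho s := by simpa [sub_eq_zero] using hs
  rcases min_choice s (π - s) with h | h
  · left; rw [hs']; exact h.symm
  · right
    have : rho s = π - s := h
    rw [mem_singleton_iff]
    linarith

/-- Schur test for the Laplace transform. With a the folded distance, write exp(-τa) as the product
of exp(-τa/2) a^(1/4) and exp(-τa/2) a^(-1/4) and apply Cauchy–Schwarz. The integral of a^(-1/2)
exp(-τa) is at most 4√π τ^(-1/2); after Tonelli the τ-integral produces √π a^(-1/2), which cancels
the remaining a^(1/2) and leaves 4π. -/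
theorem lintegral_foldLapE_sq_le {n : ℝ → ℝ} (hn : AEStronglyMeasurable n mu) (x : ℝ) :
    ∫⁻ τ in Ioi 0, foldLapE τ x n ^ 2 ≤ ENNReal.ofReal (4 * π) * ∫⁻ s, ‖n s‖ₑ ^ 2 ∂mu := by
  set a : ℝ → ℝ := fun s => |rho x - rho s| with ha
  have ham : Measurable a := by fun_prop
  have ha0 : ∀ s, 0 ≤ a s := fun s => abs_nonneg _
  set F : ℝ → ℝ → ℝ≥0∞ := fun τ s => ENNReal.ofReal (Real.exp (-(τ * a s)) * a s ^ (1 / 2 : ℝ)) *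
    ‖n s‖ₑ ^ 2 with hF
  have hFm : AEMeasurable (Function.uncurry fun τ s =>
      ENNReal.ofReal (4 * (√π * τ ^ (-(1 / 2) : ℝ))) * F τ s)
      ((volume.restrict (Ioi 0)).prod mu) := by
    have h1 : AEMeasurable (fun p : ℝ × ℝ => ‖n p.2‖ₑ ^ 2) ((volume.restrict (Ioi 0)).prod mu) :=
      (hn.enorm.pow_const 2).comp_quasiMeasurePreserving Measure.quasiMeasurePreserving_snd
    have h2 : Measurable fun p : ℝ × ℝ => ENNReal.ofReal (4 * (√π * p.1 ^ (-(1 / 2) : ℝ))) := by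
      fun_prop
    have h3 : Measurable fun p : ℝ × ℝ =>
        ENNReal.ofReal (Real.exp (-(p.1 * a p.2)) * a p.2 ^ (1 / 2 : ℝ)) := by
      fun_prop
    exact h2.aemeasurable.mul (h3.aemeasurable.mul h1)
  have hsplit : ∀ τ ∈ Ioi (0 : ℝ), foldLapE τ x n ^ 2 ≤
      ∫⁻ s, ENNReal.ofReal (4 * (√π * τ ^ (-(1 / 2) : ℝ))) * F τ s ∂mu := by
    intro τ hτ
    have hτ' : 0 < τ := hτ
    have e : foldLapE τ x n = ∫⁻ s, (ENNReal.ofReal (Real.exp (-(τ * a s) / 2) *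
        a s ^ (1 / 4 : ℝ)) * ‖n s‖ₑ) * ENNReal.ofReal (Real.exp (-(τ * a s) / 2) *
          a s ^ (-(1 / 4) : ℝ)) ∂mu := by
      refine lintegral_congr_ae ?_
      filter_upwards [ae_rho_ne x] with s hs
      have hs' : 0 < a s := lt_of_le_of_ne (ha0 s) (Ne.symm hs)
      rw [mul_right_comm, ← ENNReal.ofReal_mul (by positivity)]
      congr 2
      rw [mul_mul_mul_comm, ← Real.exp_add, ← Real.rpow_add hs']
      simp [ha]
    rw [e]
    refine (sq_lintegral_mul_le (by fun_prop) (by fun_prop)).trans ?_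
    rw [mul_comm, lintegral_const_mul' _ _ ENNReal.ofReal_ne_top]
    gcongr ?_ * ?_
    · calc ∫⁻ s, ENNReal.ofReal (Real.exp (-(τ * a s) / 2) * a s ^ (-(1 / 4) : ℝ)) ^ 2 ∂mu
          = ∫⁻ s, ENNReal.ofReal (a s ^ (-(1 / 2) : ℝ) * Real.exp (-(τ * a s))) ∂mu := by
            refine lintegral_congr fun s => ?_
            rw [← ENNReal.ofReal_pow (mul_nonneg (Real.exp_pos _).le (Real.rpow_nonneg (ha0 s) _)),
              mul_pow, ← Real.exp_nat_mul, ← Real.rpow_mul_natCast (ha0 s), mul_comm]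
            congr 3
            · norm_num
            · push_cast; ring
        _ ≤ 4 * ∫⁻ r in Ioi 0, ENNReal.ofReal (r ^ (-(1 / 2) : ℝ) * Real.exp (-(τ * r))) :=
            lintegral_comp_rho_le
              (fun r => ENNReal.ofReal (r ^ (-(1 / 2) : ℝ) * Real.exp (-(τ * r)))) (by fun_prop) x
        _ = _ := by
            rw [lintegral_rpow_exp_Ioi hτ', ← ENNReal.ofReal_ofNat 4,
              ← ENNReal.ofReal_mul (by norm_num)]
    · refine lintegral_mono fun s => le_of_eq ?_
      rw [mul_pow, ← ENNReal.ofReal_pow (mul_nonneg (Real.exp_pos _).le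
        (Real.rpow_nonneg (ha0 s) _)), mul_pow, ← Real.exp_nat_mul, ← Real.rpow_mul_natCast (ha0 s)]
      congr 4
      · push_cast; ring
      · norm_num
  calc ∫⁻ τ in Ioi 0, foldLapE τ x n ^ 2
      ≤ ∫⁻ τ in Ioi 0, ∫⁻ s, ENNReal.ofReal (4 * (√π * τ ^ (-(1 / 2) : ℝ))) * F τ s ∂mu :=
        setLIntegral_mono' measurableSet_Ioi hsplit
    _ = ∫⁻ s, (∫⁻ τ in Ioi 0, ENNReal.ofReal (4 * (√π * τ ^ (-(1 / 2) : ℝ))) * F τ s) ∂mu :=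
        lintegral_lintegral_swap hFm
    _ ≤ ∫⁻ s, ENNReal.ofReal (4 * π) * ‖n s‖ₑ ^ 2 ∂mu := by
        refine lintegral_mono_ae ?_
        filter_upwards [ae_rho_ne x] with s hs
        have hs' : 0 < a s := lt_of_le_of_ne (ha0 s) (Ne.symm hs)
        have e : ∀ τ ∈ Ioi (0 : ℝ), ENNReal.ofReal (4 * (√π * τ ^ (-(1 / 2) : ℝ))) * F τ s =
            (ENNReal.ofReal (4 * √π * a s ^ (1 / 2 : ℝ)) * ‖n s‖ₑ ^ 2) *
              ENNReal.ofReal (τ ^ (-(1 / 2) : ℝ) * Real.exp (-(a s * τ))) := by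
          intro τ hτ
          have hτ' : 0 < τ := hτ
          simp only [hF]
          rw [← mul_assoc, ← ENNReal.ofReal_mul (by positivity),
            mul_right_comm (ENNReal.ofReal (4 * √π * a s ^ (1 / 2 : ℝ))),
            ← ENNReal.ofReal_mul (by positivity)]
          congr 2
          rw [mul_comm τ (a s)]
          ring
        rw [setLIntegral_congr_fun measurableSet_Ioi e, lintegral_const_mul _ (by fun_prop),
          lintegral_rpow_exp_Ioi hs', mul_right_comm, ← ENNReal.ofReal_mul (by positivity)]
        refine le_of_eq ?_
        congr 2
        have e1 : a s ^ (1 / 2 : ℝ) * a s ^ (-(1 / 2) : ℝ) = 1 := by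
          rw [← Real.rpow_add hs']; simp
        have e2 := Real.mul_self_sqrt Real.pi_pos.le
        calc 4 * √π * a s ^ (1 / 2 : ℝ) * (√π * a s ^ (-(1 / 2) : ℝ)) =
            4 * (√π * √π) * (a s ^ (1 / 2 : ℝ) * a s ^ (-(1 / 2) : ℝ)) := by ring
          _ = 4 * π := by rw [e1, e2, mul_one]
    _ = _ := lintegral_const_mul' _ _ ENNReal.ofReal_ne_top

/-! ### Resolvents with values in continuous functions -/

section SupNorm

open BoundedContinuousFunction

theorem lintegral_enorm_sq_eq {E : Type*} [NormedAddCommGroup E] (n : ℝ → E) :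
    ∫⁻ s, ‖n s‖ₑ ^ 2 ∂mu = eLpNorm n 2 mu ^ 2 := by
  rw [eLpNorm_eq_lintegral_rpow_enorm_toReal two_ne_zero ENNReal.ofNat_ne_top,
    ← ENNReal.rpow_natCast, ← ENNReal.rpow_mul]
  simp

theorem le_sqrt_mul_of_ofReal_sq_le {a b c : ℝ} {N : ℝ≥0∞} (ha : 0 ≤ a) (hc : 0 ≤ c) (hN : N ≠ ∞)
    (hb : ENNReal.ofReal a = ENNReal.ofReal b) (hb0 : 0 ≤ b)
    (h : ENNReal.ofReal b ^ 2 ≤ ENNReal.ofReal c * N ^ 2) : a ≤ √c * N.toReal := by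
  have hab : a = b := (ENNReal.ofReal_eq_ofReal_iff ha hb0).1 hb
  have h2 := ENNReal.toReal_mono (by finiteness) h
  rw [ENNReal.toReal_pow, ENNReal.toReal_mul, ENNReal.toReal_pow, ENNReal.toReal_ofReal hb0,
    ENNReal.toReal_ofReal hc] at h2
  rw [hab]
  refine abs_le_of_sq_le_sq' ?_ (by positivity) |>.2
  rwa [mul_pow, Real.sq_sqrt hc]

theorem foldLap_le {n : ℝ → ℝ} (hn : MemLp n 2 mu) (h0 : ∀ s, 0 ≤ n s) {τ : ℝ} (hτ : 0 ≤ τ)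
    (x : ℝ) : foldLap τ x n ≤ √π * (eLpNorm n 2 mu).toReal := by
  have hL := foldLap_nonneg h0 τ x
  refine le_sqrt_mul_of_ofReal_sq_le hL Real.pi_pos.le hn.eLpNorm_ne_top rfl hL ?_
  rw [ofReal_foldLap (hn.integrable one_le_two) h0, ← lintegral_enorm_sq_eq]
  exact foldLapE_sq_le' hn.aestronglyMeasurable hτ x

theorem foldLap_le_sqrt {n : ℝ → ℝ} (hn : MemLp n 2 mu) (h0 : ∀ s, 0 ≤ n s) {τ : ℝ} (hτ : 0 < τ)
    (x : ℝ) : foldLap τ x n ≤ √(2 / τ) * (eLpNorm n 2 mu).toReal := by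
  have hL := foldLap_nonneg h0 τ x
  refine le_sqrt_mul_of_ofReal_sq_le hL (by positivity) hn.eLpNorm_ne_top rfl hL ?_
  rw [ofReal_foldLap (hn.integrable one_le_two) h0, ← lintegral_enorm_sq_eq]
  exact foldLapE_sq_le hn.aestronglyMeasurable hτ x

theorem memLp_norm (f : H) : MemLp (fun s => ‖f s‖) 2 mu := (Lp.memLp f).norm

theorem eLpNorm_norm_toReal (f : H) : (eLpNorm (fun s => ‖f s‖) 2 mu).toReal = ‖f‖ := by
  rw [eLpNorm_norm, Lp.norm_def]

/-! ### Operators -/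

/-- The space in which sup norms are measured. -/
abbrev X : Type := ℝ →ᵇ C2

/-- The retraction of `ℝ` onto `[0, π]`. -/
def clamp (x : ℝ) : ℝ := projIcc 0 π Real.pi_pos.le x

theorem clamp_mem (x : ℝ) : clamp x ∈ Icc 0 π := (projIcc 0 π Real.pi_pos.le x).2

theorem clamp_of_mem {x : ℝ} (hx : x ∈ Icc 0 π) : clamp x = x := by
  unfold clamp; rw [projIcc_of_mem _ hx]

/-- Extending by the end values keeps the sup norm equal to that on [0, π]. Requiring this extension
makes solutions unique as functions on the whole line. -/
theorem exists_clampX {y : ℝ → C2} (hy : ContinuousOn y (Icc 0 π)) :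
    ∃ u : X, ∀ x, u x = y (clamp x) :=
  ⟨(mkOfCompact (⟨(Icc 0 π).domRestrict y, hy.domRestrict⟩ : C(Icc 0 π, C2))).compContinuous
    ⟨projIcc 0 π Real.pi_pos.le, continuous_projIcc⟩, fun _ => rfl⟩

theorem InDomain.continuousOn {B : Matrix (Fin 2) (Fin 4) ℂ} {y : ℝ → C2} (h : InDomain B y) :
    ContinuousOn y (Icc 0 π) := by
  simpa [uIcc_zero_pi] using h.ac.continuousOn

/-- `R` is the resolvent of the free operator at `z`, with values in continuous functions. -/
structure IsFreeRes (B : Matrix (Fin 2) (Fin 4) ℂ) (z : ℂ) (R : H →L[ℂ] X) : Prop where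
  solves : ∀ f : H, Solves B z f (R f)
  clamp_eq : ∀ (f : H) (x : ℝ), R f (clamp x) = R f x

theorem exists_isFreeRes {B : Matrix (Fin 2) (Fin 4) ℂ} {δ : ℝ} (hδ : 0 < δ) {z : ℂ}
    (hz : CharDetGE B δ z) : ∃ R, IsFreeRes B z R := by
  obtain ⟨C, hC1, hC⟩ := Solves.bound B hδ
  have h1 : ∀ f : H, ∃ u : X, Solves B z f u ∧ ∀ x, u (clamp x) = u x := by
    intro f
    obtain ⟨y, hy⟩ := Solves.exists B hδ hz (Lp.memLp f)
    obtain ⟨u, hu⟩ := exists_clampX hy.inDomain.continuousOn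
    refine ⟨u, hy.congr_left fun x hx => by rw [hu, clamp_of_mem hx], fun x => ?_⟩
    rw [hu, hu, clamp_of_mem (clamp_mem x)]
  choose r hr1 hr2 using h1
  have huniq : ∀ (f : H) (u : X), Solves B z f u → (∀ x, u (clamp x) = u x) → r f = u := by
    intro f u h2 h3
    ext1 x
    rw [← hr2, ← h3]
    exact Solves.eqOn hδ hz (hr1 f) h2 (clamp_mem x)
  refine ⟨LinearMap.mkContinuous
    { toFun := r
      map_add' := fun f g => huniq _ _ (((hr1 f).add (hr1 g)).congr_right (Lp.coeFn_add f g).symm)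
        fun x => by simp [hr2]
      map_smul' := fun c f => huniq _ _ (((hr1 f).smul c).congr_right (Lp.coeFn_smul c f).symm)
        fun x => by simp [hr2] } (C * √π) (fun f => ?_), hr1, hr2⟩
  refine (norm_le (by positivity)).2 fun x => ?_
  change ‖r f x‖ ≤ _
  rw [← hr2, mul_assoc]
  refine (hC z hz f (r f) ((Lp.memLp f).integrable one_le_two) (hr1 f) _ (clamp_mem x)).trans ?_
  gcongr
  rw [← eLpNorm_norm_toReal]
  exact foldLap_le (memLp_norm f) (fun _ => norm_nonneg _) (abs_nonneg _) _

open Classical in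
/-- The resolvent of the free operator, with values in continuous functions. -/
def freeRes (B : Matrix (Fin 2) (Fin 4) ℂ) (z : ℂ) : H →L[ℂ] X :=
  if h : ∃ R, IsFreeRes B z R then h.choose else 0

theorem freeRes_spec {B : Matrix (Fin 2) (Fin 4) ℂ} {δ : ℝ} (hδ : 0 < δ) {z : ℂ}
    (hz : CharDetGE B δ z) : IsFreeRes B z (freeRes B z) := by
  have h := exists_isFreeRes hδ hz
  rw [freeRes, dif_pos h]
  exact h.choose_spec

theorem freeRes_unique {B : Matrix (Fin 2) (Fin 4) ℂ} {δ : ℝ} (hδ : 0 < δ) {z : ℂ}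
    (hz : CharDetGE B δ z) {f : H} {u : X} (h : Solves B z f u) (hu : ∀ x, u (clamp x) = u x) :
    freeRes B z f = u := by
  have hs := freeRes_spec hδ hz
  ext1 x
  rw [← hs.clamp_eq, ← hu]
  exact Solves.eqOn hδ hz (hs.solves f) h (clamp_mem x)

theorem freeRes_bound (B : Matrix (Fin 2) (Fin 4) ℂ) {δ : ℝ} (hδ : 0 < δ) :
    ∃ C : ℝ, 1 ≤ C ∧ ∀ z, CharDetGE B δ z → ∀ (f : H), ∀ x ∈ Icc 0 π,
      ‖freeRes B z f x‖ ≤ C * foldLap |z.im| x (fun s => ‖f s‖) := by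
  obtain ⟨C, hC1, hC⟩ := Solves.bound B hδ
  exact ⟨C, hC1, fun z hz f x hx => hC z hz f _ ((Lp.memLp f).integrable one_le_two)
    ((freeRes_spec hδ hz).solves f) x hx⟩

/-- The inclusion of bounded continuous functions into `L²`. -/
def toH : X →L[ℂ] H := BoundedContinuousFunction.toLp 2 mu ℂ

theorem coeFn_toH (u : X) : toH u =ᵐ[mu] u := coeFn_toLp 2 mu ℂ u

/-- The pointwise size of the potential. -/
def potSize (P Q : ℝ → ℂ) (x : ℝ) : ℝ := ‖P x‖ + ‖Q x‖

theorem potSize_nonneg (P Q : ℝ → ℂ) (x : ℝ) : 0 ≤ potSize P Q x := by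
  unfold potSize; positivity

theorem memLp_potSize {P Q : ℝ → ℂ} (hP : MemLp P 2 mu) (hQ : MemLp Q 2 mu) :
    MemLp (potSize P Q) 2 mu := hP.norm.add hQ.norm

theorem norm_pot_le (P Q : ℝ → ℂ) (x : ℝ) (u : C2) :
    ‖(!₂[P x * u 1, Q x * u 0] : C2)‖ ≤ potSize P Q x * ‖u‖ := by
  refine (norm_C2_le _).trans ?_
  simp only [Matrix.cons_val_zero, Matrix.cons_val_one, norm_mul, potSize, add_mul]
  gcongr <;> exact PiLp.norm_apply_le _ _

theorem memLp_pot {P Q : ℝ → ℂ} (hP : MemLp P 2 mu) (hQ : MemLp Q 2 mu) (u : X) :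
    MemLp (fun x => (!₂[P x * u x 1, Q x * u x 0] : C2)) 2 mu := by
  have hu : ∀ i, Continuous fun x => u x i := fun i =>
    (EuclideanSpace.proj (𝕜 := ℂ) i : C2 →L[ℂ] ℂ).continuous.comp u.continuous
  have hb : ∀ i x, ‖u x i‖ ≤ ‖u‖ := fun i x => (PiLp.norm_apply_le _ _).trans (u.norm_coe_le_norm x)
  refine memLp_mk ?_ ?_
  · refine hP.of_le_mul (c := ‖u‖) (hP.1.mul (hu 1).aestronglyMeasurable)
      (Eventually.of_forall fun x => ?_)
    rw [norm_mul, mul_comm]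
    exact mul_le_mul_of_nonneg_right (hb 1 x) (norm_nonneg _)
  · refine hQ.of_le_mul (c := ‖u‖) (hQ.1.mul (hu 0).aestronglyMeasurable)
      (Eventually.of_forall fun x => ?_)
    rw [norm_mul, mul_comm]
    exact mul_le_mul_of_nonneg_right (hb 0 x) (norm_nonneg _)

/-- The product of the potential and a continuous function. -/
def potFun {P Q : ℝ → ℂ} (hP : MemLp P 2 mu) (hQ : MemLp Q 2 mu) (u : X) : H :=
  (memLp_pot hP hQ u).toLp _

theorem coeFn_potFun {P Q : ℝ → ℂ} (hP : MemLp P 2 mu) (hQ : MemLp Q 2 mu) (u : X) :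
    potFun hP hQ u =ᵐ[mu] fun x => (!₂[P x * u x 1, Q x * u x 0] : C2) :=
  (memLp_pot hP hQ u).coeFn_toLp

theorem norm_potFun_le {P Q : ℝ → ℂ} (hP : MemLp P 2 mu) (hQ : MemLp Q 2 mu) (u : X) :
    ‖potFun hP hQ u‖ ≤ (eLpNorm (potSize P Q) 2 mu).toReal * ‖u‖ := by
  have h : ‖potFun hP hQ u‖ ≤ ‖u‖ * ‖(memLp_potSize hP hQ).toLp (potSize P Q)‖ := by
    refine Lp.norm_le_mul_norm_of_ae_le_mul ?_
    filter_upwards [coeFn_potFun hP hQ u, (memLp_potSize hP hQ).coeFn_toLp] with x h1 h2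
    rw [h1, h2, Real.norm_of_nonneg (potSize_nonneg P Q x), mul_comm ‖u‖]
    refine (norm_pot_le P Q x (u x)).trans ?_
    exact mul_le_mul_of_nonneg_left (u.norm_coe_le_norm x) (potSize_nonneg P Q x)
  rwa [Lp.norm_toLp, mul_comm] at h

/-- Multiplication by the potential. -/
def potOp {P Q : ℝ → ℂ} (hP : MemLp P 2 mu) (hQ : MemLp Q 2 mu) : X →L[ℂ] H :=
  LinearMap.mkContinuous
    { toFun := potFun hP hQ
      map_add' := fun u w => by
        refine Lp.ext ?_
        filter_upwards [coeFn_potFun hP hQ u, coeFn_potFun hP hQ w, coeFn_potFun hP hQ (u + w),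
          Lp.coeFn_add (potFun hP hQ u) (potFun hP hQ w)] with x h1 h2 h3 h4
        rw [h3, h4, Pi.add_apply, h1, h2]
        ext i
        fin_cases i <;> simp [mul_add]
      map_smul' := fun c u => by
        refine Lp.ext ?_
        filter_upwards [coeFn_potFun hP hQ u, coeFn_potFun hP hQ (c • u),
          Lp.coeFn_smul c (potFun hP hQ u)] with x h1 h2 h3
        rw [RingHom.id_apply, h2, h3, Pi.smul_apply, h1]
        ext i
        fin_cases i <;> simp <;> ring }
    (eLpNorm (potSize P Q) 2 mu).toReal (norm_potFun_le hP hQ)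

theorem coeFn_potOp {P Q : ℝ → ℂ} (hP : MemLp P 2 mu) (hQ : MemLp Q 2 mu) (u : X) :
    potOp hP hQ u =ᵐ[mu] fun x => (!₂[P x * u x 1, Q x * u x 0] : C2) :=
  coeFn_potFun hP hQ u

theorem norm_potOp_le {P Q : ℝ → ℂ} (hP : MemLp P 2 mu) (hQ : MemLp Q 2 mu) :
    ‖potOp hP hQ‖ ≤ (eLpNorm (potSize P Q) 2 mu).toReal :=
  LinearMap.mkContinuous_norm_le _ ENNReal.toReal_nonneg _

theorem diracExpr_eq (P Q : ℝ → ℂ) (y : ℝ → C2) (x : ℝ) :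
    diracExpr P Q y x = diracExpr 0 0 y x + !₂[P x * y x 1, Q x * y x 0] := by
  ext i
  fin_cases i <;> simp [diracExpr]

/-- Factor 1 - K² into the commuting elements 1 - K and 1 + K. Smallness of the square alone is used
because R⁰v need not be small on the vertical lines. -/
theorem isUnit_one_sub_of_norm_sq_le {A : Type*} [NormedRing A] [CompleteSpace A] {K : A}
    (h : ‖K * K‖ ≤ 1 / 2) : IsUnit (1 - K) := by
  have h1 : IsUnit (1 - K * K) := (Units.oneSub (K * K) (h.trans_lt (by norm_num))).isUnit
  have h2 : 1 - K * K = (1 - K) * (1 + K) := by noncomm_ring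
  have hc : Commute (1 - K) (1 + K) :=
    (Commute.one_left _).sub_left ((Commute.one_right K).add_right (Commute.refl K))
  rw [h2] at h1
  exact (hc.isUnit_mul_iff.1 h1).1

/-! ### The perturbed resolvent -/

section Perturbed

variable {P Q : ℝ → ℂ} (hP : MemLp P 2 mu) (hQ : MemLp Q 2 mu) (B : Matrix (Fin 2) (Fin 4) ℂ)

/-- The operator `R⁰(z) v` in the space of continuous functions. -/
def bsOp (z : ℂ) : X →L[ℂ] X := freeRes B z ∘L potOp hP hQ

/-- The resolvent of the perturbed operator, with values in continuous functions. -/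
def fullRes (z : ℂ) : H →L[ℂ] X := Ring.inverse (1 - bsOp hP hQ B z) ∘L freeRes B z

variable {hP hQ B}

/-- The equation (z - L)u = f read as the fixed point equation u = R⁰(f + vu). All later facts about
the perturbed resolvent go through this form. -/
theorem eq_fullRes_iff {z : ℂ} (h : IsUnit (1 - bsOp hP hQ B z)) {f : H} {u : X} :
    u = fullRes hP hQ B z f ↔ u = freeRes B z (f + potOp hP hQ u) := by
  have e : freeRes B z (f + potOp hP hQ u) = freeRes B z f + bsOp hP hQ B z u := by
    rw [map_add]; rfl
  rw [e]
  constructor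
  · rintro rfl
    have := congrArg (fun T : X →L[ℂ] X => T (freeRes B z f)) (Ring.mul_inverse_cancel _ h)
    simp only [mul_apply_eq_comp, one_apply_eq_self,
      _root_.sub_apply] at this
    exact sub_eq_iff_eq_add.1 this
  · intro hu
    have h1 : (1 - bsOp hP hQ B z) u = freeRes B z f := sub_eq_iff_eq_add.2 hu
    rw [fullRes, ContinuousLinearMap.comp_apply, ← h1, ← mul_apply_eq_comp,
      Ring.inverse_mul_cancel _ h, one_apply_eq_self]

theorem isUnit_one_sub_bsOp {z : ℂ} (h : ‖bsOp hP hQ B z * bsOp hP hQ B z‖ ≤ 1 / 2) :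
    IsUnit (1 - bsOp hP hQ B z) :=
  isUnit_one_sub_of_norm_sq_le (A := X →L[ℂ] X) h

theorem norm_fullRes_le {z : ℂ} (h : ‖bsOp hP hQ B z * bsOp hP hQ B z‖ ≤ 1 / 2) (f : H) :
    ‖fullRes hP hQ B z f‖ ≤ 2 * (1 + ‖bsOp hP hQ B z‖) * ‖freeRes B z f‖ := by
  have hu := (eq_fullRes_iff (isUnit_one_sub_bsOp h) (f := f)).1 rfl
  set u := fullRes hP hQ B z f
  set K := bsOp hP hQ B z with hK
  set g := freeRes B z f
  have h1 : u = g + K u := by rw [map_add] at hu; exact hu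
  -- The fixed point equation is iterated once so that only K² acts on u; its contribution is at
  -- most half of the norm and is absorbed on the left.
  have h2 : u = g + K g + (K * K) u := by
    conv_lhs => rw [h1, h1]
    rw [map_add, mul_apply_eq_comp, add_assoc]
  have h3 : ‖u‖ ≤ ‖g‖ + ‖K‖ * ‖g‖ + 1 / 2 * ‖u‖ := by
    conv_lhs => rw [h2]
    refine (norm_add_le _ _).trans (add_le_add ((norm_add_le _ _).trans
      (add_le_add_right (K.le_opNorm g) _)) (((K * K).le_opNorm u).trans ?_))
    gcongr
  linarith

theorem isResolventAt_fullRes {δ : ℝ} (hδ : 0 < δ) {z : ℂ} (hz : CharDetGE B δ z)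
    (h : IsUnit (1 - bsOp hP hQ B z)) :
    IsResolventAt (diracOp B P Q) z (toH ∘L fullRes hP hQ B z) := by
  constructor
  · intro f
    set u := fullRes hP hQ B z f with hu
    have hu' := (eq_fullRes_iff h).1 hu
    have hs := (freeRes_spec hδ hz).solves (f + potOp hP hQ u)
    rw [← hu'] at hs
    have hg : (toH u, z • toH u - f) ∈ (diracOp B P Q).graph := by
      rw [diracOp_graph]
      refine ⟨u, hs.inDomain, coeFn_toH u, ?_⟩
      filter_upwards [hs.ode, coeFn_toH u, Lp.coeFn_sub (z • toH u) f, Lp.coeFn_smul z (toH u),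
        Lp.coeFn_add f (potOp hP hQ u), coeFn_potOp hP hQ u] with x h1 h2 h3 h4 h5 h6
      rw [h3, Pi.sub_apply, h4, Pi.smul_apply, h2, diracExpr_eq]
      rw [h5, Pi.add_apply, h6] at h1
      rw [sub_eq_iff_eq_add, eq_comm, ← sub_eq_zero]
      rw [sub_eq_iff_eq_add] at h1
      rw [h1]
      abel
    obtain ⟨hd, he⟩ := LinearPMap.mem_graph_iff _ |>.1 hg
    have hmem : toH u ∈ (diracOp B P Q).domain := by
      have e : (hd : H) = toH u := he.1
      rw [← e]; exact hd.2
    refine ⟨hmem, ?_⟩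
    have : (⟨toH u, hmem⟩ : (diracOp B P Q).domain) = hd :=
      Subtype.ext he.1.symm
    simp only [ContinuousLinearMap.comp_apply, ← hu]
    rw [this, he.2]
    simp
  · intro y
    set f : H := z • (y : H) - diracOp B P Q y with hf
    have hg : ((y : H), diracOp B P Q y) ∈ (diracOp B P Q).graph := LinearPMap.mem_graph _ y
    rw [diracOp_graph] at hg
    obtain ⟨w, hw, h1, h2⟩ := hg
    obtain ⟨u, hu⟩ := exists_clampX hw.continuousOn
    have hwu : EqOn w u (Icc 0 π) := fun x hx => by rw [hu, clamp_of_mem hx]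
    have hs : Solves B z (f + potOp hP hQ u : H) w := by
      refine ⟨hw, ?_⟩
      filter_upwards [h1, h2, ae_mem_Ioo, Lp.coeFn_add f (potOp hP hQ u), coeFn_potOp hP hQ u,
        Lp.coeFn_sub (z • (y : H)) (diracOp B P Q y), Lp.coeFn_smul z (y : H)]
        with x e1 e2 e3 e4 e5 e6 e7
      rw [e4, Pi.add_apply, e5, hf, e6, Pi.sub_apply, e7, Pi.smul_apply, e1, e2,
        ← hwu (Ioo_subset_Icc_self e3), diracExpr_eq P Q]
      abel
    have hR := freeRes_unique hδ hz (hs.congr_left hwu) fun x => by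
      rw [hu, hu, clamp_of_mem (clamp_mem x)]
    rw [ContinuousLinearMap.comp_apply, ← (eq_fullRes_iff h).2 hR.symm]
    refine Lp.ext ?_
    filter_upwards [h1, ae_mem_Ioo, coeFn_toH u] with x e1 e3 e4
    rw [e4, ← hwu (Ioo_subset_Icc_self e3), ← e1]

theorem Solves.shift {z w : ℂ} {f : H} {u : X} (h : Solves B w f u) :
    Solves B z (f + (z - w) • toH u : H) u where
  inDomain := h.inDomain
  ode := by
    filter_upwards [h.ode, Lp.coeFn_add f ((z - w) • toH u), Lp.coeFn_smul (z - w) (toH u),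
      coeFn_toH u] with x h1 h2 h3 h4
    rw [h2, Pi.add_apply, h3, Pi.smul_apply, h4, ← h1, sub_smul]
    abel

/-- First resolvent identity. A solution at w also solves the problem at z with right-hand side
shifted by (z - w)u, and uniqueness at z identifies it; `toH` appears because the resolvents take
values in a different space. -/
theorem fullRes_sub {δ : ℝ} (hδ : 0 < δ) {z w : ℂ} (hz : CharDetGE B δ z) (hw : CharDetGE B δ w)
    (hz' : IsUnit (1 - bsOp hP hQ B z)) (hw' : IsUnit (1 - bsOp hP hQ B w)) :
    fullRes hP hQ B z - fullRes hP hQ B w =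
      (w - z) • (fullRes hP hQ B z ∘L toH ∘L fullRes hP hQ B w) := by
  ext1 f
  set u := fullRes hP hQ B w f with hu
  have h1 := (eq_fullRes_iff hw').1 hu
  have h2 := ((freeRes_spec hδ hw).solves (f + potOp hP hQ u)).shift (z := z)
    (u := freeRes B w (f + potOp hP hQ u))
  have h3 := freeRes_unique hδ hz h2 ((freeRes_spec hδ hw).clamp_eq _)
  rw [← h1] at h3
  have h4 : u = fullRes hP hQ B z (f + (z - w) • toH u) := by
    rw [eq_fullRes_iff hz']
    conv_lhs => rw [← h3]
    congr 1
    abel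
  simp only [_root_.sub_apply, _root_.smul_apply,
    ContinuousLinearMap.comp_apply, ← hu]
  rw [map_add, map_smul] at h4
  rw [eq_sub_of_add_eq h4.symm, sub_sub_cancel_left]
  module

end Perturbed

/-! ### Test functions -/

/-- Continuously differentiable functions with support in the open interval `(0, π)`. -/
structure IsTest (p : ℝ → ℂ) : Prop where
  contDiff : ContDiff ℝ 1 p
  tsupport_subset : tsupport p ⊆ Ioo 0 π

theorem IsTest.eq_zero {p : ℝ → ℂ} (hp : IsTest p) {x : ℝ} (hx : x ∉ Ioo 0 π) : p x = 0 :=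
  image_eq_zero_of_notMem_tsupport fun h => hx (hp.tsupport_subset h)

theorem IsTest.hasCompactSupport {p : ℝ → ℂ} (hp : IsTest p) : HasCompactSupport p :=
  isCompact_Icc.of_isClosed_subset (isClosed_tsupport p)
    (hp.tsupport_subset.trans Ioo_subset_Icc_self)

theorem IsTest.continuous_deriv {p : ℝ → ℂ} (hp : IsTest p) : Continuous (deriv p) :=
  hp.contDiff.continuous_deriv le_rfl

theorem IsTest.exists_bound {p : ℝ → ℂ} (hp : IsTest p) :
    ∃ G, 0 ≤ G ∧ ∀ x, ‖p x‖ ≤ G ∧ ‖deriv p x‖ ≤ G := by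
  obtain ⟨G₁, h₁⟩ := hp.contDiff.continuous.bounded_above_of_compact_support hp.hasCompactSupport
  obtain ⟨G₂, h₂⟩ := hp.continuous_deriv.bounded_above_of_compact_support hp.hasCompactSupport.deriv
  exact ⟨max G₁ G₂, ((norm_nonneg _).trans (h₁ 0)).trans (le_max_left _ _),
    fun x => ⟨(h₁ x).trans (le_max_left _ _), (h₂ x).trans (le_max_right _ _)⟩⟩

theorem IsTest.hasDerivAt {p : ℝ → ℂ} (hp : IsTest p) (x : ℝ) : HasDerivAt p (deriv p x) x :=
  (hp.contDiff.differentiable one_ne_zero x).hasDerivAt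

theorem IsTest.acoi {p : ℝ → ℂ} (hp : IsTest p) : AbsolutelyContinuousOnInterval p 0 π :=
  hp.contDiff.contDiffOn.absolutelyContinuousOnInterval

theorem memLp_of_bound_continuous {p : ℝ → ℂ} (hc : Continuous p) {G : ℝ} (h : ∀ x, ‖p x‖ ≤ G) :
    MemLp p 2 mu :=
  MemLp.of_bound hc.aestronglyMeasurable G (Eventually.of_forall h)

theorem IsTest.memLp {p : ℝ → ℂ} (hp : IsTest p) : MemLp p 2 mu := memLp_of_acoi hp.acoi

theorem IsTest.memLp_deriv {p : ℝ → ℂ} (hp : IsTest p) : MemLp (deriv p) 2 mu := by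
  obtain ⟨G, -, hG⟩ := hp.exists_bound
  exact memLp_of_bound_continuous hp.continuous_deriv fun x => (hG x).2

theorem IsTest.add {p q : ℝ → ℂ} (hp : IsTest p) (hq : IsTest q) : IsTest (p + q) where
  contDiff := hp.contDiff.add hq.contDiff
  tsupport_subset := (tsupport_add p q).trans (union_subset hp.tsupport_subset hq.tsupport_subset)

theorem IsTest.smul {p : ℝ → ℂ} (c : ℂ) (hp : IsTest p) : IsTest (c • p) where
  contDiff := hp.contDiff.const_smul c
  tsupport_subset := (tsupport_smul_subset_right (fun _ => c) p).trans hp.tsupport_subset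

theorem IsTest.zero : IsTest 0 where
  contDiff := contDiff_const
  tsupport_subset := by simp [tsupport]

/-- The classes of the test functions in `L²`. -/
def testSubmodule : Submodule ℂ (Lp ℂ 2 mu) where
  carrier := {f | ∃ p, IsTest p ∧ f =ᵐ[mu] p}
  zero_mem' := ⟨0, IsTest.zero, Lp.coeFn_zero ℂ 2 mu⟩
  add_mem' := by
    rintro f g ⟨p, hp, hfp⟩ ⟨q, hq, hgq⟩
    exact ⟨p + q, hp.add hq, (Lp.coeFn_add f g).trans (hfp.add hgq)⟩
  smul_mem' := by
    rintro c f ⟨p, hp, hfp⟩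
    exact ⟨c • p, hp.smul c, (Lp.coeFn_smul c f).trans (hfp.const_smul c)⟩

/-- A function orthogonal to all test functions vanishes almost everywhere, by the fundamental lemma
of the calculus of variations. -/
theorem testSubmodule_topologicalClosure : testSubmodule.topologicalClosure = ⊤ := by
  rw [Submodule.topologicalClosure_eq_top_iff, Submodule.eq_bot_iff]
  intro f hf
  have hfi : IntegrableOn f (Icc 0 π) := (Lp.memLp f).integrable one_le_two
  have h0 : ∀ᵐ x : ℝ, x ∈ Ioo 0 π → f x = 0 := by
    refine isOpen_Ioo.ae_eq_zero_of_integral_contDiff_smul_eq_zero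
      (hfi.mono_set Ioo_subset_Icc_self).locallyIntegrableOn fun g hg hgc hgs => ?_
    have ht : IsTest fun x => (g x : ℂ) := by
      refine ⟨Complex.ofRealCLM.contDiff.comp (hg.of_le (by exact_mod_cast le_top)), ?_⟩
      have : tsupport (fun x => (g x : ℂ)) ⊆ tsupport g :=
        closure_mono fun x hx => by simpa using hx
      exact this.trans hgs
    have h1 := (Submodule.mem_orthogonal testSubmodule f).1 hf (ht.memLp.toLp _)
      ⟨_, ht, ht.memLp.coeFn_toLp⟩
    rw [L2.inner_def] at h1
    have h2 : ∫ x, g x • f x = ∫ x, g x • f x ∂mu := by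
      rw [setIntegral_eq_integral_of_forall_compl_eq_zero]
      intro x hx
      rw [image_eq_zero_of_notMem_tsupport (fun h => hx (Ioo_subset_Icc_self (hgs h))), zero_smul]
    rw [h2, ← h1]
    refine integral_congr_ae ?_
    filter_upwards [ht.memLp.coeFn_toLp] with x hx
    rw [hx]
    simp [mul_comm]
  refine Lp.ext ?_
  filter_upwards [ae_mem_Ioo, ae_restrict_of_ae h0, Lp.coeFn_zero ℂ 2 mu] with x h1 h2 h3
  rw [h2 h1, h3]; rfl

theorem exists_isTest_eLpNorm_sub_le {P : ℝ → ℂ} (hP : MemLp P 2 mu) {ε : ℝ} (hε : 0 < ε) :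
    ∃ p, IsTest p ∧ (eLpNorm (P - p) 2 mu).toReal ≤ ε := by
  have h : hP.toLp P ∈ closure (testSubmodule : Set (Lp ℂ 2 mu)) := by
    rw [← Submodule.topologicalClosure_coe, testSubmodule_topologicalClosure]
    trivial
  obtain ⟨f, ⟨p, hp, hfp⟩, hd⟩ := Metric.mem_closure_iff.1 h ε hε
  refine ⟨p, hp, ?_⟩
  have e : f = hp.memLp.toLp p := Lp.ext (hfp.trans hp.memLp.coeFn_toLp.symm)
  rw [e, dist_eq_norm, ← MemLp.toLp_sub, Lp.norm_toLp] at hd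
  exact hd.le

/-! ### The free resolvent on test functions -/

theorem norm_mk_le {a b : ℂ} {G : ℝ} (ha : ‖a‖ ≤ G) (hb : ‖b‖ ≤ G) :
    ‖(!₂[a, b] : C2)‖ ≤ 2 * G := by
  refine (norm_C2_le _).trans ?_
  simp only [Matrix.cons_val_zero, Matrix.cons_val_one]
  linarith

theorem inDomain_of_zero {B : Matrix (Fin 2) (Fin 4) ℂ} {y₁ y₂ d₁ d₂ : ℝ → ℂ}
    (h₁ : AbsolutelyContinuousOnInterval y₁ 0 π) (h₂ : AbsolutelyContinuousOnInterval y₂ 0 π)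
    (hd₁ : ∀ᵐ x ∂mu, HasDerivAt y₁ (d₁ x) x) (hd₂ : ∀ᵐ x ∂mu, HasDerivAt y₂ (d₂ x) x)
    (hm₁ : MemLp d₁ 2 mu) (hm₂ : MemLp d₂ 2 mu) (h : y₁ 0 = 0 ∧ y₁ π = 0 ∧ y₂ 0 = 0 ∧ y₂ π = 0) :
    InDomain B (fun x => !₂[y₁ x, y₂ x]) where
  ac := acoi_mk h₁ h₂
  deriv_memLp := by
    refine (memLp_congr_ae ?_).2 (memLp_mk hm₁ hm₂)
    filter_upwards [hd₁, hd₂] with x e1 e2 using (hasDerivAt_mk e1 e2).deriv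
  bc := by
    rw [satisfiesBC_iff]
    simp [h.1, h.2.1, h.2.2.1, h.2.2.2]

theorem solves_of_zero {B : Matrix (Fin 2) (Fin 4) ℂ} {y₁ y₂ d₁ d₂ : ℝ → ℂ}
    (h₁ : AbsolutelyContinuousOnInterval y₁ 0 π) (h₂ : AbsolutelyContinuousOnInterval y₂ 0 π)
    (hd₁ : ∀ᵐ x ∂mu, HasDerivAt y₁ (d₁ x) x) (hd₂ : ∀ᵐ x ∂mu, HasDerivAt y₂ (d₂ x) x)
    (hm₁ : MemLp d₁ 2 mu) (hm₂ : MemLp d₂ 2 mu) (h : y₁ 0 = 0 ∧ y₁ π = 0 ∧ y₂ 0 = 0 ∧ y₂ π = 0)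
    (z : ℂ) : Solves B z (fun x => !₂[z * y₁ x - Complex.I * d₁ x, z * y₂ x + Complex.I * d₂ x])
      (fun x => !₂[y₁ x, y₂ x]) where
  inDomain := inDomain_of_zero h₁ h₂ hd₁ hd₂ hm₁ hm₂ h
  ode := by
    filter_upwards [hd₁, hd₂] with x e1 e2
    rw [diracExpr_zero_apply, (hasDerivAt_mk e1 e2).deriv]
    ext i
    fin_cases i <;> simp

theorem norm_freeRes_le (B : Matrix (Fin 2) (Fin 4) ℂ) {δ : ℝ} (hδ : 0 < δ) :
    ∃ C : ℝ, 1 ≤ C ∧ ∀ z, CharDetGE B δ z → ∀ f : H, ‖freeRes B z f‖ ≤ C * ‖f‖ := by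
  obtain ⟨C, hC1, hC⟩ := freeRes_bound B hδ
  have hpi : 1 ≤ √π := by
    rw [Real.one_le_sqrt]; linarith [Real.pi_gt_three]
  refine ⟨C * √π, by nlinarith, fun z hz f => (norm_le (by positivity)).2 fun x => ?_⟩
  rw [← (freeRes_spec hδ hz).clamp_eq, mul_assoc]
  refine (hC z hz f _ (clamp_mem x)).trans ?_
  gcongr
  rw [← eLpNorm_norm_toReal]
  exact foldLap_le (memLp_norm f) (fun _ => norm_nonneg _) (abs_nonneg _) _

/-- A test function F vanishes at both ends, so it lies in the domain whatever the boundary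
condition is. Then zR⁰F = F + R⁰L⁰F, which stays bounded in z. -/
theorem freeRes_test (B : Matrix (Fin 2) (Fin 4) ℂ) {δ : ℝ} (hδ : 0 < δ) {p q : ℝ → ℂ}
    (hp : IsTest p) (hq : IsTest q) : ∃ C : ℝ, 0 ≤ C ∧ ∀ z, CharDetGE B δ z →
      ‖z‖ * ‖freeRes B z ((memLp_mk hp.memLp hq.memLp).toLp _)‖ ≤ C := by
  obtain ⟨C, hC1, hC⟩ := norm_freeRes_le B hδ
  obtain ⟨Gp, hGp0, hGp⟩ := hp.exists_bound
  obtain ⟨Gq, hGq0, hGq⟩ := hq.exists_bound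
  have hm : MemLp (fun x => (!₂[Complex.I * deriv p x, -Complex.I * deriv q x] : C2)) 2 mu :=
    memLp_mk (hp.memLp_deriv.const_mul _) (hq.memLp_deriv.const_mul _)
  have h0 : (0 : ℝ) ∉ Ioo 0 π := by simp
  have hpi : π ∉ Ioo 0 π := by simp
  refine ⟨2 * max Gp Gq + C * ‖hm.toLp _‖, by positivity, fun z hz => ?_⟩
  set F := (memLp_mk hp.memLp hq.memLp).toLp (fun x => (!₂[p x, q x] : C2)) with hF
  have hs := freeRes_spec hδ hz
  have h1 := solves_of_zero (B := B) hp.acoi hq.acoi (Eventually.of_forall hp.hasDerivAt)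
    (Eventually.of_forall hq.hasDerivAt) hp.memLp_deriv hq.memLp_deriv
    ⟨hp.eq_zero h0, hp.eq_zero hpi, hq.eq_zero h0, hq.eq_zero hpi⟩ z
  have h2 := (h1.add (hs.solves (hm.toLp _))).congr_right (g := z • (F : ℝ → C2)) (by
    filter_upwards [hm.coeFn_toLp, (memLp_mk hp.memLp hq.memLp).coeFn_toLp] with x e1 e2
    rw [Pi.add_apply, e1, Pi.smul_apply, e2]
    ext i
    fin_cases i <;> simp)
  have h3 := ((hs.solves F).smul z).eqOn hδ hz h2
  rw [← norm_smul]
  refine (norm_le (by positivity)).2 fun x => ?_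
  have e : (z • freeRes B z F) x = z • freeRes B z F (clamp x) := by rw [hs.clamp_eq]; rfl
  have e' := h3 (clamp_mem x)
  simp only [Pi.smul_apply, Pi.add_apply] at e'
  rw [e, e']
  refine (norm_add_le _ _).trans (add_le_add (norm_mk_le ?_ ?_) ?_)
  · exact (hGp _).1.trans (le_max_left _ _)
  · exact (hGq _).1.trans (le_max_right _ _)
  · exact (norm_coe_le_norm _ _).trans (hC z hz _)

theorem IsTest.acoi_mul {p y : ℝ → ℂ} (hp : IsTest p) (hy : AbsolutelyContinuousOnInterval y 0 π) :
    AbsolutelyContinuousOnInterval (fun x => p x * y x) 0 π := hp.acoi.smul hy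

theorem IsTest.memLp_mul {p f : ℝ → ℂ} (hp : IsTest p) (hf : MemLp f 2 mu) :
    MemLp (fun x => p x * f x) 2 mu := by
  obtain ⟨G, -, hG⟩ := hp.exists_bound
  refine hf.of_le_mul (c := G) (hp.memLp.1.mul hf.1) (Eventually.of_forall fun x => ?_)
  rw [norm_mul]
  exact mul_le_mul_of_nonneg_right (hG x).1 (norm_nonneg _)

theorem IsTest.memLp_deriv_mul {p f : ℝ → ℂ} (hp : IsTest p) (hf : MemLp f 2 mu) :
    MemLp (fun x => deriv p x * f x) 2 mu := by
  obtain ⟨G, -, hG⟩ := hp.exists_bound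
  refine hf.of_le_mul (c := G) (hp.memLp_deriv.1.mul hf.1) (Eventually.of_forall fun x => ?_)
  rw [norm_mul]
  exact mul_le_mul_of_nonneg_right (hG x).2 (norm_nonneg _)

/-- For an off-diagonal W with test entries and y = R⁰f, the components of Wy oscillate with the
opposite exponentials, so z - L⁰ does not annihilate the leading term but doubles it: (z - L⁰)(Wy)
is 2zWy plus terms without a factor z. Since Wy vanishes at both ends it lies in the domain, and
applying R⁰ bounds 2zR⁰Wy. -/
theorem freeRes_pot_freeRes_test (B : Matrix (Fin 2) (Fin 4) ℂ) {δ : ℝ} (hδ : 0 < δ)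
    {p q : ℝ → ℂ} (hp : IsTest p) (hq : IsTest q) : ∃ C : ℝ, 0 ≤ C ∧ ∀ z, CharDetGE B δ z →
      ∀ f : H, ‖z‖ * ‖freeRes B z (potOp hp.memLp hq.memLp (freeRes B z f))‖ ≤ C * ‖f‖ := by
  obtain ⟨C, hC1, hC⟩ := norm_freeRes_le B hδ
  obtain ⟨Gp, hGp0, hGp⟩ := hp.exists_bound
  obtain ⟨Gq, hGq0, hGq⟩ := hq.exists_bound
  set G := max Gp Gq
  have hG0 : 0 ≤ G := hGp0.trans (le_max_left _ _)
  have hp' : ∀ x, ‖p x‖ ≤ G := fun x => (hGp x).1.trans (le_max_left _ _)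
  have hq' : ∀ x, ‖q x‖ ≤ G := fun x => (hGq x).1.trans (le_max_right _ _)
  have hdp : MemLp (fun x => Complex.I * deriv p x) 2 mu := hp.memLp_deriv.const_mul _
  have hdq : MemLp (fun x => -Complex.I * deriv q x) 2 mu := hq.memLp_deriv.const_mul _
  set W := potOp hdp hdq with hW
  have h0 : (0 : ℝ) ∉ Ioo 0 π := by simp
  have hpi : π ∉ Ioo 0 π := by simp
  refine ⟨2 * G * C + C * (‖W‖ * C + 2 * G), by positivity, fun z hz f => ?_⟩
  have hs := freeRes_spec hδ hz
  set y := freeRes B z f with hy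
  have hsy : Solves B z f y := hs.solves f
  obtain ⟨hd0, hd1⟩ := hsy.hasDerivAt
  have hac := hsy.inDomain.ac
  have hyn : ‖y‖ ≤ C * ‖f‖ := hC z hz f
  have hm : MemLp (fun x => (!₂[p x * f x 1, q x * f x 0] : C2)) 2 mu :=
    memLp_mk (hp.memLp_mul (memLp_coord (Lp.memLp f) 1)) (hq.memLp_mul (memLp_coord (Lp.memLp f) 0))
  set m : H := hm.toLp _ with hmdef
  have hmn : ‖m‖ ≤ 2 * G * ‖f‖ := by
    refine Lp.norm_le_mul_norm_of_ae_le_mul ?_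
    filter_upwards [hm.coeFn_toLp] with x hx
    rw [hmdef, hx, mul_assoc]
    refine norm_mk_le ?_ ?_
    · rw [norm_mul]
      exact mul_le_mul (hp' x) (PiLp.norm_apply_le _ _) (norm_nonneg _) hG0
    · rw [norm_mul]
      exact mul_le_mul (hq' x) (PiLp.norm_apply_le _ _) (norm_nonneg _) hG0
  have hy0 := memLp_coord (memLp_of_acoi hac) 0
  have hy1 := memLp_coord (memLp_of_acoi hac) 1
  have hf0 := memLp_coord (Lp.memLp f) 0
  have hf1 := memLp_coord (Lp.memLp f) 1
  -- The candidate is Wy, with its derivative expanded by the equations for y; the components of y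
  -- are interchanged.
  have h1 := solves_of_zero (B := B) (hp.acoi_mul (acoi_coord hac 1)) (hq.acoi_mul (acoi_coord hac 0))
    (d₁ := fun x => deriv p x * y x 1 + p x * (Complex.I * z * y x 1 + -Complex.I * f x 1))
    (d₂ := fun x => deriv q x * y x 0 + q x * (-(Complex.I * z) * y x 0 + Complex.I * f x 0))
    (by filter_upwards [hd1] with x hx using (hp.hasDerivAt x).mul hx)
    (by filter_upwards [hd0] with x hx using (hq.hasDerivAt x).mul hx)
    ((hp.memLp_deriv_mul hy1).add (hp.memLp_mul ((hy1.const_mul _).add (hf1.const_mul _))))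
    ((hq.memLp_deriv_mul hy0).add (hq.memLp_mul ((hy0.const_mul _).add (hf0.const_mul _))))
    ⟨by simp [hp.eq_zero h0], by simp [hp.eq_zero hpi], by simp [hq.eq_zero h0],
      by simp [hq.eq_zero hpi]⟩ z
  set g : H := potOp hp.memLp hq.memLp y with hg
  have h2 := (h1.add (hs.solves (W y + m))).congr_right (g := (2 * z) • (g : ℝ → C2)) (by
    filter_upwards [hm.coeFn_toLp, Lp.coeFn_add (W y) m, coeFn_potOp hdp hdq y,
      coeFn_potOp hp.memLp hq.memLp y] with x e1 e2 e3 e4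
    rw [Pi.add_apply, e2, Pi.add_apply, hmdef, e1, Pi.smul_apply, hg, e4, hW, e3]
    ext i
    fin_cases i
    · simp
      linear_combination (p x * f x 1 - p x * z * y x 1) * Complex.I_mul_I
    · simp
      linear_combination (q x * f x 0 - q x * z * y x 0) * Complex.I_mul_I)
  have h3 := ((hs.solves g).smul (2 * z)).eqOn hδ hz h2
  have h4 : ‖(2 * z) • freeRes B z g‖ ≤ 2 * G * C * ‖f‖ + C * (‖W‖ * C + 2 * G) * ‖f‖ := by
    refine (norm_le (by positivity)).2 fun x => ?_
    have e : ((2 * z) • freeRes B z g) x = (2 * z) • freeRes B z g (clamp x) := by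
      rw [hs.clamp_eq]; rfl
    have e' := h3 (clamp_mem x)
    simp only [Pi.smul_apply, Pi.add_apply] at e'
    rw [e, e']
    have hyx : ∀ i, ‖y (clamp x) i‖ ≤ C * ‖f‖ := fun i =>
      (PiLp.norm_apply_le _ _).trans ((y.norm_coe_le_norm _).trans hyn)
    refine (norm_add_le _ _).trans (add_le_add ?_ ?_)
    · rw [mul_assoc, mul_assoc]
      refine norm_mk_le ?_ ?_
      · rw [norm_mul]
        exact mul_le_mul (hp' _) (hyx 1) (norm_nonneg _) hG0
      · rw [norm_mul]
        exact mul_le_mul (hq' _) (hyx 0) (norm_nonneg _) hG0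
    · refine (norm_coe_le_norm _ _).trans ((hC z hz _).trans ?_)
      rw [mul_assoc]
      gcongr
      calc ‖W y + m‖ ≤ ‖W y‖ + ‖m‖ := norm_add_le _ _
        _ ≤ ‖W‖ * (C * ‖f‖) + 2 * G * ‖f‖ := by
          refine add_le_add ((W.le_opNorm y).trans ?_) hmn
          gcongr
        _ = _ := by ring
  rw [norm_smul, norm_mul, Complex.norm_ofNat] at h4
  have h5 : 0 ≤ ‖z‖ * ‖freeRes B z g‖ := by positivity
  linarith

/-! ### Smallness of the square of R⁰v -/

theorem potOp_sub {P Q P' Q' : ℝ → ℂ} (hP : MemLp P 2 mu) (hQ : MemLp Q 2 mu)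
    (hP' : MemLp P' 2 mu) (hQ' : MemLp Q' 2 mu) (u : X) :
    potOp hP hQ u = potOp hP' hQ' u + potOp (hP.sub hP') (hQ.sub hQ') u := by
  refine Lp.ext ?_
  filter_upwards [coeFn_potOp hP hQ u, coeFn_potOp hP' hQ' u,
    coeFn_potOp (hP.sub hP') (hQ.sub hQ') u,
    Lp.coeFn_add (potOp hP' hQ' u) (potOp (hP.sub hP') (hQ.sub hQ') u)] with x h1 h2 h3 h4
  rw [h1, h4, Pi.add_apply, h2, h3]
  ext i
  fin_cases i <;> simp <;> ring

theorem toReal_eLpNorm_potSize_le {P Q : ℝ → ℂ} (hP : MemLp P 2 mu) (hQ : MemLp Q 2 mu) :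
    (eLpNorm (potSize P Q) 2 mu).toReal ≤ (eLpNorm P 2 mu).toReal + (eLpNorm Q 2 mu).toReal := by
  rw [← ENNReal.toReal_add hP.eLpNorm_ne_top hQ.eLpNorm_ne_top]
  refine ENNReal.toReal_mono (by finiteness [hP.eLpNorm_ne_top, hQ.eLpNorm_ne_top]) ?_
  have := eLpNorm_add_le hP.norm.1 hQ.norm.1 (p := 2) one_le_two
  rwa [eLpNorm_norm, eLpNorm_norm] at this

/-- In R⁰vR⁰v only the left-hand v is split, into a test potential and a remainder small in L². The
test part gains 1/|z|; the remainder is small uniformly in z. -/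
theorem exists_norm_bsOp_sq_le {P Q : ℝ → ℂ} (hP : MemLp P 2 mu) (hQ : MemLp Q 2 mu)
    (B : Matrix (Fin 2) (Fin 4) ℂ) {δ : ℝ} (hδ : 0 < δ) :
    ∃ Λ : ℝ, ∀ z, CharDetGE B δ z → Λ ≤ ‖z‖ →
      ‖bsOp hP hQ B z * bsOp hP hQ B z‖ ≤ 1 / 2 := by
  obtain ⟨C, hC1, hC⟩ := norm_freeRes_le B hδ
  set V := potOp hP hQ with hV
  set N := ‖V‖ with hN
  have hC0 : 0 < C := by linarith
  have hN0 : 0 ≤ N := by rw [hN]; exact norm_nonneg V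
  -- Chosen so that the remainder contributes C · 2ε · C · N ≤ 1/4; N + 1 avoids division by zero.
  set ε : ℝ := 1 / (8 * C * C * (N + 1)) with hε
  have hε0 : 0 < ε := by positivity
  obtain ⟨p, hp, hpε⟩ := exists_isTest_eLpNorm_sub_le hP hε0
  obtain ⟨q, hq, hqε⟩ := exists_isTest_eLpNorm_sub_le hQ hε0
  obtain ⟨D, hD0, hD⟩ := freeRes_pot_freeRes_test B hδ hp hq
  set W := potOp (hP.sub hp.memLp) (hQ.sub hq.memLp) with hW
  have hWn : ‖W‖ ≤ 2 * ε := by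
    refine (norm_potOp_le _ _).trans ((toReal_eLpNorm_potSize_le (hP.sub hp.memLp)
      (hQ.sub hq.memLp)).trans ?_)
    linarith
  -- The term 4DN makes the test part at most 1/4, and the added 1 keeps |z| positive.
  refine ⟨4 * D * N + 1, fun z hz hΛ => ?_⟩
  have hz0 : 0 < ‖z‖ := by
    have : 0 ≤ D * N := by positivity
    linarith
  refine ContinuousLinearMap.opNorm_le_bound _ (by norm_num) fun u => ?_
  set f := V u with hf
  have hfn : ‖f‖ ≤ N * ‖u‖ := V.le_opNorm u
  have e : (bsOp hP hQ B z * bsOp hP hQ B z) u =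
      freeRes B z (potOp hp.memLp hq.memLp (freeRes B z f)) + freeRes B z (W (freeRes B z f)) := by
    rw [← map_add, ← potOp_sub]; rfl
  rw [e]
  refine (norm_add_le _ _).trans ?_
  have t1 : ‖freeRes B z (potOp hp.memLp hq.memLp (freeRes B z f))‖ ≤ 1 / 4 * ‖u‖ := by
    refine le_of_mul_le_mul_left ((hD z hz f).trans ?_) hz0
    calc D * ‖f‖ ≤ D * (N * ‖u‖) := by gcongr
      _ = (4 * D * N) * (1 / 4 * ‖u‖) := by ring
      _ ≤ ‖z‖ * (1 / 4 * ‖u‖) := by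
        gcongr
        linarith
  have t2 : ‖freeRes B z (W (freeRes B z f))‖ ≤ 1 / 4 * ‖u‖ := by
    calc ‖freeRes B z (W (freeRes B z f))‖ ≤ C * ‖W (freeRes B z f)‖ := hC z hz _
      _ ≤ C * (2 * ε * (C * (N * ‖u‖))) := by
        refine mul_le_mul_of_nonneg_left ((W.le_opNorm _).trans ?_) hC0.le
        refine mul_le_mul hWn ((hC z hz f).trans ?_) (norm_nonneg _) (by positivity)
        gcongr
      _ = (N / (N + 1)) * (1 / 4 * ‖u‖) := by rw [hε]; field_simp; ring
      _ ≤ 1 * (1 / 4 * ‖u‖) := by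
        gcongr
        rw [div_le_one (by positivity)]
        linarith
      _ = _ := one_mul _
  linarith

/-! ### Exponentially weighted estimates -/

/-- Half of the rate pays, through the triangle inequality, for moving the weight from x to s, where
it bounds v; the other half remains as the kernel. -/
theorem exp_mul_foldLap_mul_le {n v g : ℝ → ℝ} (hn : Integrable n mu) (hg : Integrable g mu)
    (hn0 : ∀ s, 0 ≤ n s) (hgn : ∀ᵐ s ∂mu, g s ≤ n s * v s) {τ M x₀ : ℝ} (hτ : 0 ≤ τ)
    (hM : ∀ s ∈ Icc 0 π, v s * Real.exp (-(τ / 2 * |rho x₀ - rho s|)) ≤ M) (hv : ∀ s, 0 ≤ v s)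
    (x : ℝ) :
    Real.exp (-(τ / 2 * |rho x₀ - rho x|)) * foldLap τ x g ≤ M * foldLap (τ / 2) x n := by
  unfold foldLap
  rw [← integral_const_mul, ← integral_const_mul]
  refine integral_mono_ae ((integrable_foldLap hg τ x).const_mul _)
    ((integrable_foldLap hn (τ / 2) x).const_mul _) ?_
  filter_upwards [hgn, ae_restrict_mem measurableSet_Icc] with s hs hsI
  calc Real.exp (-(τ / 2 * |rho x₀ - rho x|)) * (Real.exp (-(τ * |rho x - rho s|)) * g s)
      ≤ Real.exp (-(τ / 2 * |rho x₀ - rho x|)) *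
        (Real.exp (-(τ * |rho x - rho s|)) * (n s * v s)) := by gcongr
    _ = Real.exp (-(τ / 2 * |rho x₀ - rho x|) + -(τ * |rho x - rho s|)) * (n s * v s) := by
        rw [Real.exp_add]; ring
    _ ≤ Real.exp (-(τ / 2 * |rho x₀ - rho s|) + -(τ / 2 * |rho x - rho s|)) * (n s * v s) := by
        refine mul_le_mul_of_nonneg_right (Real.exp_le_exp.2 ?_) (mul_nonneg (hn0 s) (hv s))
        have := mul_le_mul_of_nonneg_left (abs_sub_le (rho x₀) (rho x) (rho s)) (by positivity : (0:ℝ) ≤ τ / 2)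
        linarith
    _ = (v s * Real.exp (-(τ / 2 * |rho x₀ - rho s|))) *
        (Real.exp (-(τ / 2 * |rho x - rho s|)) * n s) := by rw [Real.exp_add]; ring
    _ ≤ M * (Real.exp (-(τ / 2 * |rho x - rho s|)) * n s) :=
        mul_le_mul_of_nonneg_right (hM s hsI) (mul_nonneg (Real.exp_pos _).le (hn0 s))

theorem foldLap_anti {n : ℝ → ℝ} (hn : Integrable n mu) (h0 : ∀ s, 0 ≤ n s) {τ τ' : ℝ}
    (h : τ' ≤ τ) (x : ℝ) : foldLap τ x n ≤ foldLap τ' x n := by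
  refine integral_mono (integrable_foldLap hn τ x) (integrable_foldLap hn τ' x) fun s => ?_
  refine mul_le_mul_of_nonneg_right (Real.exp_le_exp.2 ?_) (h0 s)
  have := mul_le_mul_of_nonneg_right h (abs_nonneg (rho x - rho s))
  linarith

/-- Let M be the maximum of |u| times a weight of rate τ/2 centred at the given point, where τ = |Im
z|. Inserting the free estimate at the maximum point gives M ≤ C Λ_f + M · C Λ_v, where Λ denotes
folded Laplace transforms of rate τ/2. For large τ the second term is at most M/2, which bounds u.
The bound for the difference follows by feeding this into u - R⁰f = R⁰(vu). -/
theorem fullRes_bound {P Q : ℝ → ℂ} (hP : MemLp P 2 mu) (hQ : MemLp Q 2 mu)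
    (B : Matrix (Fin 2) (Fin 4) ℂ) {δ : ℝ} (hδ : 0 < δ) :
    ∃ C τ₀ : ℝ, 0 < C ∧ 0 < τ₀ ∧ ∀ z, CharDetGE B δ z → IsUnit (1 - bsOp hP hQ B z) →
      τ₀ ≤ |z.im| → ∀ f : H, ∀ x ∈ Icc 0 π,
        ‖fullRes hP hQ B z f x‖ ≤ C * foldLap (|z.im| / 2) x (fun s => ‖f s‖) ∧
        ‖fullRes hP hQ B z f x - freeRes B z f x‖ ≤
          C * (foldLap (|z.im| / 2) x (fun s => ‖f s‖) * foldLap (|z.im| / 2) x (potSize P Q)) := by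
  obtain ⟨C, hC1, hC⟩ := freeRes_bound B hδ
  set N := (eLpNorm (potSize P Q) 2 mu).toReal with hN
  have hN0 : 0 ≤ N := ENNReal.toReal_nonneg
  have hC0 : 0 < C := by linarith
  have hnI : Integrable (potSize P Q) mu := (memLp_potSize hP hQ).integrable one_le_two
  -- The threshold makes C · √(4/τ) · N at most 1/2, which is the absorption condition; the added 1
  -- makes it positive.
  refine ⟨2 * C ^ 2, 16 * (C * N) ^ 2 + 1, by positivity, by positivity,
    fun z hz hu hτz f x₀ hx₀ => ?_⟩
  set τ := |z.im|
  have hτ0 : 0 < τ := lt_of_lt_of_le (by positivity) hτz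
  set u := fullRes hP hQ B z f with hudef
  have hueq := (eq_fullRes_iff hu).1 hudef
  set g := potOp hP hQ u with hg
  have hfI : Integrable (fun s => ‖f s‖) mu := (memLp_norm f).integrable one_le_two
  have hgI : Integrable (fun s => ‖g s‖) mu := (memLp_norm g).integrable one_le_two
  have hgn : ∀ᵐ s ∂mu, ‖g s‖ ≤ potSize P Q s * ‖u s‖ := by
    filter_upwards [coeFn_potOp hP hQ u] with s hs
    rw [hg, hs]
    exact norm_pot_le P Q s (u s)
  have hux : ∀ x ∈ Icc 0 π, ‖u x‖ ≤ C * (foldLap τ x (fun s => ‖f s‖) +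
      foldLap τ x (fun s => ‖g s‖)) := by
    intro x hx
    rw [← foldLap_add hfI hgI, hueq]
    refine (hC z hz _ x hx).trans (mul_le_mul_of_nonneg_left (foldLap_mono
      ((memLp_norm _).integrable one_le_two) (hfI.add hgI) ?_ _ _) hC0.le)
    filter_upwards [Lp.coeFn_add f g] with s hs
    rw [hs]
    exact norm_add_le _ _
  -- the weighted maximum of `u`
  obtain ⟨xm, hxm, hmax⟩ := (isCompact_Icc (a := (0 : ℝ)) (b := π)).exists_isMaxOn
    ⟨0, le_rfl, Real.pi_pos.le⟩
    (f := fun x => ‖u x‖ * Real.exp (-(τ / 2 * |rho x₀ - rho x|)))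
    (Continuous.continuousOn (by fun_prop))
  set M := ‖u xm‖ * Real.exp (-(τ / 2 * |rho x₀ - rho xm|)) with hM
  have hM0 : 0 ≤ M := by positivity
  have hM' : ∀ s ∈ Icc 0 π, ‖u s‖ * Real.exp (-(τ / 2 * |rho x₀ - rho s|)) ≤ M :=
    fun s hs => hmax hs
  have hkey := exp_mul_foldLap_mul_le hnI hgI (potSize_nonneg P Q) hgn hτ0.le hM'
    (fun s => norm_nonneg _)
  have hsmall : C * foldLap (τ / 2) xm (potSize P Q) ≤ 1 / 2 := by
    have h1 := foldLap_le_sqrt (memLp_potSize hP hQ) (potSize_nonneg P Q) (half_pos hτ0) xm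
    have h2 : C * (√(2 / (τ / 2)) * N) ≤ 1 / 2 := by
      refine abs_le_of_sq_le_sq' (b := 1 / 2) ?_ (by norm_num) |>.2
      rw [mul_pow, mul_pow, Real.sq_sqrt (by positivity)]
      have : C ^ 2 * (2 / (τ / 2) * N ^ 2) = 4 * (C * N) ^ 2 / τ := by field_simp; ring
      rw [this, div_le_iff₀ hτ0]
      linarith
    exact (mul_le_mul_of_nonneg_left h1 hC0.le).trans h2
  have hLf : Real.exp (-(τ / 2 * |rho x₀ - rho xm|)) * foldLap τ xm (fun s => ‖f s‖) ≤
      foldLap (τ / 2) x₀ (fun s => ‖f s‖) := by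
    refine le_trans ?_ (exp_mul_foldLap_le hfI (fun s => norm_nonneg _) (half_pos hτ0).le x₀ xm)
    exact mul_le_mul_of_nonneg_left (foldLap_anti hfI (fun s => norm_nonneg _) (by linarith) _)
      (Real.exp_pos _).le
  have hMle : M ≤ 2 * C * foldLap (τ / 2) x₀ (fun s => ‖f s‖) := by
    have h1 : M ≤ C * foldLap (τ / 2) x₀ (fun s => ‖f s‖) +
        M * (C * foldLap (τ / 2) xm (potSize P Q)) := by
      calc M ≤ C * (foldLap τ xm (fun s => ‖f s‖) + foldLap τ xm (fun s => ‖g s‖)) *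
            Real.exp (-(τ / 2 * |rho x₀ - rho xm|)) := by
            rw [hM]; gcongr; exact hux xm hxm
        _ = C * (Real.exp (-(τ / 2 * |rho x₀ - rho xm|)) * foldLap τ xm (fun s => ‖f s‖)) +
            C * (Real.exp (-(τ / 2 * |rho x₀ - rho xm|)) * foldLap τ xm (fun s => ‖g s‖)) := by
            ring
        _ ≤ C * foldLap (τ / 2) x₀ (fun s => ‖f s‖) + C * (M * foldLap (τ / 2) xm (potSize P Q)) := by
            exact add_le_add (mul_le_mul_of_nonneg_left hLf hC0.le)
              (mul_le_mul_of_nonneg_left (hkey xm) hC0.le)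
        _ = _ := by ring
    have h2 := mul_le_mul_of_nonneg_left hsmall hM0
    linarith
  have hL0 : 0 ≤ foldLap (τ / 2) x₀ (fun s => ‖f s‖) := foldLap_nonneg (fun s => norm_nonneg _) _ _
  constructor
  · have h1 := hM' x₀ hx₀
    simp only [sub_self, abs_zero, mul_zero, neg_zero, Real.exp_zero, mul_one] at h1
    refine h1.trans (hMle.trans ?_)
    gcongr
    nlinarith
  · have e : u x₀ - freeRes B z f x₀ = freeRes B z g x₀ := by
      have : u = freeRes B z f + freeRes B z g := by
        conv_lhs => rw [hueq]
        exact map_add _ _ _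
      rw [this]
      exact add_sub_cancel_left _ _
    rw [e]
    refine (hC z hz g x₀ hx₀).trans ?_
    have h1 := hkey x₀
    simp only [sub_self, abs_zero, mul_zero, neg_zero, Real.exp_zero, one_mul] at h1
    have h2 : 0 ≤ foldLap (τ / 2) x₀ (potSize P Q) := foldLap_nonneg (potSize_nonneg P Q) _ _
    calc C * foldLap τ x₀ (fun s => ‖g s‖) ≤ C * (M * foldLap (τ / 2) x₀ (potSize P Q)) := by
          gcongr
      _ ≤ C * ((2 * C * foldLap (τ / 2) x₀ (fun s => ‖f s‖)) * foldLap (τ / 2) x₀ (potSize P Q)) := by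
          gcongr
      _ = _ := by ring

end SupNorm

/-! ### Lower bounds for the characteristic determinant -/

theorem charDet_eq {B : Matrix (Fin 2) (Fin 4) ℂ} {τ₁ τ₂ : ℂ} (h : IsExponentPair B τ₁ τ₂)
    (w : ℂ) : charDet B w = minor B 0 3 * (w - Complex.exp (Complex.I * π * τ₁)) *
      (w - Complex.exp (Complex.I * π * τ₂)) := by
  rw [← h.1 w, charDet]; ring

theorem charDetInv_eq {B : Matrix (Fin 2) (Fin 4) ℂ} {τ₁ τ₂ : ℂ} (h : IsExponentPair B τ₁ τ₂)
    (w : ℂ) : charDetInv B w = minor B 0 3 * (1 - w * Complex.exp (Complex.I * π * τ₁)) *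
      (1 - w * Complex.exp (Complex.I * π * τ₂)) := by
  have h0 := h.1 0
  have h1 := h.1 1
  rw [charDetInv]
  linear_combination w * h1 + (w ^ 2 - w) * h0

theorem half_le_norm_sub_one_of_re_nonpos {q : ℂ} (h : q.re ≤ 0) : 1 / 2 ≤ ‖1 - q‖ := by
  have h1 := Complex.re_le_norm (1 - q)
  rw [Complex.sub_re, Complex.one_re] at h1
  linarith

theorem half_le_norm_sub_one_of_norm_le {q : ℂ} (h : ‖q‖ ≤ 1 / 2) : 1 / 2 ≤ ‖1 - q‖ := by
  have h1 := norm_sub_norm_le (1 : ℂ) q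
  rw [norm_one] at h1
  linarith

theorem exp_neg_pi_mul_le {t : ℝ} (ht : 1 ≤ t) : Real.exp (-(π * t)) ≤ 1 / 2 := by
  rw [Real.exp_neg, one_div]
  refine inv_anti₀ two_pos ?_
  have h1 := Real.add_one_le_exp (π * t)
  nlinarith [Real.pi_gt_three]

/-- Since N + 1 is odd, passing from m to x shifts the angle by an odd multiple of π and reverses
the sign of a cosine that is nonnegative because r is within 1/2 of m. -/
theorem cos_pi_mul_nonpos {x m r : ℝ} {N : ℕ} (hN : Even N) (hx : |x - m| = N + 1)
    (hr : |m - r| ≤ 1 / 2) : Real.cos (π * (x - r)) ≤ 0 := by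
  obtain ⟨k, rfl⟩ := hN
  have hd : 0 ≤ Real.cos (π * (m - r)) := by
    have h1 := abs_le.1 hr
    refine Real.cos_nonneg_of_mem_Icc ⟨?_, ?_⟩ <;> nlinarith [Real.pi_pos]
  have key : Real.cos (π * (x - r)) = -Real.cos (π * (m - r)) := by
    rcases (abs_eq (by positivity)).1 hx with h | h
    · have e : π * (x - r) = π * (m - r) + π + k * (2 * π) := by
        push_cast at h
        linear_combination π * h
      rw [e, Real.cos_add_nat_mul_two_pi, Real.cos_add_pi]
    · have e : π * (x - r) = π * (m - r) - π - k * (2 * π) := by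
        push_cast at h
        linear_combination π * h
      rw [e, Real.cos_sub_nat_mul_two_pi, Real.cos_sub_pi]
  linarith

/-- Far from the real axis the exponential has modulus at most 1/2; on the vertical lines its real
part is nonpositive. Either way it stays at distance 1/2 from 1. -/
theorem half_le_norm_one_sub_exp {z τ : ℂ} {m : ℝ} (hr : |m - τ.re| ≤ 1 / 2)
    (hz : |τ.im| + 1 ≤ |z.im| ∨ ∃ N : ℕ, Even N ∧ |z.re - m| = N + 1) :
    (0 ≤ z.im → 1 / 2 ≤ ‖1 - Complex.exp (Complex.I * π * (z - τ))‖) ∧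
    (z.im ≤ 0 → 1 / 2 ≤ ‖1 - Complex.exp (-(Complex.I * π * (z - τ)))‖) := by
  have hre : (Complex.I * π * (z - τ)).re = -(π * (z.im - τ.im)) := by simp
  have him : (Complex.I * π * (z - τ)).im = π * (z.re - τ.re) := by simp
  rcases hz with hz | ⟨N, hN, hz⟩
  · constructor
    · intro h
      rw [abs_of_nonneg h] at hz
      refine half_le_norm_sub_one_of_norm_le ?_
      rw [Complex.norm_exp, hre]
      exact exp_neg_pi_mul_le (by linarith [le_abs_self τ.im])
    · intro h
      rw [abs_of_nonpos h] at hz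
      refine half_le_norm_sub_one_of_norm_le ?_
      rw [Complex.norm_exp, Complex.neg_re, hre,
        show -(-(π * (z.im - τ.im))) = -(π * (τ.im - z.im)) by ring]
      exact exp_neg_pi_mul_le (by linarith [neg_abs_le τ.im])
  · have hc := cos_pi_mul_nonpos hN hz hr
    constructor <;> intro _ <;> refine half_le_norm_sub_one_of_re_nonpos ?_
    · rw [Complex.exp_re, him]
      exact mul_nonpos_of_nonneg_of_nonpos (Real.exp_pos _).le hc
    · rw [Complex.exp_re, Complex.neg_im, him, Real.cos_neg]
      exact mul_nonpos_of_nonneg_of_nonpos (Real.exp_pos _).le hc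

theorem exists_charDetGE {B : Matrix (Fin 2) (Fin 4) ℂ} (hB : IsRegularBC B) {τ₁ τ₂ : ℂ}
    (hτ : IsExponentPair B τ₁ τ₂) : ∃ δ T : ℝ, 0 < δ ∧ 0 < T ∧ ∀ z : ℂ,
      (T ≤ |z.im| ∨ ∃ N : ℕ, Even N ∧ |z.re - (τ₁.re + τ₂.re) / 2| = N + 1) →
        CharDetGE B δ z := by
  set m := (τ₁.re + τ₂.re) / 2 with hm
  have h12 := abs_le.1 hτ.2
  -- As m is the midpoint, the normalisation |Re τ₁ - Re τ₂| ≤ 1 places both real parts within 1/2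
  -- of it.
  have hr₁ : |m - τ₁.re| ≤ 1 / 2 := by
    rw [abs_le]; constructor <;> linarith
  have hr₂ : |m - τ₂.re| ≤ 1 / 2 := by
    rw [abs_le]; constructor <;> linarith
  have h03 : 0 < ‖minor B 0 3‖ := norm_pos_iff.2 hB.1
  set ζ₁ := Complex.exp (Complex.I * π * τ₁) with hζ₁
  set ζ₂ := Complex.exp (Complex.I * π * τ₂) with hζ₂
  have hζ₁0 : 0 < ‖ζ₁‖ := norm_pos_iff.2 (Complex.exp_ne_zero _)
  have hζ₂0 : 0 < ‖ζ₂‖ := norm_pos_iff.2 (Complex.exp_ne_zero _)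
  -- Each linear factor contributes 1/2. Factoring out the roots costs |ζ₁ζ₂| for `charDet` and
  -- nothing for `charDetInv`, whence the minimum.
  refine ⟨‖minor B 0 3‖ / 4 * min (‖ζ₁‖ * ‖ζ₂‖) 1, |τ₁.im| + |τ₂.im| + 1, by positivity,
    by positivity, fun z hz => ?_⟩
  have k₁ := half_le_norm_one_sub_exp hr₁ (z := z) (hz.imp_left fun h => by
    linarith [abs_nonneg τ₂.im])
  have k₂ := half_le_norm_one_sub_exp hr₂ (z := z) (hz.imp_left fun h => by
    linarith [abs_nonneg τ₁.im])
  constructor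
  · intro him
    have e : ∀ τ : ℂ, ‖Complex.exp (Complex.I * z * π) - Complex.exp (Complex.I * π * τ)‖ =
        ‖Complex.exp (Complex.I * π * τ)‖ * ‖1 - Complex.exp (Complex.I * π * (z - τ))‖ := by
      intro τ
      rw [← norm_mul, mul_sub, mul_one, ← Complex.exp_add, norm_sub_rev]
      congr 3; ring
    rw [charDet_eq hτ, norm_mul, norm_mul, e, e, ← hζ₁, ← hζ₂]
    calc ‖minor B 0 3‖ / 4 * min (‖ζ₁‖ * ‖ζ₂‖) 1 ≤ ‖minor B 0 3‖ / 4 * (‖ζ₁‖ * ‖ζ₂‖) := by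
          gcongr; exact min_le_left _ _
      _ = ‖minor B 0 3‖ * (‖ζ₁‖ * (1 / 2)) * (‖ζ₂‖ * (1 / 2)) := by ring
      _ ≤ _ := by
          gcongr
          exacts [k₁.1 him, k₂.1 him]
  · intro him
    have e : ∀ τ : ℂ, Complex.exp (-(Complex.I * z) * π) * Complex.exp (Complex.I * π * τ) =
        Complex.exp (-(Complex.I * π * (z - τ))) := by
      intro τ
      rw [← Complex.exp_add]
      congr 1; ring
    rw [charDetInv_eq hτ, norm_mul, norm_mul, e, e]
    calc ‖minor B 0 3‖ / 4 * min (‖ζ₁‖ * ‖ζ₂‖) 1 ≤ ‖minor B 0 3‖ / 4 * 1 := by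
          gcongr; exact min_le_right _ _
      _ = ‖minor B 0 3‖ * (1 / 2) * (1 / 2) := by ring
      _ ≤ _ := by
          gcongr
          exacts [k₁.2 him, k₂.2 him]

/-! ### Contour integrals -/

/-- The integrals in `rectIntegral` are integrals of integrable functions. -/
structure RectIntegrable {G : Type*} [NormedAddCommGroup G] (f : ℂ → G) (a b c d : ℝ) : Prop where
  bot : IntervalIntegrable (fun x : ℝ => f (x + c * Complex.I)) volume a b
  top : IntervalIntegrable (fun x : ℝ => f (x + d * Complex.I)) volume a b
  right : IntervalIntegrable (fun t : ℝ => f (b + t * Complex.I)) volume c d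
  left : IntervalIntegrable (fun t : ℝ => f (a + t * Complex.I)) volume c d

/-- The boundary of a rectangle. -/
def rectBoundary (a b c d : ℝ) : Set ℂ :=
  {z | (z.im = c ∨ z.im = d) ∨ (z.re = a ∨ z.re = b)}

/-- `rectBoundary` consists of the four full lines, so every parametrisation lies in it without
restricting the parameter. -/
theorem rectIntegrable_of_continuousOn {G : Type*} [NormedAddCommGroup G] {f : ℂ → G}
    {a b c d : ℝ} (h : ContinuousOn f (rectBoundary a b c d)) : RectIntegrable f a b c d where
  bot := (h.comp_continuous (by fun_prop) fun x => by simp [rectBoundary]).intervalIntegrable _ _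
  top := (h.comp_continuous (by fun_prop) fun x => by simp [rectBoundary]).intervalIntegrable _ _
  right := (h.comp_continuous (by fun_prop) fun x => by simp [rectBoundary]).intervalIntegrable _ _
  left := (h.comp_continuous (by fun_prop) fun x => by simp [rectBoundary]).intervalIntegrable _ _

section Contour

variable {E F G : Type*} [NormedAddCommGroup E] [NormedSpace ℂ E] [NormedAddCommGroup F]
  [NormedSpace ℂ F] [NormedAddCommGroup G] [NormedSpace ℂ G]

/-- Boundedness and the identity give Lipschitz continuity, and then the difference quotient tends
to -R(w)JR(w). Only derivatives within S are claimed, so S may contain isolated vertical lines. -/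
theorem differentiableOn_of_resolvent_identity {R : ℂ → E →L[ℂ] F} {J : F →L[ℂ] E} {S : Set ℂ}
    {C : ℝ} (hR : ∀ z ∈ S, ∀ w ∈ S, R z - R w = (w - z) • (R z ∘L J ∘L R w))
    (hC : ∀ z ∈ S, ‖R z‖ ≤ C) : DifferentiableOn ℂ R S := by
  intro w hw
  have hC0 : 0 ≤ C := (norm_nonneg _).trans (hC w hw)
  have hcont : Tendsto R (𝓝[S] w) (𝓝 (R w)) := by
    rw [tendsto_iff_norm_sub_tendsto_zero]
    have h0 : Tendsto (fun z => ‖w - z‖ * (C * (‖J‖ * C))) (𝓝[S] w) (𝓝 0) := by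
      have : Tendsto (fun z => ‖w - z‖ * (C * (‖J‖ * C))) (𝓝 w) (𝓝 (‖w - w‖ * (C * (‖J‖ * C)))) :=
        Continuous.tendsto (by fun_prop) w
      rw [sub_self, norm_zero, zero_mul] at this
      exact this.mono_left nhdsWithin_le_nhds
    refine squeeze_zero' (Eventually.of_forall fun _ => norm_nonneg _) ?_ h0
    filter_upwards [self_mem_nhdsWithin] with z hz
    rw [hR z hz w hw, norm_smul]
    gcongr
    refine (ContinuousLinearMap.opNorm_comp_le _ _).trans ?_
    refine mul_le_mul (hC z hz) ((ContinuousLinearMap.opNorm_comp_le _ _).trans ?_)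
      (norm_nonneg _) hC0
    gcongr
    exact hC w hw
  have hd : HasDerivWithinAt R (-(R w ∘L J ∘L R w)) S w := by
    rw [hasDerivWithinAt_iff_tendsto_slope]
    have h1 : Tendsto (fun z => -(R z ∘L J ∘L R w)) (𝓝[S \ {w}] w) (𝓝 (-(R w ∘L J ∘L R w))) := by
      refine Tendsto.neg ?_
      have h2 : Continuous fun T : E →L[ℂ] F => T ∘L (J ∘L R w) := by fun_prop
      exact (h2.tendsto (R w)).comp (hcont.mono_left (nhdsWithin_mono w sdiff_subset))
    refine h1.congr' ?_
    filter_upwards [self_mem_nhdsWithin] with z hz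
    have hzw : z - w ≠ 0 := sub_ne_zero.2 hz.2
    rw [slope_def_module, hR z hz.1 w hw, smul_smul, ← neg_sub z w, mul_neg, inv_mul_cancel₀ hzw,
      neg_one_smul]
  exact hd.differentiableWithinAt

theorem differentiableOn_clm_sub {R R' : ℂ → E →L[ℂ] F} {S : Set ℂ} (h : DifferentiableOn ℂ R S)
    (h' : DifferentiableOn ℂ R' S) : DifferentiableOn ℂ (fun z => R z - R' z) S := h.sub h'

theorem differentiableOn_clm_apply {R : ℂ → E →L[ℂ] F} {S : Set ℂ} (h : DifferentiableOn ℂ R S)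
    (L : (E →L[ℂ] F) →L[ℂ] G) : DifferentiableOn ℂ (fun z => L (R z)) S :=
  L.differentiable.comp_differentiableOn h

theorem rectIntegral_congr {f g : ℂ → G} {a b c d : ℝ}
    (h : ∀ z ∈ rectBoundary a b c d, f z = g z) :
    rectIntegral f a b c d = rectIntegral g a b c d := by
  unfold rectIntegral
  congr 1
  · congr 1
    · congr 1 <;> refine intervalIntegral.integral_congr fun x _ => h _ (by simp [rectBoundary])
    · congr 1
      exact intervalIntegral.integral_congr fun x _ => h _ (by simp [rectBoundary])
  · congr 1
    exact intervalIntegral.integral_congr fun x _ => h _ (by simp [rectBoundary])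

theorem rectIntegral_sub {f g : ℂ → G} {a b c d : ℝ} (hf : RectIntegrable f a b c d)
    (hg : RectIntegrable g a b c d) : rectIntegral f a b c d - rectIntegral g a b c d =
      rectIntegral (fun z => f z - g z) a b c d := by
  unfold rectIntegral
  rw [intervalIntegral.integral_sub hf.bot hg.bot, intervalIntegral.integral_sub hf.top hg.top,
    intervalIntegral.integral_sub hf.right hg.right, intervalIntegral.integral_sub hf.left hg.left]
  module

theorem rectIntegral_clm [CompleteSpace F] [CompleteSpace G] (L : F →L[ℂ] G) {f : ℂ → F}
    {a b c d : ℝ} (hf : RectIntegrable f a b c d) :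
    rectIntegral (fun z => L (f z)) a b c d = L (rectIntegral f a b c d) := by
  unfold rectIntegral
  rw [L.intervalIntegral_comp_comm hf.bot, L.intervalIntegral_comp_comm hf.top,
    L.intervalIntegral_comp_comm hf.right, L.intervalIntegral_comp_comm hf.left]
  simp

theorem norm_rectIntegral_le (f : ℂ → G) {a b c d : ℝ} (hab : a ≤ b) (hcd : c ≤ d) :
    ‖rectIntegral f a b c d‖ ≤ (∫ x in a..b, ‖f (x + c * Complex.I)‖) +
      (∫ x in a..b, ‖f (x + d * Complex.I)‖) + (∫ t in c..d, ‖f (b + t * Complex.I)‖) +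
      ∫ t in c..d, ‖f (a + t * Complex.I)‖ := by
  unfold rectIntegral
  refine (norm_sub_le _ _).trans (add_le_add ((norm_add_le _ _).trans (add_le_add
    ((norm_sub_le _ _).trans (add_le_add ?_ ?_)) ?_)) ?_)
  · exact intervalIntegral.norm_integral_le_integral_norm hab
  · exact intervalIntegral.norm_integral_le_integral_norm hab
  · rw [norm_smul, Complex.norm_I, one_mul]
    exact intervalIntegral.norm_integral_le_integral_norm hcd
  · rw [norm_smul, Complex.norm_I, one_mul]
    exact intervalIntegral.norm_integral_le_integral_norm hcd

/-- The two rectangles differ by the strips T ≤ |Im z| ≤ T', on which Cauchy's theorem applies;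
nothing is assumed inside the smaller rectangle. -/
theorem rectIntegral_eq_of_differentiableOn [CompleteSpace G] {f : ℂ → G} {S : Set ℂ}
    {a b T T' : ℝ} (hf : DifferentiableOn ℂ f S) (hTT : T ≤ T')
    (hS : ∀ z : ℂ, T ≤ |z.im| → z ∈ S) (hSa : ∀ z : ℂ, z.re = a ∨ z.re = b → z ∈ S) :
    rectIntegral f a b (-T) T = rectIntegral f a b (-T') T' := by
  have hint : ∀ c c₁ c₂ : ℝ, c = a ∨ c = b →
      IntervalIntegrable (fun t : ℝ => f (c + t * Complex.I)) volume c₁ c₂ := fun c c₁ c₂ hc =>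
    (hf.continuousOn.comp_continuous (by fun_prop) fun x =>
      hSa _ (by simpa using hc)).intervalIntegrable _ _
  have h1 := Complex.integral_boundary_rect_eq_zero_of_differentiableOn f ⟨a, T⟩ ⟨b, T'⟩
    (hf.mono fun z hz => hS z (by
      have := (Complex.mem_reProdIm.1 hz).2
      simp only at this
      rw [uIcc_of_le hTT] at this
      exact this.1.trans (le_abs_self _)))
  have h2 := Complex.integral_boundary_rect_eq_zero_of_differentiableOn f ⟨a, -T'⟩ ⟨b, -T⟩
    (hf.mono fun z hz => hS z (by
      have := (Complex.mem_reProdIm.1 hz).2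
      simp only at this
      rw [uIcc_of_le (neg_le_neg hTT)] at this
      have h3 := this.2
      exact le_abs.2 (Or.inr (by linarith))))
  simp only at h1 h2
  have e : ∀ c, c = a ∨ c = b → ∫ t in (-T')..T', f (c + t * Complex.I) =
      (∫ t in (-T')..(-T), f (c + t * Complex.I)) + (∫ t in (-T)..T, f (c + t * Complex.I)) +
        ∫ t in T..T', f (c + t * Complex.I) := by
    intro c hc
    rw [intervalIntegral.integral_add_adjacent_intervals (hint c _ _ hc) (hint c _ _ hc),
      intervalIntegral.integral_add_adjacent_intervals (hint c _ _ hc) (hint c _ _ hc)]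
  unfold rectIntegral
  rw [e a (Or.inl rfl), e b (Or.inr rfl), ← sub_eq_zero]
  linear_combination (norm := module) (-1 : ℂ) • h1 + (-1 : ℂ) • h2

end Contour

/-! ### Integration along vertical lines -/

theorem aemeasurable_foldLapE {n : ℝ → ℝ} (hn : AEStronglyMeasurable n mu) (x : ℝ)
    (μ : Measure ℝ) [SFinite μ] : AEMeasurable (fun τ => foldLapE τ x n) μ := by
  have h1 : AEMeasurable (fun p : ℝ × ℝ => ‖n p.2‖ₑ) (μ.prod mu) :=
    hn.enorm.comp_quasiMeasurePreserving Measure.quasiMeasurePreserving_snd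
  have h2 : Measurable fun p : ℝ × ℝ =>
      ENNReal.ofReal (Real.exp (-(p.1 * |rho x - rho p.2|))) := by
    fun_prop
  exact (h2.aemeasurable.mul h1).lintegral_prod_right'

theorem lintegral_comp_half (k : ℝ → ℝ≥0∞) : ∫⁻ t, k (t / 2) = 2 * ∫⁻ t, k t := by
  have h := Real.smul_map_volume_mul_left (a := 1 / 2) (by norm_num)
  have he : MeasurableEmbedding fun t : ℝ => 1 / 2 * t :=
    (Homeomorph.mulLeft₀ (1 / 2 : ℝ) (by norm_num)).measurableEmbedding
  conv_rhs => rw [← h, lintegral_smul_measure, he.lintegral_map]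
  rw [smul_eq_mul, ← mul_assoc, abs_of_pos (by norm_num), ← ENNReal.ofReal_ofNat 2,
    ← ENNReal.ofReal_mul (by norm_num)]
  norm_num
  refine lintegral_congr fun t => ?_
  congr 1; ring

/-- Cauchy–Schwarz in the rate combined with the Schur test for each factor. The factor 4 comes from
the two signs of t and from the halved rate. -/
theorem lintegral_foldLapE_mul_le {f n : ℝ → ℝ} (hf : MemLp f 2 mu) (hn : MemLp n 2 mu) (x : ℝ) :
    ∫⁻ t, foldLapE (|t| / 2) x f * foldLapE (|t| / 2) x n ≤
      ENNReal.ofReal (16 * π * ((eLpNorm f 2 mu).toReal * (eLpNorm n 2 mu).toReal)) := by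
  have e1 : ∫⁻ t, foldLapE (|t| / 2) x f * foldLapE (|t| / 2) x n =
      4 * ∫⁻ τ in Ioi 0, foldLapE τ x f * foldLapE τ x n := by
    have := lintegral_comp_half fun t => foldLapE |t| x f * foldLapE |t| x n
    simp only [abs_div, abs_two] at this
    rw [this, lintegral_comp_abs_eq fun t => foldLapE t x f * foldLapE t x n, ← mul_assoc]
    norm_num
  set I := ∫⁻ τ in Ioi 0, foldLapE τ x f * foldLapE τ x n with hI
  have h2 : I ^ 2 ≤ (ENNReal.ofReal (4 * π) * (eLpNorm f 2 mu * eLpNorm n 2 mu)) ^ 2 := by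
    refine (sq_lintegral_mul_le (aemeasurable_foldLapE hf.1 x _)
      (aemeasurable_foldLapE hn.1 x _)).trans ?_
    refine (mul_le_mul' (lintegral_foldLapE_sq_le hf.1 x) (lintegral_foldLapE_sq_le hn.1 x)).trans
      (le_of_eq ?_)
    rw [lintegral_enorm_sq_eq, lintegral_enorm_sq_eq]
    ring
  have h3 : I ≤ ENNReal.ofReal (4 * π) * (eLpNorm f 2 mu * eLpNorm n 2 mu) :=
    (ENNReal.pow_le_pow_left_iff two_ne_zero).1 h2
  rw [e1]
  calc 4 * I ≤ 4 * (ENNReal.ofReal (4 * π) * (eLpNorm f 2 mu * eLpNorm n 2 mu)) := by gcongr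
    _ = ENNReal.ofReal (16 * π * ((eLpNorm f 2 mu).toReal * (eLpNorm n 2 mu).toReal)) := by
      rw [ENNReal.ofReal_mul (p := 16 * π) (by positivity),
        ENNReal.ofReal_mul (p := (eLpNorm f 2 mu).toReal) ENNReal.toReal_nonneg,
        ENNReal.ofReal_toReal hf.eLpNorm_ne_top, ENNReal.ofReal_toReal hn.eLpNorm_ne_top,
        ← mul_assoc, ← ENNReal.ofReal_ofNat 4, ← ENNReal.ofReal_mul (by norm_num)]
      congr 2; ring

/-- A uniform bound on the fixed segment |t| ≤ T₀ and the product bound elsewhere; the result does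
not depend on T. -/
theorem integral_vertical_le {f n : ℝ → ℝ} (hf : MemLp f 2 mu) (hn : MemLp n 2 mu)
    (hf0 : ∀ s, 0 ≤ f s) (hn0 : ∀ s, 0 ≤ n s) (x : ℝ) {g : ℝ → ℝ} {A C T₀ T : ℝ}
    (hA : 0 ≤ A) (hC : 0 ≤ C) (hT₀ : 0 ≤ T₀) (hT : 0 ≤ T) (hg0 : ∀ t, 0 ≤ g t)
    (hgI : IntervalIntegrable g volume (-T) T) (hg₁ : ∀ t, |t| ≤ T₀ → g t ≤ A)
    (hg₂ : ∀ t, T₀ ≤ |t| → g t ≤ C * (foldLap (|t| / 2) x f * foldLap (|t| / 2) x n)) :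
    ∫ t in (-T)..T, g t ≤
      A * (2 * T₀) + C * (16 * π * ((eLpNorm f 2 mu).toReal * (eLpNorm n 2 mu).toReal)) := by
  have hfI := hf.integrable one_le_two
  have hnI := hn.integrable one_le_two
  rw [intervalIntegral.integral_of_le (by linarith),
    ← ENNReal.ofReal_le_ofReal_iff (by positivity),
    ofReal_integral_eq_lintegral_ofReal hgI.1 (Eventually.of_forall hg0)]
  calc ∫⁻ t in Ioc (-T) T, ENNReal.ofReal (g t) ≤ ∫⁻ t, ENNReal.ofReal (g t) :=
        setLIntegral_le_lintegral _ _
    _ ≤ ∫⁻ t, ((Icc (-T₀) T₀).indicator (fun _ => ENNReal.ofReal A) t +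
        ENNReal.ofReal C * (foldLapE (|t| / 2) x f * foldLapE (|t| / 2) x n)) := by
        refine lintegral_mono fun t => ?_
        by_cases ht : |t| ≤ T₀
        · rw [indicator_of_mem (show t ∈ Icc (-T₀) T₀ from abs_le.1 ht)]
          exact (ENNReal.ofReal_le_ofReal (hg₁ t ht)).trans le_self_add
        · refine le_trans ?_ le_add_self
          rw [← ofReal_foldLap hfI hf0, ← ofReal_foldLap hnI hn0,
            ← ENNReal.ofReal_mul (foldLap_nonneg hf0 _ _), ← ENNReal.ofReal_mul hC]
          exact ENNReal.ofReal_le_ofReal (hg₂ t (not_le.1 ht).le)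
    _ = ENNReal.ofReal A * ENNReal.ofReal (2 * T₀) +
        ENNReal.ofReal C * ∫⁻ t, foldLapE (|t| / 2) x f * foldLapE (|t| / 2) x n := by
        rw [lintegral_add_left (measurable_const.indicator measurableSet_Icc),
          lintegral_indicator_const measurableSet_Icc, Real.volume_Icc,
          lintegral_const_mul' _ _ ENNReal.ofReal_ne_top]
        congr 3; ring
    _ ≤ ENNReal.ofReal A * ENNReal.ofReal (2 * T₀) + ENNReal.ofReal C *
        ENNReal.ofReal (16 * π * ((eLpNorm f 2 mu).toReal * (eLpNorm n 2 mu).toReal)) := by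
        gcongr
        exact lintegral_foldLapE_mul_le hf hn x
    _ = _ := by
        rw [← ENNReal.ofReal_mul hA, ← ENNReal.ofReal_mul hC, ENNReal.ofReal_add]
        · positivity
        · positivity

/-! ### The contours -/

/-- The part of the plane that contains all the contours. -/
def contourRegion (m : ℝ) (N₀ : ℕ) (T₀ : ℝ) : Set ℂ :=
  {z | T₀ ≤ |z.im| ∨ ∃ N : ℕ, N₀ ≤ N ∧ Even N ∧ |z.re - m| = N + 1}

theorem rectBoundary_subset_contourRegion {m T₀ T : ℝ} {N₀ N : ℕ} (hT : T₀ ≤ T)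
    (hN : N₀ ≤ N) (hNe : Even N) :
    rectBoundary (m - (N + 1)) (m + (N + 1)) (-T) T ⊆ contourRegion m N₀ T₀ := by
  have h1 : (0 : ℝ) ≤ N + 1 := by positivity
  rintro z ((h | h) | (h | h))
  · left; rw [h, abs_neg]; exact hT.trans (le_abs_self _)
  · left; rw [h]; exact hT.trans (le_abs_self _)
  · refine Or.inr ⟨N, hN, hNe, ?_⟩
    rw [h, sub_sub_cancel_left, abs_neg, abs_of_nonneg h1]
  · refine Or.inr ⟨N, hN, hNe, ?_⟩
    rw [h, add_sub_cancel_left, abs_of_nonneg h1]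

theorem half_le_norm_of_abs_re_sub {m N₀ M : ℝ} {z : ℂ} (hN : 2 * |m| ≤ N₀) (hM : N₀ ≤ M)
    (h : |z.re - m| = M) : M / 2 ≤ ‖z‖ := by
  have h1 := Complex.abs_re_le_norm z
  have h2 : |z.re - m| ≤ |z.re| + |m| := abs_sub _ _
  linarith

/-! ### The free operator as the case of zero potential -/

section Free

variable (B : Matrix (Fin 2) (Fin 4) ℂ) (z : ℂ)

theorem bsOp_zero : bsOp (P := 0) (Q := 0) MemLp.zero MemLp.zero B z = 0 := by
  have h : ∀ u : X, potOp (P := 0) (Q := 0) (MemLp.zero (p := 2) (μ := mu)) MemLp.zero u = 0 := by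
    intro u
    refine Lp.ext ?_
    filter_upwards [coeFn_potOp (P := 0) (Q := 0) (MemLp.zero (p := 2) (μ := mu)) MemLp.zero u,
      Lp.coeFn_zero C2 2 mu] with x h1 h2
    rw [h1, h2]
    ext i
    fin_cases i <;> simp
  ext1 u
  change freeRes B z (potOp _ _ u) = 0
  rw [h u, map_zero]

theorem isUnit_one_sub_bsOp_zero :
    IsUnit (1 - bsOp (P := 0) (Q := 0) MemLp.zero MemLp.zero B z) := by
  rw [bsOp_zero]
  have : IsUnit ((1 : X →L[ℂ] X) - 0) := by
    rw [sub_zero (1 : X →L[ℂ] X)]; exact isUnit_one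
  exact this

theorem fullRes_zero : fullRes (P := 0) (Q := 0) MemLp.zero MemLp.zero B z = freeRes B z := by
  ext1 f
  have h := (eq_fullRes_iff (isUnit_one_sub_bsOp_zero B z) (f := f)).1 rfl
  have e : freeRes B z (potOp (P := 0) (Q := 0) MemLp.zero MemLp.zero
      (fullRes (P := 0) (Q := 0) MemLp.zero MemLp.zero B z f)) =
      bsOp (P := 0) (Q := 0) MemLp.zero MemLp.zero B z
        (fullRes (P := 0) (Q := 0) MemLp.zero MemLp.zero B z f) := rfl
  rw [h, map_add]
  rw [e, bsOp_zero]
  exact add_zero _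

end Free

theorem resolventOf_eq {E : Type*} [NormedAddCommGroup E] [NormedSpace ℂ E] {A : E →ₗ.[ℂ] E}
    {z : ℂ} {R : E →L[ℂ] E} (h : IsResolventAt A z R) : resolventOf A z = R := by
  have he : ∃ R, IsResolventAt A z R := ⟨R, h⟩
  rw [resolventOf, dif_pos he]
  exact he.choose_spec.unique h

/-! ### Uniform resolvent bounds on the contours -/

variable {P Q : ℝ → ℂ} (hP : MemLp P 2 mu) (hQ : MemLp Q 2 mu) (B : Matrix (Fin 2) (Fin 4) ℂ)

/-- Uniform bounds for the resolvents on the region of the contours. -/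
structure ResolventBounds (m : ℝ) (N₀ : ℕ) (T₀ δ C : ℝ) : Prop where
  T₀_pos : 0 < T₀
  δ_pos : 0 < δ
  C_pos : 0 < C
  le_N₀ : 2 * |m| ≤ N₀
  charDet : ∀ z ∈ contourRegion m N₀ T₀, CharDetGE B δ z
  isUnit : ∀ z ∈ contourRegion m N₀ T₀, IsUnit (1 - bsOp hP hQ B z)
  norm_free : ∀ z ∈ contourRegion m N₀ T₀, ‖freeRes B z‖ ≤ C
  norm_full : ∀ z ∈ contourRegion m N₀ T₀, ‖fullRes hP hQ B z‖ ≤ C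
  full_le : ∀ z : ℂ, T₀ ≤ |z.im| → ∀ f : H, ∀ x ∈ Icc 0 π,
    ‖fullRes hP hQ B z f x‖ ≤ C * foldLap (|z.im| / 2) x (fun s => ‖f s‖)
  diff_le : ∀ z : ℂ, T₀ ≤ |z.im| → ∀ f : H, ∀ x ∈ Icc 0 π,
    ‖fullRes hP hQ B z f x - freeRes B z f x‖ ≤
      C * (foldLap (|z.im| / 2) x (fun s => ‖f s‖) * foldLap (|z.im| / 2) x (potSize P Q))

variable {B}

theorem exists_resolventBounds (hB : IsRegularBC B) {τ₁ τ₂ : ℂ} (hτ : IsExponentPair B τ₁ τ₂) :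
    ∃ (N₀ : ℕ) (T₀ δ C : ℝ), ResolventBounds hP hQ B ((τ₁.re + τ₂.re) / 2) N₀ T₀ δ C := by
  set m := (τ₁.re + τ₂.re) / 2
  obtain ⟨δ, T₁, hδ, hT₁, hdet⟩ := exists_charDetGE hB hτ
  obtain ⟨Λ, hΛ⟩ := exists_norm_bsOp_sq_le hP hQ B hδ
  obtain ⟨C₁, τ₀, hC₁, hτ₀, hfull⟩ := fullRes_bound hP hQ B hδ
  obtain ⟨C₂, hC₂, hfree⟩ := norm_freeRes_le B hδ
  -- Then |z| ≥ (N + 1)/2 ≥ Λ on the vertical lines, so (R⁰v)² is small there as well.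
  obtain ⟨N₀, hN₀⟩ := exists_nat_ge (max (2 * |m|) (2 * Λ))
  have hN₁ : 2 * |m| ≤ N₀ := (le_max_left _ _).trans hN₀
  have hN₂ : 2 * Λ ≤ N₀ := (le_max_right _ _).trans hN₀
  set T₀ := max T₁ (max Λ τ₀)
  have hTT₁ : T₁ ≤ T₀ := le_max_left _ _
  have hTΛ : Λ ≤ T₀ := (le_max_left _ _).trans (le_max_right _ _)
  have hTτ : τ₀ ≤ T₀ := (le_max_right _ _).trans (le_max_right _ _)
  have hd : ∀ z ∈ contourRegion m N₀ T₀, CharDetGE B δ z := by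
    rintro z (h | ⟨N, -, h1, h2⟩)
    · exact hdet z (Or.inl (hTT₁.trans h))
    · exact hdet z (Or.inr ⟨N, h1, h2⟩)
  have hz : ∀ z ∈ contourRegion m N₀ T₀, Λ ≤ ‖z‖ := by
    rintro z (h | ⟨N, h0, h1, h2⟩)
    · exact (hTΛ.trans h).trans (Complex.abs_im_le_norm z)
    · have h3 : (N₀ : ℝ) ≤ N + 1 := by exact_mod_cast h0.trans (Nat.le_succ N)
      have := half_le_norm_of_abs_re_sub hN₁ h3 h2
      linarith
  have hK : ∀ z ∈ contourRegion m N₀ T₀, ‖bsOp hP hQ B z * bsOp hP hQ B z‖ ≤ 1 / 2 :=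
    fun z h => hΛ z (hd z h) (hz z h)
  have hU : ∀ z ∈ contourRegion m N₀ T₀, IsUnit (1 - bsOp hP hQ B z) :=
    fun z h => isUnit_one_sub_bsOp (hK z h)
  have hC₂0 : 0 < C₂ := by linarith
  have hfree' : ∀ z ∈ contourRegion m N₀ T₀, ‖freeRes B z‖ ≤ C₂ := fun z h =>
    ContinuousLinearMap.opNorm_le_bound _ hC₂0.le (hfree z (hd z h))
  set C₃ := 2 * (1 + C₂ * ‖potOp hP hQ‖) * C₂
  have hfull' : ∀ z ∈ contourRegion m N₀ T₀, ‖fullRes hP hQ B z‖ ≤ C₃ := by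
    intro z h
    refine ContinuousLinearMap.opNorm_le_bound _ (by positivity) fun f => ?_
    refine (norm_fullRes_le (hK z h) f).trans ?_
    have h1 : ‖bsOp hP hQ B z‖ ≤ C₂ * ‖potOp hP hQ‖ :=
      (ContinuousLinearMap.opNorm_comp_le _ _).trans
        (mul_le_mul_of_nonneg_right (hfree' z h) (norm_nonneg _))
    calc 2 * (1 + ‖bsOp hP hQ B z‖) * ‖freeRes B z f‖
        ≤ 2 * (1 + C₂ * ‖potOp hP hQ‖) * (C₂ * ‖f‖) := by
          gcongr
          exact hfree z (hd z h) f
      _ = C₃ * ‖f‖ := by ring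
  refine ⟨N₀, T₀, δ, max C₁ (max C₂ C₃), hT₁.trans_le hTT₁, hδ, hC₁.trans_le (le_max_left _ _),
    hN₁, hd, hU, fun z h => (hfree' z h).trans ((le_max_left _ _).trans (le_max_right _ _)),
    fun z h => (hfull' z h).trans ((le_max_right _ _).trans (le_max_right _ _)),
    fun z h f x hx => ?_, fun z h f x hx => ?_⟩
  · refine ((hfull z (hd z (Or.inl h)) (hU z (Or.inl h)) (hTτ.trans h) f x hx).1).trans ?_
    exact mul_le_mul_of_nonneg_right (le_max_left _ _) (foldLap_nonneg (fun _ => norm_nonneg _) _ _)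
  · refine ((hfull z (hd z (Or.inl h)) (hU z (Or.inl h)) (hTτ.trans h) f x hx).2).trans ?_
    exact mul_le_mul_of_nonneg_right (le_max_left _ _)
      (mul_nonneg (foldLap_nonneg (fun _ => norm_nonneg _) _ _)
        (foldLap_nonneg (potSize_nonneg P Q) _ _))

variable (B) in
/-- The difference of the perturbed and the free resolvent. -/
def resDiff (z : ℂ) : H →L[ℂ] X := fullRes hP hQ B z - freeRes B z

variable {hP hQ} {m T₀ δ C : ℝ} {N₀ : ℕ}

/-- Evaluation of an operator at a vector and a point. -/
def evalAt (F : H) (x : ℝ) : (H →L[ℂ] X) →L[ℂ] C2 :=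
  BoundedContinuousFunction.evalCLM ℂ x ∘L ContinuousLinearMap.apply ℂ X F

namespace ResolventBounds

theorem isResolventAt_full (h : ResolventBounds hP hQ B m N₀ T₀ δ C) {z : ℂ}
    (hz : z ∈ contourRegion m N₀ T₀) :
    IsResolventAt (diracOp B P Q) z (toH ∘L fullRes hP hQ B z) :=
  isResolventAt_fullRes h.δ_pos (h.charDet z hz) (h.isUnit z hz)

theorem isResolventAt_free (h : ResolventBounds hP hQ B m N₀ T₀ δ C) {z : ℂ}
    (hz : z ∈ contourRegion m N₀ T₀) :
    IsResolventAt (diracOp B 0 0) z (toH ∘L freeRes B z) := by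
  rw [← fullRes_zero]
  exact isResolventAt_fullRes h.δ_pos (h.charDet z hz) (isUnit_one_sub_bsOp_zero B z)

theorem differentiableOn_full (h : ResolventBounds hP hQ B m N₀ T₀ δ C) :
    DifferentiableOn ℂ (fullRes hP hQ B) (contourRegion m N₀ T₀) :=
  differentiableOn_of_resolvent_identity (J := toH) (fun z hz w hw => fullRes_sub h.δ_pos
    (h.charDet z hz) (h.charDet w hw) (h.isUnit z hz) (h.isUnit w hw)) h.norm_full

theorem differentiableOn_free (h : ResolventBounds hP hQ B m N₀ T₀ δ C) :
    DifferentiableOn ℂ (freeRes B) (contourRegion m N₀ T₀) := by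
  refine differentiableOn_of_resolvent_identity (J := toH) (fun z hz w hw => ?_) h.norm_free
  have := fullRes_sub (P := 0) (Q := 0) (hP := MemLp.zero) (hQ := MemLp.zero) h.δ_pos
    (h.charDet z hz) (h.charDet w hw) (isUnit_one_sub_bsOp_zero B z) (isUnit_one_sub_bsOp_zero B w)
  rwa [fullRes_zero, fullRes_zero] at this

theorem differentiableOn_resDiff (h : ResolventBounds hP hQ B m N₀ T₀ δ C) :
    DifferentiableOn ℂ (resDiff hP hQ B) (contourRegion m N₀ T₀) :=
  differentiableOn_clm_sub h.differentiableOn_full h.differentiableOn_free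

theorem differentiableOn_resDiff_apply (h : ResolventBounds hP hQ B m N₀ T₀ δ C) (F : H) (x : ℝ) :
    DifferentiableOn ℂ (fun z => resDiff hP hQ B z F x) (contourRegion m N₀ T₀) :=
  differentiableOn_clm_apply h.differentiableOn_resDiff (evalAt F x)

/-- Both resolvents factor through continuous functions, so the operator integral can be formed
there, where evaluation at a vector and a point is a bounded functional and commutes with
integration. This reduces the claim to vector-valued contour integrals for each x. -/
theorem rieszProj_sub_apply (h : ResolventBounds hP hQ B m N₀ T₀ δ C) {N : ℕ} (hN : N₀ ≤ N)
    (hNe : Even N) {T : ℝ} (hT : T₀ ≤ T) (F : H) :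
    (rieszProj (diracOp B P Q) m N T - rieszProj (diracOp B 0 0) m N T) F =ᵐ[mu] fun x =>
      (2 * π * Complex.I : ℂ)⁻¹ • rectIntegral (fun z => resDiff hP hQ B z F x)
        (m - (N + 1)) (m + (N + 1)) (-T) T := by
  have hsub := rectBoundary_subset_contourRegion (m := m) hT hN hNe
  have hfull := rectIntegrable_of_continuousOn (G := H →L[ℂ] X)
    (h.differentiableOn_full.continuousOn.mono hsub)
  have hfree := rectIntegrable_of_continuousOn (G := H →L[ℂ] X)
    (h.differentiableOn_free.continuousOn.mono hsub)
  have hdiff : RectIntegrable (resDiff hP hQ B) (m - (N + 1)) (m + (N + 1)) (-T) T :=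
    rectIntegrable_of_continuousOn (G := H →L[ℂ] X) (h.differentiableOn_resDiff.continuousOn.mono hsub)
  set L := ContinuousLinearMap.compL ℂ H X H toH with hL
  set D := rectIntegral (resDiff hP hQ B) (m - (N + 1)) (m + (N + 1)) (-T) T with hD
  have e : rieszProj (diracOp B P Q) m N T - rieszProj (diracOp B 0 0) m N T =
      (2 * π * Complex.I : ℂ)⁻¹ • L D := by
    rw [rieszProj, rieszProj, ← smul_sub,
      rectIntegral_congr fun z hz => resolventOf_eq (h.isResolventAt_full (hsub hz)),
      rectIntegral_congr fun z hz => resolventOf_eq (h.isResolventAt_free (hsub hz))]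
    congr 1
    have e1 := rectIntegral_clm L hfull
    have e2 := rectIntegral_clm L hfree
    refine (congr_arg₂ (· - ·) e1 e2).trans ?_
    rw [← map_sub]
    exact congr_arg L (rectIntegral_sub hfull hfree)
  rw [e]
  filter_upwards [Lp.coeFn_smul (2 * π * Complex.I : ℂ)⁻¹ (toH (D F)), coeFn_toH (D F)]
    with x h1 h2
  refine h1.trans ?_
  rw [Pi.smul_apply, h2]
  congr 1
  exact (rectIntegral_clm (evalAt F x) hdiff).symm

theorem rectIntegral_eq (h : ResolventBounds hP hQ B m N₀ T₀ δ C) {N : ℕ} (hN : N₀ ≤ N)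
    (hNe : Even N) {T T' : ℝ} (hT : T₀ ≤ T) (hT' : T ≤ T') (F : H) (x : ℝ) :
    rectIntegral (fun z => resDiff hP hQ B z F x) (m - (N + 1)) (m + (N + 1)) (-T) T =
      rectIntegral (fun z => resDiff hP hQ B z F x) (m - (N + 1)) (m + (N + 1)) (-T') T' :=
  rectIntegral_eq_of_differentiableOn (h.differentiableOn_resDiff_apply F x)
    hT' (fun _ hz => Or.inl (hT.trans hz)) fun _ hz =>
    rectBoundary_subset_contourRegion hT hN hNe (Or.inr hz)

end ResolventBounds

/-! ### Estimates of the contour integral of the resolvent difference -/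

theorem norm_rectIntegral_le_of_bound {G : Type*} [NormedAddCommGroup G] [NormedSpace ℂ G]
    {f : ℂ → G} {a b c d K₁ K₂ : ℝ} (hab : a ≤ b) (hcd : c ≤ d)
    (h₁ : ∀ z : ℂ, z.im = c ∨ z.im = d → ‖f z‖ ≤ K₁)
    (h₂ : ∀ z : ℂ, z.re = a ∨ z.re = b → ‖f z‖ ≤ K₂) :
    ‖rectIntegral f a b c d‖ ≤ 2 * (K₁ * (b - a)) + 2 * (K₂ * (d - c)) := by
  have e₁ : ∀ t : ℝ, t = c ∨ t = d → ‖∫ x in a..b, f (x + t * Complex.I)‖ ≤ K₁ * (b - a) := by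
    intro t ht
    rw [← abs_of_nonneg (sub_nonneg.2 hab)]
    exact intervalIntegral.norm_integral_le_of_norm_le_const fun x _ => h₁ _ (by simpa using ht)
  have e₂ : ∀ x : ℝ, x = a ∨ x = b → ‖Complex.I • ∫ t in c..d, f (x + t * Complex.I)‖ ≤
      K₂ * (d - c) := by
    intro x hx
    rw [norm_smul, Complex.norm_I, one_mul, ← abs_of_nonneg (sub_nonneg.2 hcd)]
    exact intervalIntegral.norm_integral_le_of_norm_le_const fun x _ => h₂ _ (by simpa using hx)
  unfold rectIntegral
  refine (norm_sub_le _ _).trans ?_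
  have h3 := norm_add_le ((∫ x in a..b, f (x + c * Complex.I)) - (∫ x in a..b, f (x + d * Complex.I)))
    (Complex.I • (∫ t in c..d, f (b + t * Complex.I)))
  have h4 := norm_sub_le (∫ x in a..b, f (x + c * Complex.I)) (∫ x in a..b, f (x + d * Complex.I))
  linarith [e₁ c (Or.inl rfl), e₁ d (Or.inr rfl), e₂ a (Or.inl rfl), e₂ b (Or.inr rfl)]

theorem exists_isTest_norm_sub_le (F : H) {ε : ℝ} (hε : 0 < ε) :
    ∃ (p q : ℝ → ℂ) (hp : IsTest p) (hq : IsTest q),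
      ‖F - (memLp_mk hp.memLp hq.memLp).toLp _‖ ≤ ε := by
  have hF : ∀ i, MemLp (fun x => F x i) 2 mu := memLp_coord (Lp.memLp F)
  obtain ⟨p, hp, hpε⟩ := exists_isTest_eLpNorm_sub_le (hF 0) (half_pos hε)
  obtain ⟨q, hq, hqε⟩ := exists_isTest_eLpNorm_sub_le (hF 1) (half_pos hε)
  refine ⟨p, q, hp, hq, ?_⟩
  have hp' := (hF 0).sub hp.memLp
  have hq' := (hF 1).sub hq.memLp
  have h1 := toReal_eLpNorm_potSize_le hp' hq'
  have h2 : ‖F - (memLp_mk hp.memLp hq.memLp).toLp _‖ ≤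
      1 * ‖(memLp_potSize hp' hq').toLp _‖ := by
    refine Lp.norm_le_mul_norm_of_ae_le_mul ?_
    filter_upwards [Lp.coeFn_sub F ((memLp_mk hp.memLp hq.memLp).toLp _),
      (memLp_mk hp.memLp hq.memLp).coeFn_toLp, (memLp_potSize hp' hq').coeFn_toLp] with x e1 e2 e3
    rw [e1, Pi.sub_apply, e2, e3, Real.norm_of_nonneg (potSize_nonneg _ _ x), one_mul]
    refine (norm_C2_le _).trans (le_of_eq ?_)
    simp [potSize]
  rw [Lp.norm_toLp, one_mul] at h2
  linarith

variable {P Q : ℝ → ℂ} {hP : MemLp P 2 mu} {hQ : MemLp Q 2 mu} {B : Matrix (Fin 2) (Fin 4) ℂ}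
  {m T₀ δ C : ℝ} {N₀ : ℕ}

/-- Second resolvent identity with R⁰ applied to F first, so that the decay of R⁰ on test functions
can be used. -/
theorem resDiff_apply_eq {z : ℂ} (h : IsUnit (1 - bsOp hP hQ B z)) (F : H) :
    resDiff hP hQ B z F = fullRes hP hQ B z (potOp hP hQ (freeRes B z F)) := by
  have h1 := (eq_fullRes_iff h (f := F)).1 rfl
  refine (eq_fullRes_iff h).2 ?_
  have e : resDiff hP hQ B z F = fullRes hP hQ B z F - freeRes B z F := rfl
  rw [← map_add, e]
  have e2 : freeRes B z F + (fullRes hP hQ B z F - freeRes B z F) = fullRes hP hQ B z F :=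
    add_sub_cancel _ _
  rw [e2]
  rw [map_add] at h1
  exact sub_eq_iff_eq_add'.2 h1

namespace ResolventBounds

theorem norm_resDiff_le (h : ResolventBounds hP hQ B m N₀ T₀ δ C) {z : ℂ}
    (hz : z ∈ contourRegion m N₀ T₀) (F : H) : ‖resDiff hP hQ B z F‖ ≤ 2 * C * ‖F‖ := by
  have h1 := (fullRes hP hQ B z).le_of_opNorm_le (h.norm_full z hz) F
  have h2 := (freeRes B z).le_of_opNorm_le (h.norm_free z hz) F
  have h3 : ‖resDiff hP hQ B z F‖ ≤ ‖fullRes hP hQ B z F‖ + ‖freeRes B z F‖ := norm_sub_le _ _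
  linarith

theorem norm_rectIntegral_resDiff_le (h : ResolventBounds hP hQ B m N₀ T₀ δ C) :
    ∃ K, 0 ≤ K ∧ ∀ N : ℕ, N₀ ≤ N → Even N → T₀ ≤ N + 1 → ∀ F : H, ∀ x ∈ Icc 0 π,
      ‖rectIntegral (fun z => resDiff hP hQ B z F x)
        (m - (N + 1)) (m + (N + 1)) (-(N + 1)) (N + 1)‖ ≤ K * ‖F‖ := by
  set Nv := (eLpNorm (potSize P Q) 2 mu).toReal with hNv
  have hNv0 : 0 ≤ Nv := ENNReal.toReal_nonneg
  have hC := h.C_pos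
  have hT₀ := h.T₀_pos
  refine ⟨16 * C * Nv + 2 * (2 * C * (2 * T₀) + C * (16 * π * Nv)), by positivity,
    fun N hN hNe hNT F x hx => ?_⟩
  set M : ℝ := N + 1 with hM
  have hM0 : 0 < M := by positivity
  set f : ℂ → C2 := fun z => resDiff hP hQ B z F x with hf
  have hsub : rectBoundary (m - M) (m + M) (-M) M ⊆ contourRegion m N₀ T₀ :=
    rectBoundary_subset_contourRegion hNT hN hNe
  have hint : RectIntegrable f (m - M) (m + M) (-M) M :=
    rectIntegrable_of_continuousOn ((h.differentiableOn_resDiff_apply F x).continuousOn.mono hsub)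
  have hle : ∀ z ∈ contourRegion m N₀ T₀, ‖f z‖ ≤ 2 * C * ‖F‖ := fun z hz =>
    ((resDiff hP hQ B z F).norm_coe_le_norm x).trans (h.norm_resDiff_le hz F)
  have hdiff : ∀ z : ℂ, T₀ ≤ |z.im| → ‖f z‖ ≤
      C * (foldLap (|z.im| / 2) x (fun s => ‖F s‖) * foldLap (|z.im| / 2) x (potSize P Q)) :=
    fun z hz => h.diff_le z hz F x hx
  have hpot := memLp_potSize hP hQ
  -- At height M each of the two transforms is O(M^(-1/2)), which compensates the length 2M.
  have hhor : ∀ c : ℝ, c = -M ∨ c = M →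
      ∫ x in (m - M)..(m + M), ‖f (x + c * Complex.I)‖ ≤ 8 * C * Nv * ‖F‖ := by
    intro c hc
    have hc' : |c| = M := by rcases hc with rfl | rfl <;> simp [abs_of_pos hM0]
    have hb : ∀ x : ℝ, ‖f (x + c * Complex.I)‖ ≤ C * (4 / M * (‖F‖ * Nv)) := by
      intro t
      have him : ((t : ℂ) + c * Complex.I).im = c := by simp
      refine (hdiff _ (by rw [him, hc']; exact hNT)).trans ?_
      rw [him, hc']
      have h1 := foldLap_le_sqrt (memLp_norm F) (fun _ => norm_nonneg _) (half_pos hM0) x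
      have h2 := foldLap_le_sqrt hpot (potSize_nonneg P Q) (half_pos hM0) x
      rw [eLpNorm_norm_toReal] at h1
      have e : √(2 / (M / 2)) * √(2 / (M / 2)) = 4 / M := by
        rw [Real.mul_self_sqrt (by positivity)]; field_simp; norm_num
      refine mul_le_mul_of_nonneg_left ?_ hC.le
      refine (mul_le_mul h1 h2 (foldLap_nonneg (potSize_nonneg P Q) _ _) (by positivity)).trans
        (le_of_eq ?_)
      rw [← e]; ring
    refine (le_abs_self _).trans ((intervalIntegral.norm_integral_le_of_norm_le_const
      (f := fun x : ℝ => ‖f (x + c * Complex.I)‖) (C := C * (4 / M * (‖F‖ * Nv)))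
      fun t _ => ?_).trans (le_of_eq ?_))
    · rw [norm_norm]; exact hb t
    · rw [show m + M - (m - M) = 2 * M by ring, abs_of_pos (by positivity)]
      field_simp; ring
  have hver : ∀ c : ℝ, c = m - M ∨ c = m + M →
      ∫ t in (-M)..M, ‖f (c + t * Complex.I)‖ ≤
        2 * C * ‖F‖ * (2 * T₀) + C * (16 * π * (‖F‖ * Nv)) := by
    intro c hc
    have hcI : IntervalIntegrable (fun t : ℝ => ‖f (c + t * Complex.I)‖) volume (-M) M := by
      rcases hc with rfl | rfl
      · exact hint.left.norm
      · exact hint.right.norm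
    have := integral_vertical_le (memLp_norm F) hpot (fun _ => norm_nonneg _) (potSize_nonneg P Q) x
      (A := 2 * C * ‖F‖) (by positivity) hC.le hT₀.le hM0.le (fun _ => norm_nonneg _) hcI
      (fun t _ => hle _ (hsub (Or.inr (by simpa using hc))))
      (fun t ht => by
        have him : ((c : ℂ) + t * Complex.I).im = t := by simp
        have := hdiff (c + t * Complex.I) (by rwa [him])
        rwa [him] at this)
    rwa [eLpNorm_norm_toReal] at this
  refine (norm_rectIntegral_le f (by linarith) (by linarith)).trans ?_
  have := hhor (-M) (Or.inl rfl)
  have := hhor M (Or.inr rfl)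
  have := hver _ (Or.inl rfl)
  have := hver _ (Or.inr rfl)
  calc _ ≤ 8 * C * Nv * ‖F‖ + 8 * C * Nv * ‖F‖ +
        (2 * C * ‖F‖ * (2 * T₀) + C * (16 * π * (‖F‖ * Nv))) +
        (2 * C * ‖F‖ * (2 * T₀) + C * (16 * π * (‖F‖ * Nv))) := by gcongr
    _ = _ := by ring

/-- On R v R⁰F the factor R⁰F is O(1/|z|). On horizontal sides R contributes another T^(-1/2), on
vertical sides it is bounded; multiplying by the side lengths gives the two terms. -/
theorem norm_rectIntegral_resDiff_test_le (h : ResolventBounds hP hQ B m N₀ T₀ δ C)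
    {p q : ℝ → ℂ} (hp : IsTest p) (hq : IsTest q) :
    ∃ K, 0 ≤ K ∧ ∀ N : ℕ, N₀ ≤ N → Even N → ∀ T : ℝ, T₀ ≤ T → ∀ x ∈ Icc 0 π,
      ‖rectIntegral (fun z => resDiff hP hQ B z ((memLp_mk hp.memLp hq.memLp).toLp _) x)
        (m - (N + 1)) (m + (N + 1)) (-T) T‖ ≤ K * ((N + 1) / (T * √T) + T / (N + 1)) := by
  obtain ⟨D, hD0, hD⟩ := freeRes_test B h.δ_pos hp hq
  set F : H := (memLp_mk hp.memLp hq.memLp).toLp _ with hF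
  have hC := h.C_pos
  set V := potOp hP hQ with hV
  have hg : ∀ z ∈ contourRegion m N₀ T₀, ∀ s : ℝ, 0 < s → s ≤ ‖z‖ →
      ‖V (freeRes B z F)‖ ≤ ‖V‖ * (D / s) := by
    intro z hz s hs hsz
    refine (V.le_opNorm _).trans (mul_le_mul_of_nonneg_left ?_ (norm_nonneg _))
    rw [le_div_iff₀ hs, mul_comm]
    exact (mul_le_mul_of_nonneg_right hsz (norm_nonneg _)).trans (hD z (h.charDet z hz))
  refine ⟨8 * C * ‖V‖ * D, by positivity, fun N hN hNe T hT x hx => ?_⟩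
  have hT0 : 0 < T := h.T₀_pos.trans_le hT
  set M : ℝ := N + 1 with hM
  have hM0 : 0 < M := by positivity
  have hsub : rectBoundary (m - M) (m + M) (-T) T ⊆ contourRegion m N₀ T₀ :=
    rectBoundary_subset_contourRegion hT hN hNe
  have hN₀M : (N₀ : ℝ) ≤ M := by
    have : (N₀ : ℝ) ≤ N := by exact_mod_cast hN
    linarith
  refine (norm_rectIntegral_le_of_bound (K₁ := C * (2 / √T * (‖V‖ * (D / T))))
    (K₂ := C * (‖V‖ * (D / (M / 2)))) (by linarith) (by linarith) ?_ ?_).trans (le_of_eq ?_)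
  · intro z hz
    have hzr : z ∈ contourRegion m N₀ T₀ := hsub (Or.inl hz)
    have him : |z.im| = T := by rcases hz with hz | hz <;> rw [hz] <;> simp [abs_of_pos hT0]
    rw [resDiff_apply_eq (h.isUnit z hzr)]
    refine (h.full_le z (by rw [him]; exact hT) _ x hx).trans
      (mul_le_mul_of_nonneg_left ?_ hC.le)
    rw [him]
    refine (foldLap_le_sqrt (memLp_norm _) (fun _ => norm_nonneg _) (half_pos hT0) x).trans ?_
    rw [eLpNorm_norm_toReal]
    have e : √(2 / (T / 2)) = 2 / √T := by
      rw [show 2 / (T / 2) = 2 ^ 2 / T by field_simp, Real.sqrt_div (by positivity),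
        Real.sqrt_sq (by norm_num)]
    rw [e]
    exact mul_le_mul_of_nonneg_left (hg z hzr T hT0 (him ▸ Complex.abs_im_le_norm z))
      (by positivity)
  · intro z hz
    have hzr : z ∈ contourRegion m N₀ T₀ := hsub (Or.inr hz)
    have hre : |z.re - m| = M := by rcases hz with hz | hz <;> rw [hz] <;> simp [abs_of_pos hM0]
    rw [resDiff_apply_eq (h.isUnit z hzr)]
    refine ((BoundedContinuousFunction.norm_coe_le_norm _ x).trans
      ((fullRes hP hQ B z).le_of_opNorm_le (h.norm_full z hzr) _)).trans
      (mul_le_mul_of_nonneg_left ?_ hC.le)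
    exact hg z hzr _ (half_pos hM0) (half_le_norm_of_abs_re_sub h.le_N₀ hN₀M hre)
  · have hs : √T ≠ 0 := (Real.sqrt_pos.2 hT0).ne'
    field_simp
    ring

/-- F is split into a test function G and a remainder of small norm. The two integrals are moved to
different heights: N + 1 for the remainder, where the uniform bound holds, and (N + 1)^(3/4) for G.
-/
theorem eventually_norm_rectIntegral_resDiff_le (h : ResolventBounds hP hQ B m N₀ T₀ δ C)
    {T : ℝ} (hT : T₀ ≤ T) (F : H) {ε : ℝ} (hε : 0 < ε) :
    ∀ᶠ n : ℕ in atTop, ∀ x ∈ Icc 0 π, ‖rectIntegral (fun z => resDiff hP hQ B z F x)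
      (m - ((2 * n : ℕ) + 1)) (m + ((2 * n : ℕ) + 1)) (-T) T‖ ≤ ε := by
  obtain ⟨K, hK0, hK⟩ := h.norm_rectIntegral_resDiff_le
  obtain ⟨p, q, hp, hq, hpq⟩ := exists_isTest_norm_sub_le F (ε := ε / 2 / (K + 1)) (by positivity)
  set G : H := (memLp_mk hp.memLp hq.memLp).toLp _ with hG
  obtain ⟨L, hL0, hL⟩ := h.norm_rectIntegral_resDiff_test_le hp hq
  have hM : Tendsto (fun n : ℕ => ((2 * n : ℕ) : ℝ) + 1) atTop atTop :=
    tendsto_atTop_add_const_right _ _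
      (tendsto_natCast_atTop_atTop.comp (tendsto_id.const_mul_atTop' two_pos))
  -- The eighth root r of N + 1 makes the height r⁶ a polynomial with square root r³; the two terms
  -- for G become r⁸/r⁹ = r⁻¹ and r⁶/r⁸ = r⁻².
  have hr : Tendsto (fun n : ℕ => √√√(((2 * n : ℕ) : ℝ) + 1)) atTop atTop :=
    Real.tendsto_sqrt_atTop.comp (Real.tendsto_sqrt_atTop.comp (Real.tendsto_sqrt_atTop.comp hM))
  have hr6 := (tendsto_pow_atTop (α := ℝ) (n := 6) (by norm_num)).comp hr
  have hlim : Tendsto (fun n : ℕ => L * ((√√√(((2 * n : ℕ) : ℝ) + 1))⁻¹ +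
      (√√√(((2 * n : ℕ) : ℝ) + 1))⁻¹ ^ 2)) atTop (𝓝 0) := by
    have h0 := tendsto_inv_atTop_zero.comp hr
    simpa using (h0.add (h0.pow 2)).const_mul L
  filter_upwards [hM.eventually_ge_atTop T, hr6.eventually_ge_atTop T, hr.eventually_gt_atTop 0,
    hlim.eventually (eventually_le_nhds (half_pos hε)), eventually_ge_atTop N₀]
    with n hn1 hn2 hn3 hn4 hn5 x hx
  have hN : N₀ ≤ 2 * n := by omega
  have hNe : Even (2 * n) := even_two_mul n
  have hGb : ‖rectIntegral (fun z => resDiff hP hQ B z G x)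
      (m - ((2 * n : ℕ) + 1)) (m + ((2 * n : ℕ) + 1)) (-T) T‖ ≤ ε / 2 := by
    set r := √√√(((2 * n : ℕ) : ℝ) + 1) with hrdef
    have hr8 : ((2 * n : ℕ) : ℝ) + 1 = r ^ 8 := by
      have e : r ^ 8 = ((r ^ 2) ^ 2) ^ 2 := by ring
      rw [e, hrdef, Real.sq_sqrt (by positivity), Real.sq_sqrt (by positivity),
        Real.sq_sqrt (by positivity)]
    have hr6' : T ≤ r ^ 6 := hn2
    rw [h.rectIntegral_eq hN hNe hT hr6' G x]
    refine (hL (2 * n) hN hNe (r ^ 6) (hT.trans hr6') x hx).trans (le_trans (le_of_eq ?_) hn4)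
    have hs : √(r ^ 6) = r ^ 3 := by
      rw [show r ^ 6 = (r ^ 3) ^ 2 by ring, Real.sqrt_sq (by positivity)]
    rw [hs, hr8]
    field_simp
  have hFG : ‖rectIntegral (fun z => resDiff hP hQ B z (F - G) x)
      (m - ((2 * n : ℕ) + 1)) (m + ((2 * n : ℕ) + 1)) (-T) T‖ ≤ ε / 2 := by
    rw [h.rectIntegral_eq hN hNe hT hn1 (F - G) x]
    refine (hK (2 * n) hN hNe (hT.trans hn1) (F - G) x hx).trans ?_
    refine (mul_le_mul_of_nonneg_left hpq hK0).trans ?_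
    rw [mul_div_assoc', div_le_iff₀ (by positivity)]
    nlinarith
  have hint : ∀ E : H, RectIntegrable (fun z => resDiff hP hQ B z E x)
      (m - ((2 * n : ℕ) + 1)) (m + ((2 * n : ℕ) + 1)) (-T) T := fun E =>
    rectIntegrable_of_continuousOn ((h.differentiableOn_resDiff_apply E x).continuousOn.mono
      (rectBoundary_subset_contourRegion hT hN hNe))
  have e := rectIntegral_sub (hint F) (hint G)
  have e2 : (fun z => resDiff hP hQ B z F x - resDiff hP hQ B z G x) =
      fun z => resDiff hP hQ B z (F - G) x := by
    funext z
    rw [map_sub]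
    rfl
  rw [e2, sub_eq_iff_eq_add] at e
  rw [e]
  refine (norm_add_le _ _).trans ?_
  linarith

end ResolventBounds

end DiracBVP

end

theorem theorem4 (B : Matrix (Fin 2) (Fin 4) ℂ) (hB : IsRegularBC B)
    (τ₁ τ₂ : ℂ) (hτ : IsExponentPair B τ₁ τ₂)
    (P Q : ℝ → ℂ) (hP : MemLp P 2 mu) (hQ : MemLp Q 2 mu) :
    ∃ (N₀ : ℕ) (T₀ : ℝ), 0 < T₀ ∧
      -- all contours `∂R_{NT}` with `N ≥ N₀` even and `T ≥ T₀` avoid both spectra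
      (∀ z : ℂ, (T₀ ≤ |z.im| ∨
          ∃ N : ℕ, N₀ ≤ N ∧ Even N ∧ |z.re - (τ₁.re + τ₂.re) / 2| = N + 1) →
        z ∈ resolventSetOf (diracOp B P Q) ∧ z ∈ resolventSetOf (diracOp B 0 0)) ∧
      -- equiconvergence
      ∀ (F₁ F₂ : ℝ → ℂ) (F : H), (F =ᵐ[mu] fun x => !₂[F₁ x, F₂ x]) →
        (LogFourierCondition F₁ F₂ ∨ LogFourierCondition P Q ∨
          (BoundedVariationOn F₁ (Icc 0 π) ∧ BoundedVariationOn F₂ (Icc 0 π)) ∨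
          (BoundedVariationOn P (Icc 0 π) ∧ BoundedVariationOn Q (Icc 0 π))) →
        ∀ T : ℝ, T₀ ≤ T →
          Tendsto (fun n : ℕ => eLpNorm
            ((rieszProj (diracOp B P Q) ((τ₁.re + τ₂.re) / 2) (2 * n : ℕ) T -
              rieszProj (diracOp B 0 0) ((τ₁.re + τ₂.re) / 2) (2 * n : ℕ) T) F) ∞ mu)
            atTop (𝓝 0) := by
  obtain ⟨N₀, T₀, δ, C, h⟩ := exists_resolventBounds hP hQ hB hτ
  refine ⟨N₀, T₀, h.T₀_pos, fun z hz => ⟨⟨_, h.isResolventAt_full hz⟩, ⟨_, h.isResolventAt_free hz⟩⟩,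
    fun _ _ F _ _ T hT => ?_⟩
  rw [ENNReal.tendsto_nhds_zero]
  intro ε hε
  -- As ε may be infinite, it is replaced by a smaller positive real number.
  obtain ⟨ε', hε', hεε⟩ := ENNReal.lt_iff_exists_nnreal_btwn.1 hε
  have hε'0 : (0 : ℝ) < ε' := by exact_mod_cast hε'
  filter_upwards [h.eventually_norm_rectIntegral_resDiff_le hT F hε'0, eventually_ge_atTop N₀]
    with n hn hnN
  have hN : N₀ ≤ 2 * n := by omega
  refine le_trans ?_ hεε.le
  rw [eLpNorm_exponent_top, ← ENNReal.ofReal_coe_nnreal]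
  refine eLpNormEssSup_le_of_ae_bound ?_
  filter_upwards [h.rieszProj_sub_apply hN (even_two_mul n) hT F, ae_restrict_mem measurableSet_Icc]
    with x h1 hx
  rw [h1, norm_smul]
  have hc : ‖(2 * π * Complex.I : ℂ)⁻¹‖ ≤ 1 := by
    rw [norm_inv]
    refine inv_le_one_of_one_le₀ ?_
    simp only [norm_mul, Complex.norm_ofNat, Complex.norm_real, Complex.norm_I, mul_one,
      Real.norm_eq_abs, abs_of_pos Real.pi_pos]
    linarith [Real.pi_gt_three]
  exact (mul_le_of_le_one_left (norm_nonneg _) hc).trans (hn x hx)
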